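/- **Setting.** Let $L=L_C+L_F\ge 1$, let $p\ge 0$, and let $f(\mathbf x;\Theta)$ be a ReLU network on $\mathbb R^d$ ($d=m_0$, all $m_l,s_l\ge1$) with $L_C$ convolutional layers $$y^{(l)}_k=\sigma\Big(\sum_{i=1}^{s_l}w^{(l)}_i z^{(l-1)}_{k+i-1}\Big)\ (1\le k\le m_ls_l),\qquad z^{(l)}_k=\frac1{s_l}\sum_{j=1}^{s_l}y^{(l)}_{(k-1)s_l+j}\ (1\le k\le m_l),\qquad m_ls_l+s_l-1\le m_{l-1},$$ followed by $L_F$ fully connected layers $\mathbf z^{(l)}=\sigma(\mathbf A^{(l)\top}\mathbf z^{(l-1)})$ and the output $f(\mathbf x;\Theta)=m^{-p}\sum_{k=1}^m a_kz^{(L)}_k$, where $\sigma(z)=\max\{z,0\}$, $\mathbf z^{(0)}=\mathbf x$, $m=m_L$, and $\Theta$ collects all parameters; layer $l\in\{1,\dots,L+1\}$ has $q(l)$ of them. Put $C_{L,d}=\sqrt{2(L+1)\log 2}+1$ if $L_C=0$ and $C_{L,d}=2\sqrt{(L+2+\log d)\,d}$ otherwise. Let $0<C_y\le1$, let $\mu$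 be a probability measure on $\mathbb R^d\times\mathbb R$ with $\|\mathbf x\|_2\le1$ and $|y|\le C_y$ almost surely, and let $(\mathbf x_i,y_i)_{i=1}^n$, $n\ge1$, be i.i.d. with law $\mu$. Write $$\mathcal L_\mu(\Theta)=\tfrac12\,\mathbb E_\mu\big(f(\mathbf x;\Theta)-y\big)^2,\qquad \mathcal L_n(\Theta)=\frac1{2n}\sum_{i=1}^n\big(f(\mathbf x_i;\Theta)-y_i\big)^2,\qquad \mathcal E_{\rm gen}=\mathcal L_\mu-\mathcal L_n .$$ Independently of the sample, let the entries of $\Theta(0)$ be independent, those of layer $l$ with law $\mathcal N(0,\kappa^2/q(l))$, where $\kappa>0$. Gradient descent is $\Theta(t+1)=\Theta(t)-\eta_t\nabla\mathcal L_n(\Theta(t))$, where at points of non-smoothness of $\mathcal L_n$ any element of the Clarke generalized gradient may be used for $\nabla\mathcal L_n$, with $$\eta_t=\eta\Big/\Big\lceil\tfrac{t+1}{T_0}\Big\rceil^{\alpha},\qquad T_0\in\mathbb N_{\ge1},\quad \alpha\in\Big(\tfrac{L+1}{L+2},1\Big].$$ **Theorem.** There is an absolute constant $K>0$ such that for all $L\ge1$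 and $\delta\in(0,1)$ there are constants $C,c>0$, depending only on $L$ and $\delta$, with the following property. In the setting above, let $C_f>0$, $\varepsilon\in(0,1)$, and $$0<\eta\le c\,\min\left\{\frac{m^pL^{\frac{L-1}2}\sqrt{\min\{\varepsilon,(L+2)\alpha-(L+1)\}}}{(C_f+C_y)\,T_0^{\frac{1+\varepsilon}2}\kappa^{L-1}},\ \frac{\kappa^2(1-\varepsilon)}{C_y^2T_0}\right\}.$$ Then for every $T\ge0$, with probability at least $1-\delta$ over the sample and the initialization, every run of gradient descent with $|f(\cdot;\Theta(t))|\le C_f$ $\mu$-almost everywhere for all $0\le t\le T$ satisfies $C\kappa^2+\mathsf{CL}(T)\ge0$ and $$\mathcal E_{\rm gen}(\Theta(T))\le K\left[(C_f+C_y)\frac{C_{L,d}}{m^p\sqrt n}\big(C\kappa^2+\mathsf{CL}(T)\big)^{\frac{L+1}2}+(C_f+C_y)^2\sqrt{\frac{\log(2/\delta)}n}\right],$$ where $$\mathsf{CL}(T)=\sum_{t=0}^{T-1}2\eta_t\sqrt{2\mathcal L_n(\Theta(t))}\Big(C_y-\sqrt{2\mathcal L_n(\Theta(t))}\Big).$$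 -/

import Mathlib

open MeasureTheory ProbabilityTheory Filter Topology

/-- Architecture of a network with `LC` convolutional layers (convolution, ReLU, average pooling)
followed by `LF` fully connected ReLU layers and a linear output layer.
`m l` is the dimension of the `l`-th feature vector, `m 0 = d` is the input dimension, and `s l` is
the size of the kernel and of the pooling window of the convolutional layer that maps `m l` features
to `m (l + 1)` features. -/
structure Arch where
  LC : ℕ
  LF : ℕ
  m : ℕ → ℕ
  s : ℕ → ℕ
  depth_pos : 1 ≤ LC + LF
  m_pos : ∀ l, l ≤ LC + LF → 1 ≤ m l
  s_pos : ∀ l, l < LC → 1 ≤ s l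
  /-- The `m (l + 1) * s l` windows of length `s l` of the convolution fit into the input. -/
  fits : ∀ l, l < LC → m (l + 1) * s l + s l - 1 ≤ m l

namespace Arch

/-- `L`, the number of hidden layers; together with the output layer there are `L + 1` layers. -/
abbrev L (A : Arch) : ℕ := A.LC + A.LF

/-- Input dimension. -/
abbrev d (A : Arch) : ℕ := A.m 0

/-- Width `m = m_L` of the last hidden layer. -/
abbrev width (A : Arch) : ℕ := A.m (A.LC + A.LF)

/-- Index set of all parameters: the kernels `w`, the matrices `A` of the fully connected layers,
and the output weights `a`. -/
abbrev Idx (A : Arch) : Type :=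
  (Σ l : Fin A.LC, Fin (A.s l)) ⊕
    ((Σ l : Fin A.LF, Fin (A.m (A.LC + l)) × Fin (A.m (A.LC + l + 1))) ⊕ Fin A.width)

/-- Parameter vectors `Θ`. -/
abbrev Params (A : Arch) : Type := A.Idx → ℝ

/-- The number `q(l)` of parameters of the layer `l` to which the given parameter belongs. -/
def layerSize (A : Arch) : A.Idx → ℕ
  | Sum.inl ⟨l, _⟩ => A.s l
  | Sum.inr (Sum.inl ⟨l, _⟩) => A.m (A.LC + l) * A.m (A.LC + l + 1)
  | Sum.inr (Sum.inr _) => A.width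

theorem conv_index_lt (A : Arch) {l : ℕ} (hl : l < A.LC) (k : Fin (A.m (l + 1)))
    (j i : Fin (A.s l)) : (k : ℕ) * A.s l + j + i < A.m l := by
  have h1 := A.fits l hl
  have h2 : ((k : ℕ) + 1) * A.s l ≤ A.m (l + 1) * A.s l := Nat.mul_le_mul_right _ k.2
  have h3 := j.2
  have h4 := i.2
  rw [Nat.add_mul, one_mul] at h2
  omega

/-- The feature vector after `l` convolutional layers: convolution with the kernel, ReLU, and
average pooling over consecutive disjoint windows. -/
noncomputable def convFeature (A : Arch) (Θ : A.Params) (x : Fin A.d → ℝ) :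
    (l : ℕ) → l ≤ A.LC → Fin (A.m l) → ℝ
  | 0, _ => x
  | l + 1, h => fun k =>
      (1 / (A.s l : ℝ)) * ∑ j : Fin (A.s l),
        max (∑ i : Fin (A.s l), Θ (Sum.inl ⟨⟨l, h⟩, i⟩) *
          A.convFeature Θ x l (Nat.le_of_succ_le h)
            ⟨(k : ℕ) * A.s l + j + i, A.conv_index_lt h k j i⟩) 0

/-- The feature vector after all convolutional layers and `l` fully connected layers. -/
noncomputable def fcFeature (A : Arch) (Θ : A.Params) (x : Fin A.d → ℝ) :
    (l : ℕ) → l ≤ A.LF → Fin (A.m (A.LC + l)) → ℝ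
  | 0, _ => A.convFeature Θ x A.LC le_rfl
  | l + 1, h => fun j =>
      max (∑ i : Fin (A.m (A.LC + l)), Θ (Sum.inr (Sum.inl ⟨⟨l, h⟩, (i, j)⟩)) *
        A.fcFeature Θ x l (Nat.le_of_succ_le h) i) 0

/-- The network function `f(x; Θ)`, with the normalization factor `1 / m ^ p`. -/
noncomputable def net (A : Arch) (p : ℝ) (Θ : A.Params) (x : Fin A.d → ℝ) : ℝ :=
  (1 / (A.width : ℝ) ^ p) *
    ∑ k : Fin A.width, Θ (Sum.inr (Sum.inr k)) * A.fcFeature Θ x A.LF le_rfl k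

/-- The quadratic loss of `Θ` on one labelled example. -/
noncomputable def loss (A : Arch) (p : ℝ) (Θ : A.Params) (z : (Fin A.d → ℝ) × ℝ) : ℝ :=
  (1 / 2) * (A.net p Θ z.1 - z.2) ^ 2

/-- Population risk. -/
noncomputable def popRisk (A : Arch) (p : ℝ) (μ : Measure ((Fin A.d → ℝ) × ℝ))
    (Θ : A.Params) : ℝ :=
  ∫ z, A.loss p Θ z ∂μ

/-- Empirical risk on the training sample `S`. -/
noncomputable def empRisk (A : Arch) (p : ℝ) {n : ℕ} (S : Fin n → (Fin A.d → ℝ) × ℝ)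
    (Θ : A.Params) : ℝ :=
  (1 / (n : ℝ)) * ∑ i, A.loss p Θ (S i)

/-- Generalization error. -/
noncomputable def genError (A : Arch) (p : ℝ) (μ : Measure ((Fin A.d → ℝ) × ℝ)) {n : ℕ}
    (S : Fin n → (Fin A.d → ℝ) × ℝ) (Θ : A.Params) : ℝ :=
  A.popRisk p μ Θ - A.empRisk p S Θ

/-- Law of the random initialization: independent centred Gaussian parameters, with variance
`κ ^ 2 / q(l)` in layer `l`. -/
noncomputable def initLaw (A : Arch) (κ : ℝ) : Measure A.Params :=
  Measure.pi fun i => gaussianReal 0 (κ ^ 2 / (A.layerSize i : ℝ)).toNNReal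

open Classical in
/-- The constant `C_{L,d}`, for fully connected networks and for convolutional ones. -/
noncomputable def CLd (A : Arch) : ℝ :=
  if A.LC = 0 then Real.sqrt (2 * ((A.L : ℝ) + 1) * Real.log 2) + 1
  else 2 * Real.sqrt (((A.L : ℝ) + 2 + Real.log A.d) * A.d)

end Arch

/-- The vector of partial derivatives. -/
noncomputable def grad {ι : Type} [Fintype ι] [DecidableEq ι] (F : (ι → ℝ) → ℝ) (θ : ι → ℝ) :
    ι → ℝ :=
  fun i => fderiv ℝ F θ (Pi.single i 1)

/-- The (Clarke) generalized gradient: the convex hull of all limits of gradients of `F` at nearby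
points of differentiability. It contains `grad F θ` if `F` is differentiable at `θ`, and it is
`{grad F θ}` if `F` is continuously differentiable near `θ`. -/
def clarkeGrad {ι : Type} [Fintype ι] [DecidableEq ι] (F : (ι → ℝ) → ℝ) (θ : ι → ℝ) :
    Set (ι → ℝ) :=
  convexHull ℝ {v | ∃ u : ℕ → ι → ℝ, Tendsto u atTop (𝓝 θ) ∧ (∀ k, DifferentiableAt ℝ F (u k)) ∧
    Tendsto (fun k => grad F (u k)) atTop (𝓝 v)}

/-- The step sizes `η_t = η / ⌈(t + 1) / T₀⌉ ^ α`. -/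
noncomputable def stepSize (η α : ℝ) (T₀ t : ℕ) : ℝ :=
  η / (⌈((t : ℝ) + 1) / (T₀ : ℝ)⌉₊ : ℝ) ^ α

/-- `Θ 0, …, Θ T` are the iterates of full-batch gradient descent on the empirical risk. Where the
ReLU network makes the empirical risk non-differentiable, any generalized gradient may be used. -/
def IsGD (A : Arch) (p : ℝ) {n : ℕ} (S : Fin n → (Fin A.d → ℝ) × ℝ) (step : ℕ → ℝ) (T : ℕ)
    (Θ : ℕ → A.Params) : Prop :=
  ∀ t < T, ∃ g ∈ clarkeGrad (A.empRisk p S) (Θ t), Θ (t + 1) = Θ t - step t • g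

/-- The discrete cumulative loss `CL(T)` along the iterates `Θ`. -/
noncomputable def cumLoss (A : Arch) (p : ℝ) {n : ℕ} (S : Fin n → (Fin A.d → ℝ) × ℝ) (Cy : ℝ)
    (step : ℕ → ℝ) (Θ : ℕ → A.Params) (T : ℕ) : ℝ :=
  ∑ t ∈ Finset.range T, 2 * step t * Real.sqrt (2 * A.empRisk p S (Θ t)) *
    (Cy - Real.sqrt (2 * A.empRisk p S (Θ t)))

/-! Three arguments combine. Norm growth. The network is positively homogeneous in each layer
separately, so by Euler's identity the derivative of the empirical risk along the parameters of a
layer is the same number for every layer, the mean of `(f - y) f` (`fderiv_restrictLayer`). To first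
order, a gradient step therefore changes the squared norms of all layers equally, and by at most the
increment of the cumulative loss (`neg_radial_le`). The second order terms `η_t² ‖g_l‖²` are
controlled by the Lipschitz constant of the network on a ball whose radius must be known beforehand.
Since `2 s (C_y - s) ≤ C_y² / 2`, the cumulative loss has a deterministic upper bound; for `α > (L +
1) / (L + 2)` and small `η` the second order terms along the resulting radii sum to at most `κ²`
(`exists_radii`). With Markov's inequality for the initialization, every squared layer norm at time
`T` is at most `Cκ² + CL(T)` (`layerSq_le_of_isGD`). This also gives the nonnegativity of that
quantity. Complexity. Networks with layer norms at most `r` have Rademacher sums of order `m^{-p}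
r^{L+1} C_{L,d} √n` (`sum_signedSum_net_le`). The layers are peeled off inside an exponential
moment, where each ReLU costs a factor `2`; after Jensen's inequality these factors enter only
through their logarithm. Deviation. Symmetrization and bounded differences give a uniform deviation
bound for the truncated loss (`measure_exists_gap_le`). The radius is random, so the bound is
applied on dyadic levels, level `j` failing with probability at most `(δ/2) 2^{-(j+1)}`
(`measure_iUnion_badSamples_le`); the level fitting the final norms is used at the end
(`gap_le_of_notMem_badSamples`). Suprema over parameters inside an average over signs are expressed
by selections `h`, which assign a parameter to each sign vector: a bound for all selections replaces
a bound for the average of suprema, without attainment or boundedness questions. -/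

/-! ### Random signs: sub-Gaussian bounds and contraction -/

/-- The sign vector `ε` with its `i`-th sign flipped. -/
def flipSign {n : ℕ} (ε : Fin n → ℤˣ) (i : Fin n) : Fin n → ℤˣ := Function.update ε i (-ε i)

/-- The signed sum `∑ ε_i v_i`. -/
def signedSum {n : ℕ} (ε : Fin n → ℤˣ) (v : Fin n → ℝ) : ℝ := ∑ i, ((ε i : ℤ) : ℝ) * v i

/-- Hoeffding's lemma for two equally likely values, from `cosh t ≤ exp (t² / 2)` with `t = (a - b)
/ 2`. -/
theorem exp_add_exp_le {a b c : ℝ} (h : |a - b| ≤ c) :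
    Real.exp a + Real.exp b ≤ 2 * Real.exp ((a + b) / 2 + c ^ 2 / 8) := by
  have h1 : Real.exp a + Real.exp b = 2 * (Real.exp ((a + b) / 2) * Real.cosh ((a - b) / 2)) := by
    rw [Real.cosh_eq, mul_div_assoc', mul_add, ← Real.exp_add, ← Real.exp_add]
    ring_nf
  rw [h1, Real.exp_add]
  gcongr
  refine (Real.cosh_le_exp_half_sq _).trans (Real.exp_le_exp.2 ?_)
  have h2 : (a - b) ^ 2 ≤ c ^ 2 := sq_le_sq' (by linarith [(abs_le.1 h).1]) (abs_le.1 h).2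
  nlinarith

theorem sum_intUnits (f : ℤˣ → ℝ) : ∑ e, f e = f 1 + f (-1) :=
  Finset.sum_pair (a := (1 : ℤˣ)) (b := -1) (by decide)

theorem sum_signs_succ {n : ℕ} (F : (Fin (n + 1) → ℤˣ) → ℝ) :
    ∑ ε, F ε = ∑ ε : Fin n → ℤˣ, F (Fin.cons 1 ε) + ∑ ε : Fin n → ℤˣ, F (Fin.cons (-1) ε) := by
  rw [← (Fin.consEquiv (fun _ => ℤˣ)).sum_comp, Fintype.sum_prod_type, sum_intUnits]
  rfl

/-- A function on the cube that changes by at most `c` under a flip of one coordinate is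
sub-Gaussian. -/
theorem sum_exp_le_of_flip {n : ℕ} {c : ℝ} (F : (Fin n → ℤˣ) → ℝ)
    (h : ∀ ε i, |F ε - F (flipSign ε i)| ≤ c) :
    ∑ ε, Real.exp (F ε) ≤
      2 ^ n * Real.exp ((1 / 2 ^ n) * ∑ ε, F ε + n * c ^ 2 / 8) := by
  induction n with
  | zero => simp
  | succ n ih =>
    have key : ∀ a : ℤˣ, ∑ ε : Fin n → ℤˣ, Real.exp (F (Fin.cons a ε)) ≤
        2 ^ n * Real.exp ((1 / 2 ^ n) * ∑ ε : Fin n → ℤˣ, F (Fin.cons a ε) + n * c ^ 2 / 8) := by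
      intro a
      refine ih (fun ε => F (Fin.cons a ε)) fun ε i => ?_
      have := h (Fin.cons a ε) i.succ
      simpa [flipSign, Fin.cons_update] using this
    -- The averages conditioned on the first sign differ by at most `c`, so the two-point Hoeffding
    -- bound merges the two halves of the cube.
    have hd : |(1 / 2 ^ n) * ∑ ε : Fin n → ℤˣ, F (Fin.cons 1 ε) + n * c ^ 2 / 8 -
        ((1 / 2 ^ n) * ∑ ε : Fin n → ℤˣ, F (Fin.cons (-1) ε) + n * c ^ 2 / 8)| ≤ c := by
      rw [add_sub_add_right_eq_sub, ← mul_sub, ← Finset.sum_sub_distrib, abs_mul,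
        abs_of_nonneg (by positivity)]
      have h1 : |∑ ε : Fin n → ℤˣ, (F (Fin.cons 1 ε) - F (Fin.cons (-1) ε))| ≤ 2 ^ n * c := by
        refine (Finset.abs_sum_le_sum_abs _ _).trans ?_
        refine (Finset.sum_le_card_nsmul _ _ c fun ε _ => ?_).trans ?_
        · simpa [flipSign] using h (Fin.cons 1 ε) 0
        · simp
      rw [div_mul_eq_mul_div, one_mul, div_le_iff₀ (by positivity)]
      linarith
    rw [sum_signs_succ, sum_signs_succ]
    refine (add_le_add (key 1) (key (-1))).trans ?_
    rw [← mul_add]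
    refine (mul_le_mul_of_nonneg_left (exp_add_exp_le hd) (by positivity)).trans (le_of_eq ?_)
    rw [pow_succ (2 : ℝ), mul_assoc]
    congr 3
    push_cast
    field_simp
    ring

theorem flipSign_flipSign {n : ℕ} (ε : Fin n → ℤˣ) (i : Fin n) :
    flipSign (flipSign ε i) i = ε := by
  simp [flipSign]

theorem sum_flipSign {n : ℕ} (i : Fin n) (F : (Fin n → ℤˣ) → ℝ) :
    ∑ ε, F (flipSign ε i) = ∑ ε, F ε :=
  Equiv.sum_comp (Function.Involutive.toPerm (fun ε => flipSign ε i)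
    fun ε => flipSign_flipSign ε i) F

/-- Comparison in one coordinate: a pairwise inequality for the two values of the `i`-th sign
allows to replace `φ` by `ψ`, after a change of the selection `h`. -/
theorem exists_selection_coord {n : ℕ} {P : Type*} {G : ℝ → ℝ} {φ ψ : P → ℝ}
    (hG : ∀ a b p q, G (a + φ p) + G (b - φ q) ≤ G (a + ψ p) + G (b - ψ q) ∨
      G (a + φ p) + G (b - φ q) ≤ G (b + ψ q) + G (a - ψ p))
    (i : Fin n) (r : (Fin n → ℤˣ) → P → ℝ) (hr : ∀ ε p, r (flipSign ε i) p = r ε p)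
    (h : (Fin n → ℤˣ) → P) :
    ∃ h' : (Fin n → ℤˣ) → P, ∑ ε, G (r ε (h ε) + ((ε i : ℤ) : ℝ) * φ (h ε)) ≤
      ∑ ε, G (r ε (h' ε) + ((ε i : ℤ) : ℝ) * ψ (h' ε)) := by
  classical
  have key : ∀ F F' : (Fin n → ℤˣ) → ℝ,
      (∀ ε, F ε + F (flipSign ε i) ≤ F' ε + F' (flipSign ε i)) → ∑ ε, F ε ≤ ∑ ε, F' ε := by
    intro F F' hF
    have h1 := Finset.sum_le_sum fun ε (_ : ε ∈ Finset.univ) => hF ε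
    rw [Finset.sum_add_distrib, Finset.sum_add_distrib, sum_flipSign, sum_flipSign] at h1
    linarith
  -- Sign vectors are paired with their flips. Each pair either keeps its two selected points or
  -- exchanges them, according to the alternative of `hG` that holds; `keep` is invariant under the
  -- flip, so both members of a pair decide alike.
  let keep : (Fin n → ℤˣ) → Prop := fun ε =>
    G (r ε (h ε) + ((ε i : ℤ) : ℝ) * φ (h ε)) +
      G (r ε (h (flipSign ε i)) - ((ε i : ℤ) : ℝ) * φ (h (flipSign ε i))) ≤
    G (r ε (h ε) + ((ε i : ℤ) : ℝ) * ψ (h ε)) +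
      G (r ε (h (flipSign ε i)) - ((ε i : ℤ) : ℝ) * ψ (h (flipSign ε i)))
  have hfi : ∀ ε : Fin n → ℤˣ, (((flipSign ε i) i : ℤ) : ℝ) = -((ε i : ℤ) : ℝ) := by
    intro ε; simp [flipSign]
  have hkeep : ∀ ε, keep (flipSign ε i) ↔ keep ε := by
    intro ε
    simp only [keep, flipSign_flipSign, hr, hfi]
    constructor <;> intro h <;> ring_nf at h ⊢ <;> linarith
  refine ⟨fun ε => if keep ε then h ε else h (flipSign ε i), key _ _ fun ε => ?_⟩
  simp only [hkeep, flipSign_flipSign, hr, hfi]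
  by_cases hk : keep ε
  · simp only [hk, if_true]
    simp only [keep] at hk
    simp only [neg_mul, ← sub_eq_add_neg]
    exact hk
  · simp only [hk, if_false]
    simp only [keep] at hk
    rcases Int.units_eq_one_or (ε i) with h1 | h1 <;> simp only [h1] at hk ⊢ <;>
      simp at hk ⊢
    · rcases hG (r ε (h ε)) (r ε (h (flipSign ε i))) (h ε) (h (flipSign ε i)) with h2 | h2
      · simp only [← sub_eq_add_neg] at *
        linarith
      · simp only [← sub_eq_add_neg] at *
        linarith
    · rcases hG (r ε (h (flipSign ε i))) (r ε (h ε)) (h (flipSign ε i)) (h ε) with h2 | h2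
      · simp only [← sub_eq_add_neg] at *
        linarith
      · simp only [← sub_eq_add_neg] at *
        linarith

/-- Contraction principle for signed sums, in terms of selections instead of suprema. -/
theorem exists_selection_signedSum {n : ℕ} {P : Type*} {G : ℝ → ℝ} {φ ψ : P → Fin n → ℝ}
    (hG : ∀ i a b p q, G (a + φ p i) + G (b - φ q i) ≤ G (a + ψ p i) + G (b - ψ q i) ∨
      G (a + φ p i) + G (b - φ q i) ≤ G (b + ψ q i) + G (a - ψ p i))
    (h : (Fin n → ℤˣ) → P) :
    ∃ h' : (Fin n → ℤˣ) → P, ∑ ε, G (signedSum ε (φ (h ε))) ≤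
      ∑ ε, G (signedSum ε (ψ (h' ε))) := by
  classical
  -- The coordinates are replaced one at a time; `s` collects those already carrying `ψ`.
  have key : ∀ s : Finset (Fin n), ∃ h' : (Fin n → ℤˣ) → P,
      ∑ ε, G (signedSum ε (φ (h ε))) ≤
      ∑ ε, G (signedSum ε (fun j => if j ∈ s then ψ (h' ε) j else φ (h' ε) j)) := by
    intro s
    induction s using Finset.induction_on with
    | empty => exact ⟨h, by simp⟩
    | insert i s hi ih =>
      obtain ⟨h₁, hh₁⟩ := ih
      let r : (Fin n → ℤˣ) → P → ℝ := fun ε p =>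
        ∑ j ∈ Finset.univ.erase i, ((ε j : ℤ) : ℝ) * (if j ∈ s then ψ p j else φ p j)
      have hr : ∀ ε p, r (flipSign ε i) p = r ε p := by
        intro ε p
        refine Finset.sum_congr rfl fun j hj => ?_
        rw [flipSign, Function.update_of_ne (Finset.ne_of_mem_erase hj)]
      obtain ⟨h₂, hh₂⟩ := exists_selection_coord (hG i) i r hr h₁
      refine ⟨h₂, hh₁.trans (le_trans (le_of_eq ?_) (hh₂.trans (le_of_eq ?_)))⟩
      · refine Finset.sum_congr rfl fun ε _ => ?_
        rw [signedSum, ← Finset.sum_erase_add _ _ (Finset.mem_univ i), if_neg hi]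
      · refine Finset.sum_congr rfl fun ε _ => ?_
        rw [signedSum, ← Finset.sum_erase_add _ _ (Finset.mem_univ i),
          if_pos (Finset.mem_insert_self _ _)]
        congr 2
        refine Finset.sum_congr rfl fun j hj => ?_
        simp [Finset.ne_of_mem_erase hj]
  obtain ⟨h', hh'⟩ := key Finset.univ
  exact ⟨h', by simpa using hh'⟩

/-- Here `G` is the identity, and the sign of `v p i - v q i` decides which alternative of the
pairwise inequality holds. -/
theorem exists_selection_lipschitz {n : ℕ} {P : Type*} {v : P → Fin n → ℝ} {φ : Fin n → ℝ → ℝ}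
    {M : ℝ} (hφ : ∀ i x y, |φ i x - φ i y| ≤ M * |x - y|) (h : (Fin n → ℤˣ) → P) :
    ∃ h' : (Fin n → ℤˣ) → P, ∑ ε, signedSum ε (fun i => φ i (v (h ε) i)) ≤
      ∑ ε, signedSum ε (fun i => M * v (h' ε) i) := by
  refine exists_selection_signedSum (G := id) (φ := fun p i => φ i (v p i))
    (ψ := fun p i => M * v p i) (fun i a b p q => ?_) h
  have h1 := (le_abs_self _).trans (hφ i (v p i) (v q i))
  rcases abs_cases (v p i - v q i) with ⟨h2, -⟩ | ⟨h2, -⟩ <;> rw [h2] at h1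
  · left; simp only [id]; nlinarith
  · right; simp only [id]; nlinarith

/-- If one of `x`, `y` is nonnegative, monotonicity suffices. If both are negative, convexity of
`exp` bounds twice the left side by the sum of the two right sides, so one of them is large enough.
-/
theorem exp_relu_pair {l : ℝ} (hl : 0 ≤ l) (a b x y : ℝ) :
    Real.exp (l * (a + max x 0)) + Real.exp (l * (b - max y 0)) ≤
        Real.exp (l * (a + x)) + Real.exp (l * (b - y)) ∨
      Real.exp (l * (a + max x 0)) + Real.exp (l * (b - max y 0)) ≤
        Real.exp (l * (b + y)) + Real.exp (l * (a - x)) := by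
  have mono : ∀ {u w : ℝ}, u ≤ w → Real.exp (l * u) ≤ Real.exp (l * w) := fun h =>
    Real.exp_le_exp.2 (mul_le_mul_of_nonneg_left h hl)
  have conv : ∀ u w : ℝ, 2 * Real.exp (l * u) ≤ Real.exp (l * (u + w)) + Real.exp (l * (u - w)) := by
    intro u w
    have h1 : Real.exp (l * (u + w)) + Real.exp (l * (u - w)) =
        2 * (Real.exp (l * u) * Real.cosh (l * w)) := by
      rw [Real.cosh_eq, mul_add l, mul_sub l, Real.exp_add, sub_eq_add_neg, Real.exp_add]
      ring
    rw [h1]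
    have := Real.one_le_cosh (l * w)
    nlinarith [Real.exp_pos (l * u)]
  rcases le_total 0 x with hx | hx <;> rcases le_total 0 y with hy | hy
  · left; rw [max_eq_left hx, max_eq_left hy]
  · left; rw [max_eq_left hx, max_eq_right hy]
    have := @mono (b - 0) (b - y) (by linarith)
    linarith
  · right; rw [max_eq_right hx, max_eq_left hy]
    have h1 := @mono (a + 0) (a - x) (by linarith)
    have h2 := @mono (b - y) (b + y) (by linarith)
    linarith
  · rw [max_eq_right hx, max_eq_right hy, add_zero, sub_zero]
    by_contra hcon
    rw [not_or, not_le, not_le] at hcon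
    linarith [conv a x, conv b y]

theorem exists_selection_relu {n : ℕ} {P : Type*} {v : P → Fin n → ℝ} {l : ℝ} (hl : 0 ≤ l)
    (h : (Fin n → ℤˣ) → P) :
    ∃ h' : (Fin n → ℤˣ) → P, ∑ ε, Real.exp (l * signedSum ε (fun i => max (v (h ε) i) 0)) ≤
      ∑ ε, Real.exp (l * signedSum ε (v (h' ε))) :=
  exists_selection_signedSum (G := fun t => Real.exp (l * t)) (φ := fun p i => max (v p i) 0)
    (ψ := v) (fun _ a b _ _ => exp_relu_pair hl a b _ _) h

theorem signedSum_neg {n : ℕ} (ε : Fin n → ℤˣ) (v : Fin n → ℝ) :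
    signedSum (-ε) v = -signedSum ε v := by
  simp [signedSum]

theorem exp_mul_abs_le {l : ℝ} (x : ℝ) :
    Real.exp (l * |x|) ≤ Real.exp (l * x) + Real.exp (l * -x) := by
  rcases abs_cases x with ⟨h, -⟩ | ⟨h, -⟩ <;> rw [h]
  · linarith [Real.exp_pos (l * -x)]
  · linarith [Real.exp_pos (l * x)]

theorem sum_signs_neg {n : ℕ} (F : (Fin n → ℤˣ) → ℝ) : ∑ ε, F (-ε) = ∑ ε, F ε :=
  Equiv.sum_comp (Equiv.neg _) F

/-- The peeling step: ReLUs inside the absolute value of a signed sum cost a factor `2`. -/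
theorem sum_exp_abs_relu_le {n : ℕ} {P : Type*} {v : P → Fin n → ℝ} {l U : ℝ} (hl : 0 ≤ l)
    (hU : ∀ h : (Fin n → ℤˣ) → P, ∑ ε, Real.exp (l * |signedSum ε (v (h ε))|) ≤ U)
    (h : (Fin n → ℤˣ) → P) :
    ∑ ε, Real.exp (l * |signedSum ε (fun i => max (v (h ε) i) 0)|) ≤ 2 * U := by
  have key : ∀ h : (Fin n → ℤˣ) → P,
      ∑ ε, Real.exp (l * signedSum ε (fun i => max (v (h ε) i) 0)) ≤ U := by
    intro h
    obtain ⟨h', hh'⟩ := exists_selection_relu (v := v) hl h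
    refine hh'.trans (le_trans (Finset.sum_le_sum fun ε _ => ?_) (hU h'))
    exact Real.exp_le_exp.2 (mul_le_mul_of_nonneg_left (le_abs_self _) hl)
  refine (Finset.sum_le_sum fun ε _ => exp_mul_abs_le _).trans ?_
  rw [Finset.sum_add_distrib]
  -- The substitution `ε ↦ -ε` turns the part with the negative sign into a sum of the same kind,
  -- for another selection.
  have h2 := key (fun ε => h (-ε))
  rw [← sum_signs_neg] at h2
  simp only [neg_neg, signedSum_neg] at h2
  linarith [key h]

/-- The signs are independent: the sum factors into terms `2 cosh (l v_i)`. -/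
theorem sum_exp_signedSum_le {n : ℕ} (l : ℝ) (v : Fin n → ℝ) :
    ∑ ε, Real.exp (l * signedSum ε v) ≤ 2 ^ n * Real.exp (l ^ 2 * (∑ i, v i ^ 2) / 2) := by
  have h1 : ∀ ε : Fin n → ℤˣ, Real.exp (l * signedSum ε v) =
      ∏ i, Real.exp (l * (((ε i : ℤ) : ℝ) * v i)) := by
    intro ε
    rw [signedSum, Finset.mul_sum, Real.exp_sum]
  simp only [h1]
  rw [← Fintype.prod_sum (fun (i : Fin n) (e : ℤˣ) => Real.exp (l * (((e : ℤ) : ℝ) * v i)))]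
  have h2 : (2 : ℝ) ^ n * Real.exp (l ^ 2 * (∑ i, v i ^ 2) / 2) =
      ∏ i, (2 * Real.exp ((l * v i) ^ 2 / 2)) := by
    rw [Finset.prod_mul_distrib, ← Real.exp_sum, Finset.prod_const, Finset.card_univ,
      Fintype.card_fin]
    congr 2
    rw [Finset.mul_sum, Finset.sum_div]
    exact Finset.sum_congr rfl fun i _ => by ring
  rw [h2]
  refine Finset.prod_le_prod (fun i _ => Finset.sum_nonneg fun _ _ => (Real.exp_pos _).le)
    fun i _ => ?_
  rw [sum_intUnits]
  have := Real.cosh_le_exp_half_sq (l * v i)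
  rw [Real.cosh_eq] at this
  simp only [Units.val_one, Int.cast_one, one_mul, Units.val_neg, Int.cast_neg, neg_mul,
    mul_neg]
  linarith

theorem sum_signedSum_sq {n : ℕ} (v : Fin n → ℝ) :
    ∑ ε, signedSum ε v ^ 2 = 2 ^ n * ∑ i, v i ^ 2 := by
  induction n with
  | zero => simp [signedSum]
  | succ n ih =>
    have h1 : ∀ (a : ℤˣ) (ε : Fin n → ℤˣ), signedSum (Fin.cons a ε) v =
        ((a : ℤ) : ℝ) * v 0 + signedSum ε (fun i => v i.succ) := by
      intro a ε
      simp [signedSum, Fin.sum_univ_succ]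
    rw [sum_signs_succ, ← Finset.sum_add_distrib]
    simp only [h1]
    have h2 : ∀ ε : Fin n → ℤˣ,
        (((1 : ℤˣ) : ℤ) * v 0 + signedSum ε (fun i => v i.succ)) ^ 2 +
        ((((-1 : ℤˣ) : ℤ) : ℝ) * v 0 + signedSum ε (fun i => v i.succ)) ^ 2 =
        2 * v 0 ^ 2 + 2 * signedSum ε (fun i => v i.succ) ^ 2 := by
      intro ε
      push_cast
      ring
    rw [Finset.sum_congr rfl fun ε _ => h2 ε, Finset.sum_add_distrib, ← Finset.mul_sum, ← Finset.mul_sum, ih]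
    simp [Fin.sum_univ_succ]
    ring

/-- Jensen's inequality for a uniform average over the cube. -/
theorem exp_avg_le {n : ℕ} (F : (Fin n → ℤˣ) → ℝ) :
    Real.exp ((1 / 2 ^ n) * ∑ ε, F ε) ≤ (1 / 2 ^ n) * ∑ ε, Real.exp (F ε) := by
  have := convexOn_exp.map_sum_le (t := Finset.univ) (w := fun _ : Fin n → ℤˣ => (1 / 2 ^ n : ℝ))
    (p := F) (fun _ _ => by positivity) (by simp) (fun _ _ => Set.mem_univ _)
  simpa [Finset.mul_sum] using this

theorem signedSum_sub {n : ℕ} (ε : Fin n → ℤˣ) (v w : Fin n → ℝ) :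
    signedSum ε (fun i => v i - w i) = signedSum ε v - signedSum ε w := by
  simp [signedSum, mul_sub, Finset.sum_sub_distrib]

theorem abs_signedSum_le {n : ℕ} (ε : Fin n → ℤˣ) (v : Fin n → ℝ) :
    |signedSum ε v| ≤ ∑ i, |v i| := by
  refine (Finset.abs_sum_le_sum_abs _ _).trans (Finset.sum_le_sum fun i _ => ?_)
  rcases Int.units_eq_one_or (ε i) with h | h <;> simp [h]

theorem abs_signedSum_sub_flip {n : ℕ} (ε : Fin n → ℤˣ) (v : Fin n → ℝ) (i : Fin n) :
    |signedSum ε v - signedSum (flipSign ε i) v| = 2 * |v i| := by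
  have h : signedSum ε v - signedSum (flipSign ε i) v = 2 * ((ε i : ℤ) : ℝ) * v i := by
    rw [signedSum, signedSum, ← Finset.sum_sub_distrib, Finset.sum_eq_single i]
    · simp [flipSign]; ring
    · intro j _ hj
      simp [flipSign, hj]
    · simp
  rw [h]
  rcases Int.units_eq_one_or (ε i) with h | h <;> simp [h, abs_mul]

theorem abs_ciSup_sub_ciSup_le {ι : Type*} [Finite ι] [Nonempty ι] {f g : ι → ℝ} {c : ℝ}
    (h : ∀ i, |f i - g i| ≤ c) : |(⨆ i, f i) - ⨆ i, g i| ≤ c := by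
  rw [abs_le]
  constructor
  · have : ⨆ i, g i ≤ (⨆ i, f i) + c := ciSup_le fun i => by
      have := le_ciSup (Finite.bddAbove_range f) i
      linarith [(abs_le.1 (h i)).1]
    linarith
  · have : ⨆ i, f i ≤ (⨆ i, g i) + c := ciSup_le fun i => by
      have := le_ciSup (Finite.bddAbove_range g) i
      linarith [(abs_le.1 (h i)).2]
    linarith

/-- Flipping one sign moves the supremum by at most `2M`, so it is sub-Gaussian around its mean. As
`ι` is finite, the mean is attained by a selection of maximizers, to which `hρ` applies. -/
theorem sum_exp_iSup_signedSum_le {ι : Type*} [Finite ι] [Nonempty ι] {n : ℕ} {M ρ l : ℝ}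
    (hl : 0 ≤ l) {v : ι → Fin n → ℝ} (hv : ∀ θ i, |v θ i| ≤ M)
    (hρ : ∀ θ : (Fin n → ℤˣ) → ι, ∑ ε, signedSum ε (v (θ ε)) ≤ 2 ^ n * ρ) :
    ∑ ε : Fin n → ℤˣ, Real.exp (l * ⨆ θ, signedSum ε (v θ)) ≤
      2 ^ n * Real.exp (l * ρ + n * (l ^ 2 * M ^ 2) / 2) := by
  have h1 : ∀ (ε : Fin n → ℤˣ) (i : Fin n),
      |l * (⨆ θ, signedSum ε (v θ)) - l * ⨆ θ, signedSum (flipSign ε i) (v θ)| ≤ l * (2 * M) := by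
    intro ε i
    rw [← mul_sub, abs_mul, abs_of_nonneg hl]
    refine mul_le_mul_of_nonneg_left (abs_ciSup_sub_ciSup_le fun θ => ?_) hl
    rw [abs_signedSum_sub_flip]
    linarith [hv θ i]
  refine (sum_exp_le_of_flip _ h1).trans ?_
  refine mul_le_mul_of_nonneg_left (Real.exp_le_exp.2 (add_le_add ?_ (le_of_eq (by ring))))
    (by positivity)
  choose θ hθ using fun ε : Fin n → ℤˣ => exists_eq_ciSup_of_finite (f := fun θ => signedSum ε (v θ))
  have h2 := hρ θ
  simp only [hθ] at h2
  rw [← Finset.mul_sum, ← mul_assoc, mul_comm _ l, mul_assoc]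
  refine mul_le_mul_of_nonneg_left ?_ hl
  rw [div_mul_eq_mul_div, one_mul, div_le_iff₀ (by positivity)]
  linarith

/-! ### Symmetrization and uniform deviation -/

section Symmetrization

variable {Z : Type*} {ι : Type*}

/-- The largest signed deviation between two samples. -/
noncomputable def signedGap {n : ℕ} (f : ι → Z → ℝ) (ε : Fin n → ℤˣ) (Q : Fin n → Z × Z) : ℝ :=
  ⨆ θ, signedSum ε (fun i => f θ (Q i).2 - f θ (Q i).1)

theorem abs_signedGap_le [Finite ι] [Nonempty ι] {n : ℕ} {f : ι → Z → ℝ} {M : ℝ}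
    (hM : ∀ θ z, |f θ z| ≤ M) (ε : Fin n → ℤˣ) (Q : Fin n → Z × Z) :
    |signedGap f ε Q| ≤ n * (2 * M) := by
  obtain ⟨θ, hθ⟩ := exists_eq_ciSup_of_finite
    (f := fun θ => signedSum ε (fun i => f θ (Q i).2 - f θ (Q i).1))
  rw [signedGap, ← hθ]
  refine (abs_signedSum_le _ _).trans ?_
  refine (Finset.sum_le_card_nsmul _ _ (2 * M) fun i _ => ?_).trans (by simp)
  linarith [abs_sub (f θ (Q i).2) (f θ (Q i).1), hM θ (Q i).2, hM θ (Q i).1]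

variable [MeasurableSpace Z]

theorem measurable_signedGap [Finite ι] {n : ℕ} {f : ι → Z → ℝ} (hf : ∀ θ, Measurable (f θ))
    (ε : Fin n → ℤˣ) : Measurable (signedGap f ε) := by
  refine Measurable.iSup fun θ => ?_
  unfold signedSum
  have := hf θ
  fun_prop

theorem integrable_exp_signedGap [Finite ι] [Nonempty ι] {n : ℕ} {f : ι → Z → ℝ} {M : ℝ}
    (hf : ∀ θ, Measurable (f θ)) (hM : ∀ θ z, |f θ z| ≤ M) (ε : Fin n → ℤˣ) (l : ℝ)
    (P : Measure (Fin n → Z × Z)) [IsFiniteMeasure P] :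
    Integrable (fun Q => Real.exp (l * signedGap f ε Q)) P := by
  refine Integrable.of_bound ?_ (Real.exp (|l| * (n * (2 * M)))) (ae_of_all _ fun Q => ?_)
  · exact (Real.measurable_exp.comp ((measurable_signedGap hf ε).const_mul l)).aestronglyMeasurable
  · rw [Real.norm_of_nonneg (Real.exp_pos _).le]
    refine Real.exp_le_exp.2 ((le_abs_self _).trans ?_)
    rw [abs_mul]
    exact mul_le_mul_of_nonneg_left (abs_signedGap_le hM ε Q) (abs_nonneg _)

/-- Exchanging the two points of a pair preserves the product law and reverses the sign of their
difference; this is done at the indices with `ε i = -1`. -/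
theorem integral_exp_signedGap_eq [Finite ι] {n : ℕ} {f : ι → Z → ℝ}
    (hf : ∀ θ, Measurable (f θ)) (μ : Measure Z) [IsProbabilityMeasure μ] (ε : Fin n → ℤˣ)
    (l : ℝ) :
    ∫ Q, Real.exp (l * signedGap f ε Q) ∂(Measure.pi fun _ : Fin n => μ.prod μ) =
      ∫ Q, Real.exp (l * signedGap f 1 Q) ∂(Measure.pi fun _ : Fin n => μ.prod μ) := by
  have hT : MeasurePreserving (fun (Q : Fin n → Z × Z) i => if ε i = 1 then Q i else (Q i).swap)
      (Measure.pi fun _ : Fin n => μ.prod μ) (Measure.pi fun _ : Fin n => μ.prod μ) := by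
    refine measurePreserving_pi _ _
      (f := fun i (q : Z × Z) => if ε i = 1 then q else q.swap) fun i => ?_
    by_cases h : ε i = 1
    · simp only [h, if_true]
      exact MeasurePreserving.id (μ.prod μ)
    · simp only [h, if_false]
      exact Measure.measurePreserving_swap
  have hm : Measurable fun Q => Real.exp (l * signedGap f (1 : Fin n → ℤˣ) Q) :=
    Real.measurable_exp.comp ((measurable_signedGap hf 1).const_mul l)
  conv_rhs => rw [← hT.map_eq]
  rw [integral_map hT.aemeasurable hm.aestronglyMeasurable]
  refine integral_congr_ae (ae_of_all _ fun Q => ?_)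
  simp only [signedGap, signedSum]
  congr 3
  ext θ
  refine Finset.sum_congr rfl fun i _ => ?_
  rcases Int.units_eq_one_or (ε i) with h | h <;> simp [h]

/-- The largest deviation of the sample sums from their expectations. -/
noncomputable def sampleGap {n : ℕ} (f : ι → Z → ℝ) (μ : Measure Z) (S : Fin n → Z) : ℝ :=
  ⨆ θ, ∑ i, (∫ z, f θ z ∂μ - f θ (S i))

/-- The expectation under `μ` is an average over an independent ghost sample `S'`. Jensen's
inequality is applied at the `θ` that attains the gap for `S`. -/
theorem exp_sampleGap_le [Finite ι] [Nonempty ι] {n : ℕ} {f : ι → Z → ℝ} {M : ℝ}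
    (hf : ∀ θ, Measurable (f θ)) (hM : ∀ θ z, |f θ z| ≤ M) (μ : Measure Z)
    [IsProbabilityMeasure μ] {l : ℝ} (hl : 0 ≤ l) (S : Fin n → Z) :
    Real.exp (l * sampleGap f μ S) ≤
      ∫ S', Real.exp (l * signedGap f 1 fun i => (S i, S' i)) ∂(Measure.pi fun _ : Fin n => μ) := by
  obtain ⟨θ, hθ⟩ := exists_eq_ciSup_of_finite
    (f := fun θ => ∑ i, (∫ z, f θ z ∂μ - f θ (S i)))
  have hint : Integrable (f θ) μ := Integrable.of_bound (hf θ).aestronglyMeasurable M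
    (ae_of_all _ (hM θ))
  have hint' : ∀ i : Fin n, Integrable (fun S' : Fin n → Z => f θ (S' i))
      (Measure.pi fun _ : Fin n => μ) := fun i =>
    (measurePreserving_eval (fun _ : Fin n => μ) i).integrable_comp_of_integrable hint
  have hsum : Integrable (fun S' : Fin n → Z => l * ∑ i, (f θ (S' i) - f θ (S i)))
      (Measure.pi fun _ : Fin n => μ) :=
    (integrable_finsetSum _ fun i _ => (hint' i).sub (integrable_const _)).const_mul l
  have hexp : ∀ S' : Fin n → Z, l * ∑ i, (f θ (S' i) - f θ (S i)) ≤
      l * signedGap f 1 fun i => (S i, S' i) := by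
    intro S'
    refine mul_le_mul_of_nonneg_left ?_ hl
    have := le_ciSup (Finite.bddAbove_range
      fun θ => signedSum (1 : Fin n → ℤˣ) fun i => f θ (S' i) - f θ (S i)) θ
    simpa [signedGap, signedSum] using this
  have hbig : Integrable (fun S' : Fin n → Z => Real.exp (l * signedGap f 1 fun i => (S i, S' i)))
      (Measure.pi fun _ : Fin n => μ) := by
    refine Integrable.of_bound ?_ (Real.exp (l * (n * (2 * M)))) (ae_of_all _ fun S' => ?_)
    · have h1 : Measurable fun S' : Fin n → Z => fun i => (S i, S' i) := by fun_prop
      exact (Real.measurable_exp.comp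
        (((measurable_signedGap hf 1).comp h1).const_mul l)).aestronglyMeasurable
    · rw [Real.norm_of_nonneg (Real.exp_pos _).le]
      exact Real.exp_le_exp.2 (mul_le_mul_of_nonneg_left
        ((le_abs_self _).trans (abs_signedGap_le hM _ _)) hl)
  have hsmall : Integrable (fun S' : Fin n → Z =>
      Real.exp (l * ∑ i, (f θ (S' i) - f θ (S i)))) (Measure.pi fun _ : Fin n => μ) := by
    refine hbig.mono' (Real.continuous_exp.comp_aestronglyMeasurable hsum.aestronglyMeasurable)
      (ae_of_all _ fun S' => ?_)
    rw [Real.norm_of_nonneg (Real.exp_pos _).le]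
    exact Real.exp_le_exp.2 (hexp S')
  have hJ := convexOn_exp.map_integral_le Real.continuous_exp.continuousOn isClosed_univ
    (ae_of_all _ fun _ => Set.mem_univ _) hsum hsmall
  refine le_trans (le_of_eq ?_) (hJ.trans (integral_mono hsmall hbig fun S' =>
    Real.exp_le_exp.2 (hexp S')))
  rw [sampleGap, ← hθ, integral_const_mul, integral_finsetSum (f := fun i (S' : Fin n → Z) =>
    f θ (S' i) - f θ (S i)) _ fun i _ => (hint' i).sub (integrable_const _)]
  congr 2
  refine Finset.sum_congr rfl fun i _ => ?_
  rw [integral_sub (hint' i) (integrable_const _),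
    integral_comp_eval (μ := fun _ : Fin n => μ) (hf θ).aestronglyMeasurable]
  simp

theorem integral_exp_sampleGap_le [Finite ι] [Nonempty ι] {n : ℕ} {f : ι → Z → ℝ} {M ρ : ℝ}
    (hf : ∀ θ, Measurable (f θ)) (hM : ∀ θ z, |f θ z| ≤ M) (μ : Measure Z)
    [IsProbabilityMeasure μ] {l : ℝ} (hl : 0 ≤ l)
    (hρ : ∀ᵐ S ∂(Measure.pi fun _ : Fin n => μ), ∀ θ : (Fin n → ℤˣ) → ι,
      ∑ ε, signedSum ε (fun i => f (θ ε) (S i)) ≤ 2 ^ n * ρ) :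
    ∫ S, Real.exp (l * sampleGap f μ S) ∂(Measure.pi fun _ : Fin n => μ) ≤
      Real.exp (2 * l * ρ + n * ((2 * l) ^ 2 * M ^ 2) / 2) := by
  set P := Measure.pi fun _ : Fin n => μ.prod μ with hP
  set P₁ := Measure.pi fun _ : Fin n => μ with hP₁
  have hprod : ∫ S, ∫ S', Real.exp (l * signedGap f 1 fun i => (S i, S' i)) ∂P₁ ∂P₁ =
      ∫ Q, Real.exp (l * signedGap f 1 Q) ∂P := by
    have hmp := measurePreserving_arrowProdEquivProdArrow Z Z (Fin n) (fun _ => μ) (fun _ => μ)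
    have h1 := hmp.symm.integral_comp' (fun Q => Real.exp (l * signedGap f 1 Q))
    rw [← h1, integral_prod]
    · rfl
    · have := (integrable_exp_signedGap hf hM 1 l P)
      exact (hmp.symm.integrable_comp_emb (MeasurableEquiv.measurableEmbedding _)).2 this
  have hfst : MeasurePreserving (fun (Q : Fin n → Z × Z) i => (Q i).1) P P₁ :=
    measurePreserving_pi _ _ (f := fun _ (q : Z × Z) => q.1) fun i => measurePreserving_fst
  have hsnd : MeasurePreserving (fun (Q : Fin n → Z × Z) i => (Q i).2) P P₁ :=
    measurePreserving_pi _ _ (f := fun _ (q : Z × Z) => q.2) fun i => measurePreserving_snd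
  have hleft : ∫ S, Real.exp (l * sampleGap f μ S) ∂P₁ ≤ ∫ Q, Real.exp (l * signedGap f 1 Q) ∂P := by
    rw [← hprod]
    refine integral_mono_of_nonneg (ae_of_all _ fun S => (Real.exp_pos _).le) ?_
      (ae_of_all _ fun S => exp_sampleGap_le hf hM μ hl S)
    have hmp := measurePreserving_arrowProdEquivProdArrow Z Z (Fin n) (fun _ => μ) (fun _ => μ)
    have := (hmp.symm.integrable_comp_emb (MeasurableEquiv.measurableEmbedding _)).2
      (integrable_exp_signedGap hf hM 1 l P)
    exact this.integral_prod_left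
  refine hleft.trans ?_
  have havg : ∫ Q, Real.exp (l * signedGap f 1 Q) ∂P =
      ∫ Q, (1 / 2 ^ n) * ∑ ε : Fin n → ℤˣ, Real.exp (l * signedGap f ε Q) ∂P := by
    rw [integral_const_mul, integral_finsetSum _
      fun ε _ => integrable_exp_signedGap hf hM ε l P]
    simp only [hP, integral_exp_signedGap_eq hf μ _ l]
    simp
  rw [havg]
  have hae : ∀ᵐ Q ∂P, (1 / 2 ^ n) * ∑ ε : Fin n → ℤˣ, Real.exp (l * signedGap f ε Q) ≤
      Real.exp (2 * l * ρ + n * ((2 * l) ^ 2 * M ^ 2) / 2) := by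
    filter_upwards [hfst.quasiMeasurePreserving.ae hρ, hsnd.quasiMeasurePreserving.ae hρ]
      with Q hQ1 hQ2
    have e1 := sum_exp_iSup_signedSum_le (l := 2 * l) (by linarith)
      (v := fun θ i => f θ (Q i).1) (fun θ i => hM θ _) hQ1
    have e2 := sum_exp_iSup_signedSum_le (l := 2 * l) (by linarith)
      (v := fun θ i => f θ (Q i).2) (fun θ i => hM θ _) hQ2
    rw [← sum_signs_neg] at e1
    -- The gap is at most the sum of one supremum for each sample, and `e^{l(a+b)} ≤ (e^{2la} +
    -- e^{2lb}) / 2` separates them; hence the parameter `2 * l`.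
    have e3 : ∀ ε : Fin n → ℤˣ, Real.exp (l * signedGap f ε Q) ≤
        (1 / 2) * (Real.exp (2 * l * ⨆ θ, signedSum (-ε) fun i => f θ (Q i).1) +
          Real.exp (2 * l * ⨆ θ, signedSum ε fun i => f θ (Q i).2)) := by
      intro ε
      have h1 : signedGap f ε Q ≤ (⨆ θ, signedSum (-ε) fun i => f θ (Q i).1) +
          ⨆ θ, signedSum ε fun i => f θ (Q i).2 := by
        refine ciSup_le fun θ => ?_
        have a1 := le_ciSup (Finite.bddAbove_range
          fun θ => signedSum (-ε) fun i => f θ (Q i).1) θ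
        have a2 := le_ciSup (Finite.bddAbove_range
          fun θ => signedSum ε fun i => f θ (Q i).2) θ
        rw [signedSum_sub]
        simp only [signedSum_neg] at a1 ⊢
        linarith
      set a := ⨆ θ, signedSum (-ε) fun i => f θ (Q i).1
      set b := ⨆ θ, signedSum ε fun i => f θ (Q i).2
      have h2 : Real.exp (l * signedGap f ε Q) ≤ Real.exp (l * a) * Real.exp (l * b) := by
        rw [← Real.exp_add, ← mul_add]
        exact Real.exp_le_exp.2 (mul_le_mul_of_nonneg_left h1 hl)
      have h3 : ∀ x : ℝ, Real.exp (2 * l * x) = Real.exp (l * x) ^ 2 := by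
        intro x
        rw [← Real.exp_nat_mul]
        congr 1
        push_cast
        ring
      rw [h3, h3]
      nlinarith [sq_nonneg (Real.exp (l * a) - Real.exp (l * b))]
    have e4 := Finset.sum_le_sum fun ε (_ : ε ∈ (Finset.univ : Finset (Fin n → ℤˣ))) => e3 ε
    rw [← Finset.mul_sum, Finset.sum_add_distrib] at e4
    rw [div_mul_eq_mul_div, one_mul, div_le_iff₀ (by positivity)]
    linarith
  have hc := integral_mono_ae (μ := P)
    (((integrable_finsetSum _ fun ε _ => integrable_exp_signedGap hf hM ε l P).const_mul
      (1 / 2 ^ n : ℝ))) (integrable_const _) hae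
  simpa using hc

/-- Uniform deviation inequality for a finite family of bounded functions, in terms of a bound
for its Rademacher averages. -/
theorem measure_exists_sum_gap_le [Finite ι] {n : ℕ} {f : ι → Z → ℝ}
    {M ρ t : ℝ} (hn : 1 ≤ n) (hMpos : 0 < M) (ht : 0 ≤ t)
    (hf : ∀ θ, Measurable (f θ)) (hM : ∀ θ z, |f θ z| ≤ M) (μ : Measure Z)
    [IsProbabilityMeasure μ]
    (hρ : ∀ᵐ S ∂(Measure.pi fun _ : Fin n => μ), ∀ θ : (Fin n → ℤˣ) → ι,
      ∑ ε, signedSum ε (fun i => f (θ ε) (S i)) ≤ 2 ^ n * (n * ρ)) :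
    (Measure.pi fun _ : Fin n => μ)
        {S | ∃ θ, 2 * ρ + t < ∫ z, f θ z ∂μ - (1 / (n : ℝ)) * ∑ i, f θ (S i)} ≤
      ENNReal.ofReal (Real.exp (-(n * t ^ 2 / (8 * M ^ 2)))) := by
  rcases isEmpty_or_nonempty ι with hι | hι
  · simp
  have hn' : (0 : ℝ) < n := by exact_mod_cast hn
  set P := Measure.pi fun _ : Fin n => μ with hP
  -- Minimizer of the Chernoff exponent `n (-l t + 2 l² M²)`.
  set l := t / (4 * M ^ 2) with hl
  have hl0 : 0 ≤ l := by positivity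
  have hmeas : Measurable (sampleGap (n := n) f μ) := by
    refine Measurable.iSup fun θ => ?_
    have := hf θ
    fun_prop
  have hint : Integrable (fun S => Real.exp (l * sampleGap f μ S)) P := by
    refine Integrable.of_bound (Real.measurable_exp.comp (hmeas.const_mul l)).aestronglyMeasurable
      (Real.exp (l * (n * (2 * M)))) (ae_of_all _ fun S => ?_)
    rw [Real.norm_of_nonneg (Real.exp_pos _).le]
    refine Real.exp_le_exp.2 (mul_le_mul_of_nonneg_left (ciSup_le fun θ => ?_) hl0)
    refine (Finset.sum_le_card_nsmul _ _ (2 * M) fun i _ => ?_).trans (by simp)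
    have h1 : ∫ z, f θ z ∂μ ≤ M := by
      have := norm_integral_le_of_norm_le_const (μ := μ) (f := f θ) (ae_of_all _ (hM θ))
      simp at this
      linarith [(abs_le.1 this).2]
    linarith [(abs_le.1 (hM θ (S i))).1]
  have hsub : {S : Fin n → Z | ∃ θ, 2 * ρ + t < ∫ z, f θ z ∂μ - (1 / (n : ℝ)) * ∑ i, f θ (S i)} ⊆
      {S | n * (2 * ρ + t) ≤ sampleGap f μ S} := by
    rintro S ⟨θ, hθ⟩
    have h1 := le_ciSup (Finite.bddAbove_range
      fun θ => ∑ i, (∫ z, f θ z ∂μ - f θ (S i))) θ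
    have h2 : ∑ i, (∫ z, f θ z ∂μ - f θ (S i)) =
        n * (∫ z, f θ z ∂μ - (1 / (n : ℝ)) * ∑ i, f θ (S i)) := by
      rw [Finset.sum_sub_distrib]
      simp
      field_simp
    simp only [Set.mem_ofPred_eq]
    refine le_trans ?_ h1
    simp only [h2]
    exact mul_le_mul_of_nonneg_left hθ.le hn'.le
  refine (measure_mono hsub).trans ?_
  rw [← ofReal_measureReal]
  refine ENNReal.ofReal_le_ofReal ((measure_ge_le_exp_mul_mgf _ hl0 hint).trans ?_)
  rw [mgf]
  refine (mul_le_mul_of_nonneg_left (integral_exp_sampleGap_le hf hM μ hl0 hρ)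
    (Real.exp_pos _).le).trans (le_of_eq ?_)
  rw [← Real.exp_add, hl]
  congr 1
  field_simp
  ring

/-- The uniform deviation inequality for a sequence of functions. -/
theorem measure_exists_nat_gap_le {n : ℕ} {f : ℕ → Z → ℝ}
    {M ρ t : ℝ} (hn : 1 ≤ n) (hMpos : 0 < M) (ht : 0 ≤ t)
    (hf : ∀ θ, Measurable (f θ)) (hM : ∀ θ z, |f θ z| ≤ M) (μ : Measure Z)
    [IsProbabilityMeasure μ]
    (hρ : ∀ᵐ S ∂(Measure.pi fun _ : Fin n => μ), ∀ θ : (Fin n → ℤˣ) → ℕ,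
      ∑ ε, signedSum ε (fun i => f (θ ε) (S i)) ≤ 2 ^ n * (n * ρ)) :
    (Measure.pi fun _ : Fin n => μ)
        {S | ∃ θ, 2 * ρ + t < ∫ z, f θ z ∂μ - (1 / (n : ℝ)) * ∑ i, f θ (S i)} ≤
      ENNReal.ofReal (Real.exp (-(n * t ^ 2 / (8 * M ^ 2)))) := by
  -- Continuity from below along the first `N` functions: the bound for finite families does not
  -- depend on `N`.
  have hU : {S : Fin n → Z | ∃ θ, 2 * ρ + t < ∫ z, f θ z ∂μ - (1 / (n : ℝ)) * ∑ i, f θ (S i)} =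
      ⋃ N : ℕ, {S | ∃ θ : Fin N, 2 * ρ + t < ∫ z, f θ z ∂μ - (1 / (n : ℝ)) * ∑ i, f θ (S i)} := by
    ext S
    simp only [Set.mem_ofPred_eq, Set.mem_iUnion]
    exact ⟨fun ⟨θ, h⟩ => ⟨θ + 1, ⟨θ, Nat.lt_succ_self θ⟩, h⟩, fun ⟨N, θ, h⟩ => ⟨θ, h⟩⟩
  rw [hU, Monotone.measure_iUnion]
  · refine iSup_le fun N => measure_exists_sum_gap_le (ι := Fin N) (f := fun θ => f θ) hn hMpos ht
      (fun θ => hf θ) (fun θ => hM θ) μ ?_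
    filter_upwards [hρ] with S hS θ using hS fun ε => θ ε
  · rintro N N' h S ⟨θ, hθ⟩
    exact ⟨⟨θ, θ.2.trans_le h⟩, hθ⟩

/-- The uniform deviation inequality for a family of functions that depends continuously on a
parameter in a second countable space. -/
theorem measure_exists_gap_le {Θ : Type*} [TopologicalSpace Θ] [SecondCountableTopology Θ]
    {n : ℕ} {f : Θ → Z → ℝ} {C : Set Θ}
    {M ρ t : ℝ} (hn : 1 ≤ n) (hMpos : 0 < M) (ht : 0 ≤ t)
    (hf : ∀ θ, Measurable (f θ)) (hcont : ∀ z, Continuous fun θ => f θ z)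
    (hM : ∀ θ z, |f θ z| ≤ M) (μ : Measure Z)
    [IsProbabilityMeasure μ]
    (hρ : ∀ᵐ S ∂(Measure.pi fun _ : Fin n => μ), ∀ θ : (Fin n → ℤˣ) → C,
      ∑ ε, signedSum ε (fun i => f (θ ε) (S i)) ≤ 2 ^ n * (n * ρ)) :
    (Measure.pi fun _ : Fin n => μ)
        {S | ∃ θ ∈ C, 2 * ρ + t < ∫ z, f θ z ∂μ - (1 / (n : ℝ)) * ∑ i, f θ (S i)} ≤
      ENNReal.ofReal (Real.exp (-(n * t ^ 2 / (8 * M ^ 2)))) := by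
  rcases C.eq_empty_or_nonempty with rfl | hC
  · simp
  have : Nonempty C := hC.to_subtype
  obtain ⟨u, hu⟩ := TopologicalSpace.exists_dense_seq C
  refine le_trans (measure_mono ?_) (measure_exists_nat_gap_le (f := fun k => f (u k)) (ρ := ρ)
    hn hMpos ht (fun k => hf _) (fun k => hM _) μ ?_)
  · rintro S ⟨θ, hθC, hθ⟩
    have hc : Continuous fun θ : C => ∫ z, f θ z ∂μ - (1 / (n : ℝ)) * ∑ i, f θ (S i) := by
      refine Continuous.sub ?_ (continuous_const.mul (continuous_finsetSum _ fun i _ =>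
        (hcont (S i)).comp continuous_subtype_val))
      exact continuous_of_dominated (fun θ => (hf θ).aestronglyMeasurable)
        (fun θ => ae_of_all _ (hM θ)) (integrable_const M)
        (ae_of_all _ fun z => (hcont z).comp continuous_subtype_val)
    -- The gap is continuous in `θ` and the violation is a strict inequality, so it already occurs
    -- at a member of a dense sequence of `C`.
    have hopen := isOpen_Ioi.preimage hc (t := Set.Ioi (2 * ρ + t))
    obtain ⟨k, hk⟩ := hu.exists_mem_open hopen ⟨⟨θ, hθC⟩, hθ⟩
    exact ⟨k, hk⟩
  · filter_upwards [hρ] with S hS θ using hS fun ε => u (θ ε)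

end Symmetrization

/-! ### Norm estimates and homogeneity of the layers -/

/-- The Euclidean norm of a real vector. -/
noncomputable def euc {ι : Type*} [Fintype ι] (v : ι → ℝ) : ℝ := Real.sqrt (∑ i, v i ^ 2)

section Euc

variable {ι : Type*} [Fintype ι]

theorem euc_eq_norm (v : ι → ℝ) : euc v = ‖(WithLp.toLp 2 v : EuclideanSpace ℝ ι)‖ := by
  rw [EuclideanSpace.norm_eq, euc]
  simp

theorem euc_nonneg (v : ι → ℝ) : 0 ≤ euc v := Real.sqrt_nonneg _

theorem euc_sq (v : ι → ℝ) : euc v ^ 2 = ∑ i, v i ^ 2 :=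
  Real.sq_sqrt (Finset.sum_nonneg fun _ _ => sq_nonneg _)

theorem euc_zero : euc (0 : ι → ℝ) = 0 := by simp [euc]

theorem euc_add_le (v w : ι → ℝ) : euc (v + w) ≤ euc v + euc w := by
  simp only [euc_eq_norm, WithLp.toLp_add]
  exact norm_add_le _ _

theorem euc_smul (c : ℝ) (v : ι → ℝ) : euc (fun i => c * v i) = |c| * euc v := by
  have : (fun i => c * v i) = c • v := rfl
  simp only [this, euc_eq_norm, WithLp.toLp_smul, norm_smul, Real.norm_eq_abs]

theorem abs_sum_mul_le_euc (v w : ι → ℝ) : |∑ i, v i * w i| ≤ euc v * euc w := by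
  rw [← abs_of_nonneg (mul_nonneg (euc_nonneg v) (euc_nonneg w))]
  refine sq_le_sq.1 ?_
  rw [mul_pow, euc_sq, euc_sq]
  exact Finset.sum_mul_sq_le_sq_mul_sq _ _ _

theorem euc_le_of_sq_le {v : ι → ℝ} {c : ℝ} (hc : 0 ≤ c) (h : ∑ i, v i ^ 2 ≤ c ^ 2) :
    euc v ≤ c := by
  rw [← Real.sqrt_sq hc]
  exact Real.sqrt_le_sqrt h

theorem abs_le_euc (v : ι → ℝ) (i : ι) : |v i| ≤ euc v := by
  rw [← Real.sqrt_sq_eq_abs]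
  exact Real.sqrt_le_sqrt (Finset.single_le_sum (f := fun i => v i ^ 2)
    (fun _ _ => sq_nonneg _) (Finset.mem_univ i))

end Euc

theorem abs_relu_sub_le (a b : ℝ) : |max a 0 - max b 0| ≤ |a - b| :=
  abs_max_sub_max_le_abs a b 0

/-- A fully connected ReLU layer. -/
noncomputable def fcLayer {a b : ℕ} (W : Fin a × Fin b → ℝ) (z : Fin a → ℝ) : Fin b → ℝ :=
  fun j => max (∑ i, W (i, j) * z i) 0

/-- ReLU is 1-Lipschitz, the operator norm is at most the Frobenius norm, and `Wz - W'z' = W(z - z')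
+ (W - W')z'`. -/
theorem euc_fcLayer_sub_le {a b : ℕ} (W W' : Fin a × Fin b → ℝ) (z z' : Fin a → ℝ) :
    euc (fcLayer W z - fcLayer W' z') ≤ euc W * euc (z - z') + euc (W - W') * euc z' := by
  have lin : ∀ (V : Fin a × Fin b → ℝ) (y : Fin a → ℝ),
      euc (fun j => ∑ i, V (i, j) * y i) ≤ euc V * euc y := by
    intro V y
    refine euc_le_of_sq_le (mul_nonneg (euc_nonneg _) (euc_nonneg _)) ?_
    rw [mul_pow, euc_sq, euc_sq, Fintype.sum_prod_type_right, Finset.sum_mul]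
    exact Finset.sum_le_sum fun j _ => Finset.sum_mul_sq_le_sq_mul_sq _ _ _
  refine le_trans ?_ ((euc_add_le (fun j => ∑ i, W (i, j) * (z - z') i)
    (fun j => ∑ i, (W - W') (i, j) * z' i)).trans (add_le_add (lin _ _) (lin _ _)))
  refine Real.sqrt_le_sqrt (Finset.sum_le_sum fun j _ => sq_le_sq.2 ?_)
  refine (abs_relu_sub_le _ _).trans (le_of_eq ?_)
  congr 1
  simp only [Pi.add_apply, Pi.sub_apply, ← Finset.sum_sub_distrib, ← Finset.sum_add_distrib]
  exact Finset.sum_congr rfl fun i _ => by ring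

namespace Arch

variable (A : Arch)

/-- The convolution with the kernel `w`, before the ReLU. -/
noncomputable def convPre {l : ℕ} (hl : l < A.LC) (w : Fin (A.s l) → ℝ) (z : Fin (A.m l) → ℝ)
    (q : Fin (A.m (l + 1)) × Fin (A.s l)) : ℝ :=
  ∑ i : Fin (A.s l), w i * z ⟨(q.1 : ℕ) * A.s l + q.2 + i, A.conv_index_lt hl q.1 q.2 i⟩

/-- A convolutional layer: convolution, ReLU and average pooling. -/
noncomputable def convLayer {l : ℕ} (hl : l < A.LC) (w : Fin (A.s l) → ℝ) (z : Fin (A.m l) → ℝ) :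
    Fin (A.m (l + 1)) → ℝ :=
  fun k => (1 / (A.s l : ℝ)) * ∑ j : Fin (A.s l), max (A.convPre hl w z (k, j)) 0

theorem convFeature_succ (Θ : A.Params) (x : Fin A.d → ℝ) (l : ℕ) (h : l + 1 ≤ A.LC) :
    A.convFeature Θ x (l + 1) h =
      A.convLayer h (fun i => Θ (Sum.inl ⟨⟨l, h⟩, i⟩)) (A.convFeature Θ x l (Nat.le_of_succ_le h)) :=
  rfl

theorem fcFeature_succ (Θ : A.Params) (x : Fin A.d → ℝ) (l : ℕ) (h : l + 1 ≤ A.LF) :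
    A.fcFeature Θ x (l + 1) h =
      fcLayer (fun q => Θ (Sum.inr (Sum.inl ⟨⟨l, h⟩, q⟩)))
        (A.fcFeature Θ x l (Nat.le_of_succ_le h)) :=
  rfl

/-- By Cauchy–Schwarz in each window. For a fixed offset `i` the position `k * s + j + i` determines
`(k, j)`, so each entry of `z` is used at most once per offset, hence at most `s` times. -/
theorem sum_convPre_sq_le {l : ℕ} (hl : l < A.LC) (w : Fin (A.s l) → ℝ) (z : Fin (A.m l) → ℝ) :
    ∑ q, A.convPre hl w z q ^ 2 ≤ A.s l * (euc w * euc z) ^ 2 := by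
  have h1 : ∀ q, A.convPre hl w z q ^ 2 ≤ (∑ i, w i ^ 2) * ∑ i : Fin (A.s l),
      z ⟨(q.1 : ℕ) * A.s l + q.2 + i, A.conv_index_lt hl q.1 q.2 i⟩ ^ 2 := fun q =>
    Finset.sum_mul_sq_le_sq_mul_sq _ _ _
  have h2 : ∀ i : Fin (A.s l), ∑ q : Fin (A.m (l + 1)) × Fin (A.s l),
      z ⟨(q.1 : ℕ) * A.s l + q.2 + i, A.conv_index_lt hl q.1 q.2 i⟩ ^ 2 ≤ ∑ j, z j ^ 2 := by
    intro i
    have hinj : Function.Injective fun q : Fin (A.m (l + 1)) × Fin (A.s l) =>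
        (⟨(q.1 : ℕ) * A.s l + q.2 + i, A.conv_index_lt hl q.1 q.2 i⟩ : Fin (A.m l)) := by
      rintro ⟨k, j⟩ ⟨k', j'⟩ h
      have h3 : (j : ℕ) + A.s l * k = j' + A.s l * k' := by
        have := congrArg Fin.val h
        simp only at this
        rw [mul_comm, mul_comm (A.s l)]
        omega
      have hs : 0 < A.s l := A.s_pos l hl
      have h4 : (k : ℕ) = k' := by
        have := congrArg (· / A.s l) h3
        simpa [Nat.add_mul_div_left _ _ hs, Nat.div_eq_of_lt j.2, Nat.div_eq_of_lt j'.2] using this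
      rw [h4] at h3
      exact Prod.ext (Fin.ext h4) (Fin.ext (by simpa using h3))
    rw [← Finset.sum_image (g := fun q : Fin (A.m (l + 1)) × Fin (A.s l) =>
        (⟨(q.1 : ℕ) * A.s l + q.2 + i, A.conv_index_lt hl q.1 q.2 i⟩ : Fin (A.m l)))
      (f := fun j => z j ^ 2) hinj.injOn]
    exact Finset.sum_le_sum_of_subset_of_nonneg (Finset.subset_univ _) fun _ _ _ => sq_nonneg _
  refine (Finset.sum_le_sum fun q _ => h1 q).trans ?_
  rw [← Finset.mul_sum, Finset.sum_comm, mul_pow, euc_sq, euc_sq, ← mul_assoc,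
    mul_comm (A.s l : ℝ), mul_assoc]
  refine mul_le_mul_of_nonneg_left ?_ (Finset.sum_nonneg fun _ _ => sq_nonneg _)
  refine (Finset.sum_le_card_nsmul _ _ _ fun i _ => h2 i).trans ?_
  simp

theorem euc_convLayer_sub_le {l : ℕ} (hl : l < A.LC) (w w' : Fin (A.s l) → ℝ)
    (z z' : Fin (A.m l) → ℝ) :
    euc (A.convLayer hl w z - A.convLayer hl w' z') ≤
      euc w * euc (z - z') + euc (w - w') * euc z' := by
  have hs : (0 : ℝ) < A.s l := by exact_mod_cast A.s_pos l hl
  have lin : ∀ (v : Fin (A.s l) → ℝ) (y : Fin (A.m l) → ℝ),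
      euc (A.convPre hl v y) ≤ Real.sqrt (A.s l) * (euc v * euc y) := by
    intro v y
    refine euc_le_of_sq_le (by have := euc_nonneg v; have := euc_nonneg y; positivity) ?_
    rw [mul_pow, Real.sq_sqrt hs.le]
    exact A.sum_convPre_sq_le hl v y
  have hdiff : A.convPre hl w z - A.convPre hl w' z' =
      A.convPre hl w (z - z') + A.convPre hl (w - w') z' := by
    ext q
    simp only [convPre, Pi.add_apply, Pi.sub_apply, ← Finset.sum_sub_distrib,
      ← Finset.sum_add_distrib]
    exact Finset.sum_congr rfl fun i _ => by ring
  have h1 : euc (A.convPre hl w z - A.convPre hl w' z') ≤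
      Real.sqrt (A.s l) * (euc w * euc (z - z') + euc (w - w') * euc z') := by
    rw [hdiff, mul_add]
    exact (euc_add_le _ _).trans (add_le_add (lin _ _) (lin _ _))
  refine euc_le_of_sq_le (add_nonneg (mul_nonneg (euc_nonneg _) (euc_nonneg _))
    (mul_nonneg (euc_nonneg _) (euc_nonneg _))) ?_
  set B := euc w * euc (z - z') + euc (w - w') * euc z'
  -- Cauchy–Schwarz over the pooling window gains the factor `1 / s`, which cancels the overlap
  -- factor `s` of the convolution.
  have h2 : ∀ k, (A.convLayer hl w z - A.convLayer hl w' z') k ^ 2 ≤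
      (1 / (A.s l : ℝ)) * ∑ j, (A.convPre hl w z - A.convPre hl w' z') (k, j) ^ 2 := by
    intro k
    have e : (A.convLayer hl w z - A.convLayer hl w' z') k = (1 / (A.s l : ℝ)) *
        ∑ j, (max (A.convPre hl w z (k, j)) 0 - max (A.convPre hl w' z' (k, j)) 0) := by
      simp only [convLayer, Pi.sub_apply, Finset.sum_sub_distrib, mul_sub]
    have c := sq_sum_le_card_mul_sum_sq (s := Finset.univ) (f := fun j : Fin (A.s l) =>
      max (A.convPre hl w z (k, j)) 0 - max (A.convPre hl w' z' (k, j)) 0)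
    have d : ∑ j : Fin (A.s l),
        (max (A.convPre hl w z (k, j)) 0 - max (A.convPre hl w' z' (k, j)) 0) ^ 2 ≤
        ∑ j, (A.convPre hl w z - A.convPre hl w' z') (k, j) ^ 2 :=
      Finset.sum_le_sum fun j _ => sq_le_sq.2 (abs_relu_sub_le _ _)
    simp only [Finset.card_univ, Fintype.card_fin] at c
    rw [e, mul_pow]
    have : (1 / (A.s l : ℝ)) ^ 2 * ((A.s l : ℝ) *
        ∑ j, (A.convPre hl w z - A.convPre hl w' z') (k, j) ^ 2) = (1 / (A.s l : ℝ)) *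
        ∑ j, (A.convPre hl w z - A.convPre hl w' z') (k, j) ^ 2 := by
      field_simp
    rw [← this]
    refine mul_le_mul_of_nonneg_left (c.trans ?_) (by positivity)
    exact mul_le_mul_of_nonneg_left d hs.le
  refine (Finset.sum_le_sum fun k _ => h2 k).trans ?_
  rw [← Finset.mul_sum, ← Fintype.sum_prod_type', ← euc_sq, one_div, inv_mul_le_iff₀ hs]
  calc euc (A.convPre hl w z - A.convPre hl w' z') ^ 2 ≤ (Real.sqrt (A.s l) * B) ^ 2 :=
        pow_le_pow_left₀ (euc_nonneg _) h1 2
    _ = A.s l * B ^ 2 := by rw [mul_pow, Real.sq_sqrt hs.le]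

/-- The number of the layer, from `0` to `L`, to which a parameter belongs. -/
def layerNo : A.Idx → ℕ
  | Sum.inl ⟨l, _⟩ => l
  | Sum.inr (Sum.inl ⟨l, _⟩) => A.LC + l
  | Sum.inr (Sum.inr _) => A.LC + A.LF

/-- The squared Euclidean norm of the parameters of one layer. -/
noncomputable def layerSq (Θ : A.Params) (l : ℕ) : ℝ :=
  ∑ i, if A.layerNo i = l then Θ i ^ 2 else 0

/-- The Euclidean norm of the parameters of one layer. -/
noncomputable def layerNorm (Θ : A.Params) (l : ℕ) : ℝ := Real.sqrt (A.layerSq Θ l)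

theorem layerSq_nonneg (Θ : A.Params) (l : ℕ) : 0 ≤ A.layerSq Θ l :=
  Finset.sum_nonneg fun _ _ => by split_ifs <;> positivity

theorem layerNorm_nonneg (Θ : A.Params) (l : ℕ) : 0 ≤ A.layerNorm Θ l := Real.sqrt_nonneg _

theorem sum_layer_conv (l : Fin A.LC) (g : A.Idx → ℝ) :
    (∑ i, if A.layerNo i = l then g i else 0) = ∑ i, g (Sum.inl ⟨l, i⟩) := by
  have hl := l.2
  rw [Fintype.sum_sum_type, Fintype.sum_sum_type, Fintype.sum_sigma, Fintype.sum_sigma]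
  have h1 : ∀ k : Fin A.LF, A.LC + (k : ℕ) ≠ l := fun k => by omega
  have h2 : A.LC + A.LF ≠ l := by omega
  simp only [layerNo, h1, h2, if_false, Finset.sum_const_zero, add_zero]
  rw [Finset.sum_eq_single l]
  · simp
  · intro b _ hb
    have : (b : ℕ) ≠ l := fun h => hb (Fin.ext h)
    simp [this]
  · simp

theorem sum_layer_fc (l : Fin A.LF) (g : A.Idx → ℝ) :
    (∑ i, if A.layerNo i = A.LC + l then g i else 0) =
      ∑ q, g (Sum.inr (Sum.inl ⟨l, q⟩)) := by
  have hl := l.2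
  rw [Fintype.sum_sum_type, Fintype.sum_sum_type, Fintype.sum_sigma, Fintype.sum_sigma]
  have h1 : ∀ k : Fin A.LC, (k : ℕ) ≠ A.LC + l := fun k => by omega
  have h2 : A.LC + A.LF ≠ A.LC + l := by omega
  simp only [layerNo, h1, h2, if_false, Finset.sum_const_zero, add_zero, zero_add]
  rw [Finset.sum_eq_single l]
  · simp
  · intro b _ hb
    have : (b : ℕ) ≠ l := fun h => hb (Fin.ext h)
    simp [this]
  · simp

theorem sum_layer_out (g : A.Idx → ℝ) :
    (∑ i, if A.layerNo i = A.LC + A.LF then g i else 0) =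
      ∑ k, g (Sum.inr (Sum.inr k)) := by
  rw [Fintype.sum_sum_type, Fintype.sum_sum_type, Fintype.sum_sigma, Fintype.sum_sigma]
  have h1 : ∀ k : Fin A.LC, (k : ℕ) ≠ A.LC + A.LF := fun k => by omega
  have h2 : ∀ k : Fin A.LF, A.LC + (k : ℕ) ≠ A.LC + A.LF := fun k => by omega
  simp only [layerNo, h1, h2, if_false, Finset.sum_const_zero, zero_add, if_true]

theorem euc_conv_weights (Θ : A.Params) {l : ℕ} (h : l < A.LC) :
    euc (fun i => Θ (Sum.inl ⟨⟨l, h⟩, i⟩)) = A.layerNorm Θ l := by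
  rw [euc, layerNorm, layerSq, A.sum_layer_conv ⟨l, h⟩ (fun i => Θ i ^ 2)]

theorem euc_fc_weights (Θ : A.Params) {l : ℕ} (h : l < A.LF) :
    euc (fun q => Θ (Sum.inr (Sum.inl ⟨⟨l, h⟩, q⟩))) = A.layerNorm Θ (A.LC + l) := by
  rw [euc, layerNorm, layerSq, A.sum_layer_fc ⟨l, h⟩ (fun i => Θ i ^ 2)]

theorem euc_out_weights (Θ : A.Params) :
    euc (fun k => Θ (Sum.inr (Sum.inr k))) = A.layerNorm Θ (A.LC + A.LF) := by
  rw [euc, layerNorm, layerSq, A.sum_layer_out (fun i => Θ i ^ 2)]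

theorem euc_convFeature_sub_le (Θ Θ' : A.Params) (x : Fin A.d → ℝ) (l : ℕ) (h : l + 1 ≤ A.LC) :
    euc (A.convFeature Θ x (l + 1) h - A.convFeature Θ' x (l + 1) h) ≤
      A.layerNorm Θ l * euc (A.convFeature Θ x l (Nat.le_of_succ_le h) -
        A.convFeature Θ' x l (Nat.le_of_succ_le h)) +
      A.layerNorm (Θ - Θ') l * euc (A.convFeature Θ' x l (Nat.le_of_succ_le h)) := by
  rw [convFeature_succ, convFeature_succ, ← A.euc_conv_weights Θ h,
    ← A.euc_conv_weights (Θ - Θ') h]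
  exact A.euc_convLayer_sub_le h _ _ _ _

theorem euc_fcFeature_sub_le (Θ Θ' : A.Params) (x : Fin A.d → ℝ) (l : ℕ) (h : l + 1 ≤ A.LF) :
    euc (A.fcFeature Θ x (l + 1) h - A.fcFeature Θ' x (l + 1) h) ≤
      A.layerNorm Θ (A.LC + l) * euc (A.fcFeature Θ x l (Nat.le_of_succ_le h) -
        A.fcFeature Θ' x l (Nat.le_of_succ_le h)) +
      A.layerNorm (Θ - Θ') (A.LC + l) * euc (A.fcFeature Θ' x l (Nat.le_of_succ_le h)) := by
  rw [fcFeature_succ, fcFeature_succ, ← A.euc_fc_weights Θ h,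
    ← A.euc_fc_weights (Θ - Θ') h]
  exact euc_fcLayer_sub_le _ _ _ _

theorem euc_convFeature_succ_le (Θ : A.Params) (x : Fin A.d → ℝ) (l : ℕ) (h : l + 1 ≤ A.LC) :
    euc (A.convFeature Θ x (l + 1) h) ≤
      A.layerNorm Θ l * euc (A.convFeature Θ x l (Nat.le_of_succ_le h)) := by
  have h1 := A.euc_convLayer_sub_le h (fun i => Θ (Sum.inl ⟨⟨l, h⟩, i⟩)) 0
    (A.convFeature Θ x l (Nat.le_of_succ_le h)) 0
  have h0 : A.convLayer h 0 0 = 0 := by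
    ext k
    simp [convLayer, convPre]
  rw [h0, sub_zero, sub_zero, euc_zero, mul_zero, add_zero, A.euc_conv_weights Θ h] at h1
  exact h1

theorem euc_fcFeature_succ_le (Θ : A.Params) (x : Fin A.d → ℝ) (l : ℕ) (h : l + 1 ≤ A.LF) :
    euc (A.fcFeature Θ x (l + 1) h) ≤
      A.layerNorm Θ (A.LC + l) * euc (A.fcFeature Θ x l (Nat.le_of_succ_le h)) := by
  have h1 := euc_fcLayer_sub_le (fun q => Θ (Sum.inr (Sum.inl ⟨⟨l, h⟩, q⟩))) 0
    (A.fcFeature Θ x l (Nat.le_of_succ_le h)) 0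
  have h0 : fcLayer (0 : Fin (A.m (A.LC + l)) × Fin (A.m (A.LC + l + 1)) → ℝ) 0 = 0 := by
    ext k
    simp [fcLayer]
  rw [h0, sub_zero, sub_zero, euc_zero, mul_zero, add_zero, A.euc_fc_weights Θ h] at h1
  exact h1

/-- Parameter vectors all of whose layers have Euclidean norm at most `r`. -/
def layerBall (r : ℝ) : Set A.Params := {Θ | ∀ l ≤ A.LC + A.LF, A.layerNorm Θ l ≤ r}

variable {A} {r : ℝ} {Θ Θ' : A.Params} {x : Fin A.d → ℝ}

theorem euc_convFeature_le (hr : 0 ≤ r) (hΘ : Θ ∈ A.layerBall r) (hx : euc x ≤ 1) (l : ℕ)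
    (h : l ≤ A.LC) : euc (A.convFeature Θ x l h) ≤ r ^ l := by
  induction l with
  | zero => simpa [convFeature] using hx
  | succ l ih =>
    refine (A.euc_convFeature_succ_le Θ x l h).trans ?_
    rw [pow_succ']
    exact mul_le_mul (hΘ l (by omega)) (ih _) (euc_nonneg _) hr

theorem euc_fcFeature_le (hr : 0 ≤ r) (hΘ : Θ ∈ A.layerBall r) (hx : euc x ≤ 1) (l : ℕ)
    (h : l ≤ A.LF) : euc (A.fcFeature Θ x l h) ≤ r ^ (A.LC + l) := by
  induction l with
  | zero => exact euc_convFeature_le hr hΘ hx _ _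
  | succ l ih =>
    refine (A.euc_fcFeature_succ_le Θ x l h).trans ?_
    rw [← add_assoc, pow_succ']
    exact mul_le_mul (hΘ _ (by omega)) (ih _) (euc_nonneg _) hr

/-- The induction step shared by all layers: `D` and `c` are the feature differences before and
after the layer, `S` the sum of the earlier parameter differences. The factor `r` on the left avoids
the exponent `l - 1` of the natural bound `r^{l-1} S`. -/
theorem mul_add_le_of_layer {N N' D z c S : ℝ} (l : ℕ) (hr : 0 ≤ r) (hN : N ≤ r) (hD0 : 0 ≤ D)
    (hN' : 0 ≤ N') (hD : r * D ≤ r ^ l * S) (hz : z ≤ r ^ l) (hc : c ≤ N * D + N' * z) :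
    r * c ≤ r ^ (l + 1) * (S + N') := by
  calc r * c ≤ r * (N * D + N' * z) := mul_le_mul_of_nonneg_left hc hr
    _ ≤ r * (r * D + N' * r ^ l) := by gcongr
    _ = r * (r * D) + r ^ (l + 1) * N' := by ring
    _ ≤ r * (r ^ l * S) + r ^ (l + 1) * N' := by gcongr
    _ = r ^ (l + 1) * (S + N') := by ring

theorem mul_euc_convFeature_sub_le (hr : 0 ≤ r) (hΘ : Θ ∈ A.layerBall r)
    (hΘ' : Θ' ∈ A.layerBall r) (hx : euc x ≤ 1) (l : ℕ) (h : l ≤ A.LC) :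
    r * euc (A.convFeature Θ x l h - A.convFeature Θ' x l h) ≤
      r ^ l * ∑ k ∈ Finset.range l, A.layerNorm (Θ - Θ') k := by
  induction l with
  | zero =>
    have : A.convFeature Θ x 0 h - A.convFeature Θ' x 0 h = 0 := by simp [convFeature]
    rw [this, euc_zero]
    simp
  | succ l ih =>
    rw [Finset.sum_range_succ]
    exact mul_add_le_of_layer l hr (hΘ l (by omega)) (euc_nonneg _) (A.layerNorm_nonneg _ _)
      (ih (Nat.le_of_succ_le h)) (euc_convFeature_le hr hΘ' hx l _)
      (A.euc_convFeature_sub_le Θ Θ' x l h)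

theorem mul_euc_fcFeature_sub_le (hr : 0 ≤ r) (hΘ : Θ ∈ A.layerBall r)
    (hΘ' : Θ' ∈ A.layerBall r) (hx : euc x ≤ 1) (l : ℕ) (h : l ≤ A.LF) :
    r * euc (A.fcFeature Θ x l h - A.fcFeature Θ' x l h) ≤
      r ^ (A.LC + l) * ∑ k ∈ Finset.range (A.LC + l), A.layerNorm (Θ - Θ') k := by
  induction l with
  | zero => exact mul_euc_convFeature_sub_le hr hΘ hΘ' hx _ _
  | succ l ih =>
    change _ ≤ r ^ (A.LC + l + 1) * ∑ k ∈ Finset.range (A.LC + l + 1), A.layerNorm (Θ - Θ') k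
    rw [Finset.sum_range_succ]
    exact mul_add_le_of_layer _ hr (hΘ _ (by omega)) (euc_nonneg _) (A.layerNorm_nonneg _ _)
      (ih (Nat.le_of_succ_le h)) (euc_fcFeature_le hr hΘ' hx l _)
      (A.euc_fcFeature_sub_le Θ Θ' x l h)

theorem width_rpow_pos (A : Arch) (p : ℝ) : (0 : ℝ) < (A.width : ℝ) ^ p :=
  Real.rpow_pos_of_pos (by exact_mod_cast A.m_pos _ le_rfl) p

/-- The network function is Lipschitz in the parameters. -/
theorem mul_abs_net_sub_le (p : ℝ) (hr : 0 ≤ r) (hΘ : Θ ∈ A.layerBall r)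
    (hΘ' : Θ' ∈ A.layerBall r) (hx : euc x ≤ 1) :
    r * |A.net p Θ x - A.net p Θ' x| ≤ (1 / (A.width : ℝ) ^ p) *
      (r ^ (A.L + 1) * ∑ k ∈ Finset.range (A.L + 1), A.layerNorm (Θ - Θ') k) := by
  have hw := A.width_rpow_pos p
  rw [net, net, ← mul_sub, abs_mul, abs_of_pos (by positivity : (0 : ℝ) < 1 / (A.width : ℝ) ^ p),
    ← mul_assoc, mul_comm r, mul_assoc]
  refine mul_le_mul_of_nonneg_left ?_ (by positivity)
  rw [Finset.sum_range_succ]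
  refine mul_add_le_of_layer _ hr (hΘ _ le_rfl) (euc_nonneg _) (A.layerNorm_nonneg _ _)
    (mul_euc_fcFeature_sub_le hr hΘ hΘ' hx A.LF le_rfl) (euc_fcFeature_le hr hΘ' hx A.LF le_rfl) ?_
  rw [← A.euc_out_weights Θ, ← A.euc_out_weights (Θ - Θ')]
  refine le_trans (le_of_eq ?_) ((abs_add_le _ _).trans
    (add_le_add (abs_sum_mul_le_euc _ _) (abs_sum_mul_le_euc _ _)))
  congr 1
  simp only [Pi.sub_apply, ← Finset.sum_sub_distrib, ← Finset.sum_add_distrib]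
  exact Finset.sum_congr rfl fun i _ => by ring

theorem continuous_convFeature (A : Arch) (l : ℕ) (h : l ≤ A.LC) :
    Continuous fun q : A.Params × (Fin A.d → ℝ) => A.convFeature q.1 q.2 l h := by
  induction l with
  | zero => exact continuous_snd
  | succ l ih =>
    have := ih (Nat.le_of_succ_le h)
    simp only [convFeature]
    fun_prop

theorem continuous_fcFeature (A : Arch) (l : ℕ) (h : l ≤ A.LF) :
    Continuous fun q : A.Params × (Fin A.d → ℝ) => A.fcFeature q.1 q.2 l h := by
  induction l with
  | zero => exact A.continuous_convFeature _ _
  | succ l ih =>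
    have := ih (Nat.le_of_succ_le h)
    simp only [fcFeature]
    fun_prop

theorem continuous_net (A : Arch) (p : ℝ) :
    Continuous fun q : A.Params × (Fin A.d → ℝ) => A.net p q.1 q.2 := by
  have := A.continuous_fcFeature A.LF le_rfl
  simp only [net]
  fun_prop

/-- Rescaling of each layer by a factor. -/
def scaleLayers (A : Arch) (c : ℕ → ℝ) (Θ : A.Params) : A.Params := fun i => c (A.layerNo i) * Θ i

theorem relu_mul {c : ℝ} (hc : 0 ≤ c) (t : ℝ) : max (c * t) 0 = c * max t 0 := by
  rw [mul_max_of_nonneg _ _ hc, mul_zero]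

theorem convFeature_scaleLayers {c : ℕ → ℝ} (hc : ∀ l, 0 ≤ c l) (l : ℕ) (h : l ≤ A.LC) :
    A.convFeature (A.scaleLayers c Θ) x l h =
      fun k => (∏ j ∈ Finset.range l, c j) * A.convFeature Θ x l h k := by
  induction l with
  | zero => simp [convFeature]
  | succ l ih =>
    ext k
    simp only [convFeature, ih (Nat.le_of_succ_le h), scaleLayers, layerNo]
    rw [mul_left_comm]
    refine congrArg _ ?_
    rw [Finset.mul_sum]
    refine Finset.sum_congr rfl fun j _ => ?_
    rw [← relu_mul (Finset.prod_nonneg fun l _ => hc l), Finset.mul_sum, Finset.prod_range_succ]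
    refine congrArg (max · 0) ?_
    exact Finset.sum_congr rfl fun i _ => by ring

theorem fcFeature_scaleLayers {c : ℕ → ℝ} (hc : ∀ l, 0 ≤ c l) (l : ℕ) (h : l ≤ A.LF) :
    A.fcFeature (A.scaleLayers c Θ) x l h =
      fun k => (∏ j ∈ Finset.range (A.LC + l), c j) * A.fcFeature Θ x l h k := by
  induction l with
  | zero => exact convFeature_scaleLayers hc _ _
  | succ l ih =>
    ext k
    simp only [fcFeature, ih (Nat.le_of_succ_le h), scaleLayers, layerNo]
    rw [← relu_mul (Finset.prod_nonneg fun l _ => hc l), Finset.mul_sum, ← add_assoc,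
      Finset.prod_range_succ]
    congr 1
    exact Finset.sum_congr rfl fun i _ => by ring

/-- Homogeneity in each layer separately; the factors must be nonnegative to pass through the ReLUs.
-/
theorem net_scaleLayers (p : ℝ) {c : ℕ → ℝ} (hc : ∀ l, 0 ≤ c l) :
    A.net p (A.scaleLayers c Θ) x = (∏ j ∈ Finset.range (A.L + 1), c j) * A.net p Θ x := by
  simp only [net, fcFeature_scaleLayers hc, scaleLayers, layerNo]
  rw [mul_left_comm]
  refine congrArg _ ?_
  rw [Finset.mul_sum]
  refine Finset.sum_congr rfl fun j _ => ?_
  rw [Finset.prod_range_succ]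
  ring

end Arch

/-! ### Rademacher averages of networks by peeling layers -/

theorem signedSum_const_mul {n : ℕ} (ε : Fin n → ℤˣ) (c : ℝ) (v : Fin n → ℝ) :
    signedSum ε (fun i => c * v i) = c * signedSum ε v := by
  rw [signedSum, signedSum, Finset.mul_sum]
  exact Finset.sum_congr rfl fun i _ => by ring

theorem signedSum_sum {n : ℕ} {κ : Type*} (s : Finset κ) (ε : Fin n → ℤˣ) (v : κ → Fin n → ℝ) :
    signedSum ε (fun i => ∑ k ∈ s, v k i) = ∑ k ∈ s, signedSum ε (v k) := by
  simp only [signedSum, Finset.mul_sum]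
  exact Finset.sum_comm

/-- The vector of signed sums of the coordinates. -/
def signedVec {n : ℕ} {κ : Type*} (ε : Fin n → ℤˣ) (z : Fin n → κ → ℝ) : κ → ℝ :=
  fun k => signedSum ε fun i => z i k

theorem signedSum_sum_mul {n : ℕ} {κ : Type*} [Fintype κ] (ε : Fin n → ℤˣ) (u : κ → ℝ)
    (z : Fin n → κ → ℝ) :
    signedSum ε (fun i => ∑ k, u k * z i k) = ∑ k, u k * signedVec ε z k := by
  rw [signedSum_sum]
  exact Finset.sum_congr rfl fun k _ => signedSum_const_mul _ _ _

/-- Write column `j` of `W` as `N_j u_j` with `|u_j| ≤ 1`. The norm `N_j` passes through the ReLU,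
and `∑ N_j² = ‖W‖²`, so the neuron with the largest signed sum dominates the layer, whatever its
width. -/
theorem exists_unit_euc_fcLayer_le {a b n : ℕ} {W : Fin a × Fin b → ℝ} {r : ℝ} (hr : 0 ≤ r)
    (hW : euc W ≤ r) (z : Fin n → Fin a → ℝ) (ε : Fin n → ℤˣ) :
    ∃ u : Fin a → ℝ, euc u ≤ 1 ∧ euc (signedVec ε fun i => fcLayer W (z i)) ≤
      r * |signedSum ε fun i => max (∑ k, u k * z i k) 0| := by
  rcases isEmpty_or_nonempty (Fin b) with hb | hb
  · refine ⟨0, by simp [euc_zero], ?_⟩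
    rw [euc, Finset.univ_eq_empty, Finset.sum_empty, Real.sqrt_zero]
    positivity
  set N : Fin b → ℝ := fun j => euc fun k => W (k, j) with hN
  have hN0 : ∀ j, 0 ≤ N j := fun j => euc_nonneg _
  set u : Fin b → Fin a → ℝ := fun j k => (N j)⁻¹ * W (k, j) with hu
  have hWu : ∀ k j, W (k, j) = N j * u j k := by
    intro k j
    by_cases h : N j = 0
    · have := abs_le_euc (fun k => W (k, j)) k
      have h' : euc (fun k => W (k, j)) = 0 := h
      rw [h'] at this
      rw [h, zero_mul]
      exact abs_eq_zero.1 (le_antisymm this (abs_nonneg _))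
    · rw [hu]
      field_simp
  have hu1 : ∀ j, euc (u j) ≤ 1 := by
    intro j
    rw [hu, euc_smul, abs_of_nonneg (inv_nonneg.2 (hN0 j))]
    by_cases h : N j = 0
    · rw [h]; simp
    · exact (inv_mul_cancel₀ h).le
  obtain ⟨j₀, hj₀⟩ := Finite.exists_max fun j => |signedSum ε fun i => max (∑ k, u j k * z i k) 0|
  refine ⟨u j₀, hu1 j₀, euc_le_of_sq_le (by positivity) ?_⟩
  set t := |signedSum ε fun i => max (∑ k, u j₀ k * z i k) 0|
  have hcol : ∀ j, signedVec ε (fun i => fcLayer W (z i)) j ^ 2 ≤ N j ^ 2 * t ^ 2 := by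
    intro j
    have : signedVec ε (fun i => fcLayer W (z i)) j =
        N j * signedSum ε fun i => max (∑ k, u j k * z i k) 0 := by
      rw [← signedSum_const_mul, signedVec]
      congr 1
      ext i
      rw [fcLayer, ← Arch.relu_mul (hN0 j), Finset.mul_sum]
      refine congrArg (max · 0) (Finset.sum_congr rfl fun k _ => ?_)
      rw [hWu k j, mul_assoc]
    rw [this, mul_pow]
    refine mul_le_mul_of_nonneg_left ?_ (sq_nonneg _)
    rw [← sq_abs]
    exact pow_le_pow_left₀ (abs_nonneg _) (hj₀ j) 2
  refine (Finset.sum_le_sum fun j _ => hcol j).trans ?_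
  rw [← Finset.sum_mul, mul_pow]
  refine mul_le_mul_of_nonneg_right ?_ (sq_nonneg _)
  have : ∑ j, N j ^ 2 = euc W ^ 2 := by
    simp only [hN, euc_sq]
    rw [Fintype.sum_prod_type_right]
  rw [this]
  exact pow_le_pow_left₀ (euc_nonneg _) hW 2

/-- Peeling a fully connected layer: the selection is enlarged by a unit vector `u` that depends on
`ε`, the ReLU is removed at cost `2`, and Cauchy–Schwarz removes `u` again. -/
theorem sum_exp_fcLayer_le {a b n : ℕ} {P : Type*} {W : P → Fin a × Fin b → ℝ}
    {z : P → Fin n → Fin a → ℝ} {r l U : ℝ} (hr : 0 ≤ r) (hl : 0 ≤ l) (hW : ∀ p, euc (W p) ≤ r)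
    (hU : ∀ h : (Fin n → ℤˣ) → P, ∑ ε, Real.exp (l * r * euc (signedVec ε (z (h ε)))) ≤ U)
    (h : (Fin n → ℤˣ) → P) :
    ∑ ε, Real.exp (l * euc (signedVec ε fun i => fcLayer (W (h ε)) (z (h ε) i))) ≤ 2 * U := by
  choose u hu1 hu2 using fun ε => exists_unit_euc_fcLayer_le hr (hW (h ε)) (z (h ε)) ε
  refine le_trans (Finset.sum_le_sum fun ε _ => ?_)
    (sum_exp_abs_relu_le (P := P × {u : Fin a → ℝ // euc u ≤ 1}) (l := l * r) (U := U)
      (v := fun q i => ∑ k, q.2.1 k * z q.1 i k) (by positivity) (fun q => ?_)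
      (fun ε => (h ε, ⟨u ε, hu1 ε⟩)))
  · refine Real.exp_le_exp.2 ?_
    rw [mul_assoc]
    exact mul_le_mul_of_nonneg_left (hu2 ε) hl
  · refine le_trans (Finset.sum_le_sum fun ε _ => ?_) (hU fun ε => (q ε).1)
    refine Real.exp_le_exp.2 (mul_le_mul_of_nonneg_left ?_ (by positivity))
    rw [signedSum_sum_mul]
    refine (abs_sum_mul_le_euc _ _).trans ?_
    exact mul_le_of_le_one_left (euc_nonneg _) (q ε).2.2

theorem euc_le_sqrt_card_mul {ι : Type*} [Fintype ι] {v : ι → ℝ} {t : ℝ} (ht : 0 ≤ t)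
    (h : ∀ i, |v i| ≤ t) : euc v ≤ Real.sqrt (Fintype.card ι) * t := by
  refine euc_le_of_sq_le (by positivity) ?_
  rw [mul_pow, Real.sq_sqrt (by positivity)]
  refine (Finset.sum_le_card_nsmul _ _ (t ^ 2) fun i _ => ?_).trans (by simp)
  rw [← sq_abs]
  exact pow_le_pow_left₀ (abs_nonneg _) (h i) 2

namespace Arch

variable {A : Arch}

/-- Convolutional layers are peeled in the maximum norm, so the selection carries a coordinate. A
pooled value is at most the largest in its window, and a convolution with a kernel of norm `r` is at
most `√s r` times the largest entry that it meets. -/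
theorem sum_exp_convLayer_le {n j : ℕ} (hj : j < A.LC) {P : Type*} {w : P → Fin (A.s j) → ℝ}
    {z : P → Fin n → Fin (A.m j) → ℝ} {r l U : ℝ} (hl : 0 ≤ l)
    (hr : 0 ≤ r) (hw : ∀ p, euc (w p) ≤ r)
    (hU : ∀ h : (Fin n → ℤˣ) → P × Fin (A.m j), ∑ ε, Real.exp (l * (Real.sqrt (A.s j) * r) *
      |signedVec ε (z (h ε).1) (h ε).2|) ≤ U)
    (h : (Fin n → ℤˣ) → P × Fin (A.m (j + 1))) :
    ∑ ε, Real.exp (l * |signedVec ε (fun i => A.convLayer hj (w (h ε).1) (z (h ε).1 i)) (h ε).2|) ≤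
      2 * U := by
  have hs : (0 : ℝ) < A.s j := by exact_mod_cast A.s_pos j hj
  have : Nonempty (Fin (A.s j)) := ⟨⟨0, A.s_pos j hj⟩⟩
  have hpool : ∀ (ε : Fin n → ℤˣ) (p : P) (k : Fin (A.m (j + 1))), ∃ i' : Fin (A.s j),
      |signedVec ε (fun i => A.convLayer hj (w p) (z p i)) k| ≤
        |signedSum ε fun i => max (A.convPre hj (w p) (z p i) (k, i')) 0| := by
    intro ε p k
    obtain ⟨i', hi'⟩ := Finite.exists_max fun i' : Fin (A.s j) =>
      |signedSum ε fun i => max (A.convPre hj (w p) (z p i) (k, i')) 0|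
    refine ⟨i', ?_⟩
    have e : signedVec ε (fun i => A.convLayer hj (w p) (z p i)) k = (1 / (A.s j : ℝ)) *
        ∑ i', signedSum ε fun i => max (A.convPre hj (w p) (z p i) (k, i')) 0 := by
      rw [← signedSum_sum, ← signedSum_const_mul]
      rfl
    rw [e, abs_mul, abs_of_pos (by positivity), one_div, inv_mul_le_iff₀ hs]
    refine (Finset.abs_sum_le_sum_abs _ _).trans ?_
    exact (Finset.sum_le_card_nsmul _ _ _ fun i _ => hi' i).trans (by simp)
  choose i' hi' using hpool
  refine le_trans (Finset.sum_le_sum fun ε _ => Real.exp_le_exp.2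
      (mul_le_mul_of_nonneg_left (hi' ε (h ε).1 (h ε).2) hl))
    (sum_exp_abs_relu_le (P := P × Fin (A.m (j + 1)) × Fin (A.s j)) (U := U)
      (v := fun q i => A.convPre hj (w q.1) (z q.1 i) q.2) hl (fun q => ?_)
      (fun ε => ((h ε).1, (h ε).2, i' ε (h ε).1 (h ε).2)))
  have hlin : ∀ ε : Fin n → ℤˣ, ∃ k : Fin (A.m j),
      |signedSum ε fun i => A.convPre hj (w (q ε).1) (z (q ε).1 i) (q ε).2| ≤
        Real.sqrt (A.s j) * r * |signedVec ε (z (q ε).1) k| := by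
    intro ε
    set idx : Fin (A.s j) → Fin (A.m j) := fun i =>
      ⟨((q ε).2.1 : ℕ) * A.s j + (q ε).2.2 + i, A.conv_index_lt hj (q ε).2.1 (q ε).2.2 i⟩
    obtain ⟨i₀, hi₀⟩ := Finite.exists_max fun i => |signedVec ε (z (q ε).1) (idx i)|
    refine ⟨idx i₀, ?_⟩
    have e : (signedSum ε fun i => A.convPre hj (w (q ε).1) (z (q ε).1 i) (q ε).2) =
        ∑ i, w (q ε).1 i * signedVec ε (fun i' k => z (q ε).1 i' (idx k)) i := by
      rw [← signedSum_sum_mul]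
      rfl
    rw [e]
    refine (abs_sum_mul_le_euc _ _).trans ?_
    have h1 : euc (signedVec ε (fun i' k => z (q ε).1 i' (idx k))) ≤
        Real.sqrt (A.s j) * |signedVec ε (z (q ε).1) (idx i₀)| := by
      have := euc_le_sqrt_card_mul (abs_nonneg _) hi₀
      rw [Fintype.card_fin] at this
      exact this
    calc _ ≤ r * (Real.sqrt (A.s j) * |signedVec ε (z (q ε).1) (idx i₀)|) :=
          mul_le_mul (hw _) h1 (euc_nonneg _) hr
      _ = _ := by ring
  choose k hk using hlin
  refine le_trans (Finset.sum_le_sum fun ε _ => Real.exp_le_exp.2 ?_)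
    (hU fun ε => ((q ε).1, k ε))
  rw [mul_assoc]
  exact mul_le_mul_of_nonneg_left (hk ε) hl

end Arch

/-- Base case without convolutions: `‖∑ ε_i x_i‖` has mean at most `√n` by orthogonality of the
signs, and a flip changes it by at most `2`. -/
theorem sum_exp_euc_signedVec_le {n d : ℕ} {x : Fin n → Fin d → ℝ} (hx : ∀ i, euc (x i) ≤ 1)
    {l : ℝ} (hl : 0 ≤ l) :
    ∑ ε, Real.exp (l * euc (signedVec ε x)) ≤
      2 ^ n * Real.exp (l * Real.sqrt n + l ^ 2 * n / 2) := by
  have hflip : ∀ (ε : Fin n → ℤˣ) i, |l * euc (signedVec ε x) -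
      l * euc (signedVec (flipSign ε i) x)| ≤ l * 2 := by
    intro ε i
    rw [← mul_sub, abs_mul, abs_of_nonneg hl]
    refine mul_le_mul_of_nonneg_left ?_ hl
    have h1 : ∀ a b : Fin d → ℝ, |euc a - euc b| ≤ euc (a - b) := by
      intro a b
      simp only [euc_eq_norm, WithLp.toLp_sub]
      exact abs_norm_sub_norm_le _ _
    refine (h1 _ _).trans ?_
    have h2 : ∑ k, (signedVec ε x - signedVec (flipSign ε i) x) k ^ 2 = (2 * euc (x i)) ^ 2 := by
      rw [mul_pow, euc_sq, Finset.mul_sum]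
      refine Finset.sum_congr rfl fun k _ => ?_
      rw [← sq_abs, Pi.sub_apply, signedVec, signedVec, abs_signedSum_sub_flip, mul_pow, sq_abs]
    rw [euc, h2, Real.sqrt_sq (by have := euc_nonneg (x i); positivity)]
    linarith [hx i]
  refine (sum_exp_le_of_flip _ hflip).trans ?_
  refine mul_le_mul_of_nonneg_left (Real.exp_le_exp.2 (add_le_add ?_ (le_of_eq (by ring))))
    (by positivity)
  have hsq : ∑ ε : Fin n → ℤˣ, euc (signedVec ε x) ^ 2 ≤ 2 ^ n * n := by
    simp only [euc_sq, signedVec]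
    rw [Finset.sum_comm]
    simp only [sum_signedSum_sq]
    rw [← Finset.mul_sum, Finset.sum_comm]
    refine mul_le_mul_of_nonneg_left ?_ (by positivity)
    refine (Finset.sum_le_card_nsmul _ _ 1 fun i _ => ?_).trans (by simp)
    rw [← euc_sq]
    exact pow_le_one₀ (euc_nonneg _) (hx i)
  have hcs := sq_sum_le_card_mul_sum_sq (s := Finset.univ)
    (f := fun ε : Fin n → ℤˣ => euc (signedVec ε x))
  have hcard : ((Finset.univ : Finset (Fin n → ℤˣ)).card : ℝ) = 2 ^ n := by simp
  rw [hcard] at hcs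
  have h3 : ∑ ε : Fin n → ℤˣ, euc (signedVec ε x) ≤ 2 ^ n * Real.sqrt n := by
    refine le_of_sq_le_sq ?_ (by positivity)
    rw [mul_pow, Real.sq_sqrt (by positivity)]
    nlinarith [pow_pos (two_pos : (0 : ℝ) < 2) n]
  rw [← Finset.mul_sum, ← mul_assoc, mul_comm _ l, mul_assoc]
  refine mul_le_mul_of_nonneg_left ?_ hl
  rw [div_mul_eq_mul_div, one_mul, div_le_iff₀ (by positivity)]
  linarith

/-- Base case with convolutions: the selected coordinate is bounded by the sum over all coordinates,
at the cost of a factor `d`. -/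
theorem sum_exp_abs_coord_le {n d : ℕ} {x : Fin n → Fin d → ℝ} (hx : ∀ i, euc (x i) ≤ 1)
    (l : ℝ) (h : (Fin n → ℤˣ) → Fin d) :
    ∑ ε, Real.exp (l * |signedVec ε x (h ε)|) ≤
      2 * d * (2 ^ n * Real.exp (l ^ 2 * n / 2)) := by
  have h1 : ∀ k, ∑ ε : Fin n → ℤˣ, Real.exp (l * |signedVec ε x k|) ≤
      2 * (2 ^ n * Real.exp (l ^ 2 * n / 2)) := by
    intro k
    have h2 : ∀ l' : ℝ, l' ^ 2 = l ^ 2 → ∑ ε : Fin n → ℤˣ, Real.exp (l' * signedVec ε x k) ≤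
        2 ^ n * Real.exp (l ^ 2 * n / 2) := by
      intro l' hl'
      refine (sum_exp_signedSum_le _ _).trans ?_
      rw [hl']
      gcongr
      refine (Finset.sum_le_card_nsmul _ _ 1 fun i _ => ?_).trans (by simp)
      rw [← sq_abs]
      exact pow_le_one₀ (abs_nonneg _) ((abs_le_euc (x i) k).trans (hx i))
    refine (Finset.sum_le_sum fun ε _ => exp_mul_abs_le _).trans ?_
    rw [Finset.sum_add_distrib]
    have h3 := h2 (-l) (by ring)
    simp only [neg_mul, ← mul_neg] at h3
    linarith [h2 l rfl]
  calc ∑ ε, Real.exp (l * |signedVec ε x (h ε)|)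
      ≤ ∑ ε : Fin n → ℤˣ, ∑ k, Real.exp (l * |signedVec ε x k|) :=
        Finset.sum_le_sum fun ε _ => Finset.single_le_sum
          (f := fun k => Real.exp (l * |signedVec ε x k|))
          (fun _ _ => (Real.exp_pos _).le) (Finset.mem_univ _)
    _ ≤ 2 * d * (2 ^ n * Real.exp (l ^ 2 * n / 2)) := by
        rw [Finset.sum_comm]
        refine (Finset.sum_le_card_nsmul _ _ _ fun k _ => h1 k).trans (le_of_eq ?_)
        simp
        ring

namespace Arch

variable {A : Arch} {n : ℕ} {r : ℝ} {x : Fin n → Fin A.d → ℝ}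

theorem sum_exp_convFeature_le (hr : 0 ≤ r) (hx : ∀ i, euc (x i) ≤ 1) (j : ℕ) (hj : j ≤ A.LC)
    {l : ℝ} (hl : 0 ≤ l) (h : (Fin n → ℤˣ) → A.layerBall r × Fin (A.m j)) :
    ∑ ε, Real.exp (l * |signedVec ε (fun i => A.convFeature (h ε).1 (x i) j hj) (h ε).2|) ≤
      2 ^ j * (2 * A.d * (2 ^ n * Real.exp
        (l ^ 2 * ((∏ k ∈ Finset.range j, (A.s k : ℝ)) * (r ^ j) ^ 2) * n / 2))) := by
  induction j generalizing l with
  | zero =>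
    simp only [pow_zero, one_mul, Finset.range_zero, Finset.prod_empty, one_pow, mul_one]
    exact sum_exp_abs_coord_le hx l fun ε => (h ε).2
  | succ j ih =>
    have hs : (0 : ℝ) ≤ A.s j := by positivity
    rw [pow_succ' (2 : ℝ), mul_assoc 2]
    refine A.sum_exp_convLayer_le hj (P := A.layerBall r)
      (w := fun Θ i => Θ.1 (Sum.inl ⟨⟨j, hj⟩, i⟩))
      (z := fun Θ i => A.convFeature Θ.1 (x i) j (Nat.le_of_succ_le hj)) hl hr (fun Θ => ?_)
      (fun h => ?_) h
    · rw [A.euc_conv_weights Θ.1 hj]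
      exact Θ.2 j (by omega)
    · refine (ih (Nat.le_of_succ_le hj) (l := l * (Real.sqrt (A.s j) * r)) (by positivity) h).trans
        (le_of_eq ?_)
      congr 4
      rw [mul_pow, mul_pow, Real.sq_sqrt hs, Finset.prod_range_succ]
      ring

theorem sum_exp_fcFeature_le (hr : 0 ≤ r) {B : ℝ → ℝ}
    (hB : ∀ l, 0 ≤ l → ∀ h : (Fin n → ℤˣ) → A.layerBall r,
      ∑ ε, Real.exp (l * euc (signedVec ε fun i => A.convFeature (h ε) (x i) A.LC le_rfl)) ≤ B l)
    (j : ℕ) (hj : j ≤ A.LF) {l : ℝ} (hl : 0 ≤ l) (h : (Fin n → ℤˣ) → A.layerBall r) :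
    ∑ ε, Real.exp (l * euc (signedVec ε fun i => A.fcFeature (h ε) (x i) j hj)) ≤
      2 ^ j * B (l * r ^ j) := by
  induction j generalizing l h with
  | zero =>
    rw [pow_zero, pow_zero, one_mul, mul_one]
    exact hB l hl h
  | succ j ih =>
    rw [pow_succ' (2 : ℝ), mul_assoc 2]
    refine sum_exp_fcLayer_le (P := A.layerBall r)
      (W := fun Θ q => Θ.1 (Sum.inr (Sum.inl ⟨⟨j, hj⟩, q⟩)))
      (z := fun Θ i => A.fcFeature Θ.1 (x i) j (Nat.le_of_succ_le hj)) hr hl (fun Θ => ?_)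
      (fun h => ?_) h
    · rw [A.euc_fc_weights Θ.1 hj]
      exact Θ.2 _ (by omega)
    · refine (ih (Nat.le_of_succ_le hj) (l := l * r) (by positivity) h).trans (le_of_eq ?_)
      rw [pow_succ', mul_assoc l]

/-- Each layer shrinks the dimension by the factor `s` or more. This collects the losses `√s` of the
convolutional layers and the final `√m` (from maximum to Euclidean norm) into a single `√d`. -/
theorem prod_s_mul_le (A : Arch) (j : ℕ) (hj : j ≤ A.LC) :
    (∏ k ∈ Finset.range j, A.s k) * A.m j ≤ A.d := by
  induction j with
  | zero => simp
  | succ j ih =>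
    refine le_trans ?_ (ih (Nat.le_of_succ_le hj))
    rw [Finset.prod_range_succ, mul_assoc]
    refine Nat.mul_le_mul_left _ ?_
    have h1 := A.fits j hj
    have h2 := A.s_pos j hj
    rw [mul_comm]
    omega

theorem sum_exp_euc_convFeature_le (hr : 0 ≤ r) (hx : ∀ i, euc (x i) ≤ 1)
    {l : ℝ} (hl : 0 ≤ l) (h : (Fin n → ℤˣ) → A.layerBall r) :
    ∑ ε, Real.exp (l * euc (signedVec ε fun i => A.convFeature (h ε) (x i) A.LC le_rfl)) ≤
      2 ^ A.LC * (2 * A.d * (2 ^ n * Real.exp ((l * r ^ A.LC) ^ 2 * A.d * n / 2))) := by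
  have : Nonempty (Fin (A.m A.LC)) := ⟨⟨0, A.m_pos _ (by omega)⟩⟩
  have hmax : ∀ ε : Fin n → ℤˣ, ∃ k : Fin (A.m A.LC),
      euc (signedVec ε fun i => A.convFeature (h ε) (x i) A.LC le_rfl) ≤
        Real.sqrt (A.m A.LC) *
          |signedVec ε (fun i => A.convFeature (h ε) (x i) A.LC le_rfl) k| := by
    intro ε
    obtain ⟨k, hk⟩ := Finite.exists_max fun k =>
      |signedVec ε (fun i => A.convFeature (h ε) (x i) A.LC le_rfl) k|
    exact ⟨k, by simpa using euc_le_sqrt_card_mul (abs_nonneg _) hk⟩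
  choose k hk using hmax
  have h1 := sum_exp_convFeature_le hr hx A.LC le_rfl (l := l * Real.sqrt (A.m A.LC))
    (by positivity) fun ε => (h ε, k ε)
  refine le_trans (Finset.sum_le_sum fun ε _ => Real.exp_le_exp.2 ?_) (h1.trans ?_)
  · rw [mul_assoc]
    exact mul_le_mul_of_nonneg_left (hk ε) hl
  · gcongr ?_ * (_ * (_ * Real.exp (?_ * _ / _)))
    have h2 : ((∏ k ∈ Finset.range A.LC, (A.s k : ℝ)) * A.m A.LC) ≤ A.d := by
      exact_mod_cast A.prod_s_mul_le A.LC le_rfl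
    rw [mul_pow, Real.sq_sqrt (by positivity), mul_pow]
    calc l ^ 2 * (A.m A.LC : ℝ) * ((∏ k ∈ Finset.range A.LC, (A.s k : ℝ)) * (r ^ A.LC) ^ 2)
        = l ^ 2 * (r ^ A.LC) ^ 2 * ((∏ k ∈ Finset.range A.LC, (A.s k : ℝ)) * A.m A.LC) := by ring
      _ ≤ l ^ 2 * (r ^ A.LC) ^ 2 * A.d := by gcongr

/-- Jensen's inequality at one value of `l`, which the caller may optimize. -/
theorem avg_le_of_sum_exp_le {F : (Fin n → ℤˣ) → ℝ} {l b c : ℝ} (hl : 0 < l)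
    (h : ∑ ε, Real.exp (l * F ε) ≤ 2 ^ n * Real.exp c) (hc : c ≤ l * b) :
    ∑ ε, F ε ≤ 2 ^ n * b := by
  have h1 := (exp_avg_le fun ε => l * F ε).trans
    (mul_le_mul_of_nonneg_left h (by positivity : (0 : ℝ) ≤ 1 / 2 ^ n))
  rw [← mul_assoc, one_div_mul_cancel (by positivity), one_mul, Real.exp_le_exp,
    ← Finset.mul_sum] at h1
  have h2 : (1 / 2 ^ n) * (l * ∑ ε, F ε) = l * ((∑ ε, F ε) / 2 ^ n) := by ring
  rw [h2] at h1
  have h3 := le_of_mul_le_mul_left (h1.trans hc) hl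
  rw [div_le_iff₀ (by positivity)] at h3
  linarith

theorem CLd_pos (A : Arch) : 0 < A.CLd := by
  have hd : (1 : ℝ) ≤ A.d := by exact_mod_cast A.m_pos 0 (by omega)
  have := Real.log_nonneg hd
  rw [CLd]
  split_ifs
  · positivity
  · have h1 : (0 : ℝ) < ((A.L : ℝ) + 2 + Real.log A.d) * A.d := by positivity
    have := Real.sqrt_pos.2 h1
    positivity

theorem sum_euc_fcFeature_le (hn : 1 ≤ n) (hr : 0 < r) (hx : ∀ i, euc (x i) ≤ 1)
    (h : (Fin n → ℤˣ) → A.layerBall r) :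
    ∑ ε, euc (signedVec ε fun i => A.fcFeature (h ε) (x i) A.LF le_rfl) ≤
      2 ^ n * (r ^ A.L * (Real.sqrt n * A.CLd)) := by
  have hn' : (0 : ℝ) < n := by exact_mod_cast hn
  have hL : (1 : ℝ) ≤ A.L := by exact_mod_cast A.depth_pos
  have hlog2 : 0 < Real.log 2 := Real.log_pos one_lt_two
  have hpow2 : ∀ k : ℕ, (2 : ℝ) ^ k = Real.exp (k * Real.log 2) := by
    intro k
    rw [Real.exp_nat_mul, Real.exp_log two_pos]
  by_cases hLC : A.LC = 0
  · set a := Real.sqrt (2 * A.L * Real.log 2) with ha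
    have ha2 : a ^ 2 = 2 * A.L * Real.log 2 := Real.sq_sqrt (by positivity)
    have ha0 : 0 < a := Real.sqrt_pos.2 (by positivity)
    have hbase : ∀ l, 0 ≤ l → ∀ h : (Fin n → ℤˣ) → A.layerBall r,
        ∑ ε, Real.exp (l * euc (signedVec ε fun i => A.convFeature (h ε) (x i) A.LC le_rfl)) ≤
          2 ^ n * Real.exp (l * Real.sqrt n + l ^ 2 * n / 2) := by
      intro l hl h
      -- The index is generalized so that it can be replaced by `0` despite the dependent type.
      have key : ∀ (j : ℕ) (hj : j ≤ A.LC), j = 0 →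
          ∑ ε, Real.exp (l * euc (signedVec ε fun i => A.convFeature (h ε) (x i) j hj)) ≤
          2 ^ n * Real.exp (l * Real.sqrt n + l ^ 2 * n / 2) := by
        rintro j hj rfl
        exact sum_exp_euc_signedVec_le hx hl
      exact key A.LC le_rfl hLC
    have hsn : 0 < Real.sqrt n := Real.sqrt_pos.2 hn'
    have hLF : A.LF = A.L := by simp [L, hLC]
    -- This `l` balances the cost `L log 2` of peeling against the variance term `(l r^L)² n / 2`.
    set l := a / (Real.sqrt n * r ^ A.L) with hl
    have hl0 : 0 < l := by positivity
    have h1 := sum_exp_fcFeature_le hr.le hbase A.LF le_rfl hl0.le h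
    refine avg_le_of_sum_exp_le hl0 (h1.trans (le_of_eq ?_)) (c := A.L * Real.log 2 +
      (l * r ^ A.L * Real.sqrt n + (l * r ^ A.L) ^ 2 * n / 2)) ?_
    · rw [hpow2 A.LF, hLF, Real.exp_add (A.L * Real.log 2)]
      ring
    · have e1 : l * r ^ A.L = a / Real.sqrt n := by
        rw [hl]
        field_simp
      have e2 : l * (r ^ A.L * (Real.sqrt n * A.CLd)) = a * A.CLd := by
        rw [← mul_assoc, e1]
        field_simp
      rw [e1, e2, div_pow, Real.sq_sqrt hn'.le, div_mul_cancel₀ _ hsn.ne',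
        div_mul_cancel₀ _ hn'.ne', CLd, if_pos hLC]
      have h3 : a ≤ Real.sqrt (2 * ((A.L : ℝ) + 1) * Real.log 2) :=
        Real.sqrt_le_sqrt (by gcongr; linarith)
      nlinarith
  · have hd : (1 : ℝ) ≤ A.d := by exact_mod_cast A.m_pos 0 (by omega)
    have hlogd := Real.log_nonneg hd
    -- `exp b = 2^(L+1) d` is the total cost: `L` peelings, the absolute value in the base case and
    -- the choice of a coordinate. The `l` below makes the variance term equal to `b` as well.
    set b := ((A.L : ℝ) + 1) * Real.log 2 + Real.log A.d with hb
    have hb0 : 0 < b := by positivity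
    set a := Real.sqrt (2 * b * A.d) with ha
    have ha2 : a ^ 2 = 2 * b * A.d := Real.sq_sqrt (by positivity)
    have ha0 : 0 < a := Real.sqrt_pos.2 (by positivity)
    have hsn : 0 < Real.sqrt n := Real.sqrt_pos.2 hn'
    have hd0 : (0 : ℝ) < A.d := by linarith
    set l := a / (A.d * (Real.sqrt n * r ^ A.L)) with hl
    have hl0 : 0 < l := by positivity
    have h1 := sum_exp_fcFeature_le hr.le (fun l hl h => sum_exp_euc_convFeature_le hr.le hx hl h)
      A.LF le_rfl hl0.le h
    refine avg_le_of_sum_exp_le hl0 (h1.trans (le_of_eq ?_)) (c := b +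
      (l * r ^ A.L) ^ 2 * A.d * n / 2) ?_
    · have e : Real.exp b = 2 ^ A.LC * 2 ^ A.LF * 2 * A.d := by
        rw [hb, Real.exp_add, Real.exp_log hd0, ← pow_add, ← pow_succ, hpow2]
        push_cast
        rfl
      rw [Real.exp_add, e, mul_assoc l, ← pow_add, add_comm A.LF]
      ring
    · have e1 : l * r ^ A.L = a / (A.d * Real.sqrt n) := by
        rw [hl]
        field_simp
      have e2 : l * (r ^ A.L * (Real.sqrt n * A.CLd)) = a / A.d * A.CLd := by
        rw [← mul_assoc, e1]
        field_simp
      have e3 : (a / (A.d * Real.sqrt n)) ^ 2 * A.d * n / 2 = b := by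
        rw [div_pow, mul_pow, Real.sq_sqrt hn'.le, ha2]
        field_simp
      rw [e1, e2, e3, CLd, if_neg hLC]
      have h3 : a ≤ 2 * Real.sqrt (((A.L : ℝ) + 2 + Real.log A.d) * A.d) := by
        have h4 : (2 : ℝ) = Real.sqrt 4 := by
          rw [show (4 : ℝ) = 2 ^ 2 by norm_num, Real.sqrt_sq two_pos.le]
        rw [ha, h4, ← Real.sqrt_mul (by norm_num)]
        refine Real.sqrt_le_sqrt ?_
        have h5 : Real.log 2 ≤ 1 := by linarith [Real.log_two_lt_d9]
        have h6 : b ≤ A.L + 1 + Real.log A.d := by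
          rw [hb]
          nlinarith
        rw [← h4]
        nlinarith
      have h7 : a / A.d * a = b + b := by
        rw [div_mul_eq_mul_div, ← sq, ha2]
        field_simp
        ring
      rw [← h7]
      exact mul_le_mul_of_nonneg_left h3 (by positivity)

/-- The size-independent bound for the Rademacher averages of the networks whose layers all have
Euclidean norm at most `r`. -/
theorem sum_signedSum_net_le (p : ℝ) (hn : 1 ≤ n) (hr : 0 < r) (hx : ∀ i, euc (x i) ≤ 1)
    (h : (Fin n → ℤˣ) → A.layerBall r) :
    ∑ ε, signedSum ε (fun i => A.net p (h ε) (x i)) ≤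
      2 ^ n * ((1 / (A.width : ℝ) ^ p) * r ^ (A.L + 1) * (Real.sqrt n * A.CLd)) := by
  have hw := A.width_rpow_pos p
  have h1 : ∀ ε : Fin n → ℤˣ, signedSum ε (fun i => A.net p (h ε) (x i)) ≤
      (1 / (A.width : ℝ) ^ p) * r *
        euc (signedVec ε fun i => A.fcFeature (h ε) (x i) A.LF le_rfl) := by
    intro ε
    simp only [net]
    rw [signedSum_const_mul, signedSum_sum_mul, mul_assoc]
    refine mul_le_mul_of_nonneg_left ((le_abs_self _).trans ((abs_sum_mul_le_euc _ _).trans ?_))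
      (by positivity)
    rw [A.euc_out_weights]
    exact mul_le_mul_of_nonneg_right ((h ε).2 _ le_rfl) (euc_nonneg _)
  refine (Finset.sum_le_sum fun ε _ => h1 ε).trans ?_
  rw [← Finset.mul_sum]
  refine (mul_le_mul_of_nonneg_left (sum_euc_fcFeature_le hn hr hx h) (by positivity)).trans
    (le_of_eq ?_)
  ring

end Arch

/-! ### Generalized gradients and growth of the layer norms -/

theorem fderiv_apply_eq_sum_grad {ι : Type} [Fintype ι] [DecidableEq ι] (F : (ι → ℝ) → ℝ)
    (θ v : ι → ℝ) : fderiv ℝ F θ v = ∑ i, grad F θ i * v i := by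
  have h : v = ∑ i, v i • (Pi.single i 1 : ι → ℝ) := by
    ext j
    simp [Finset.sum_apply, Pi.single_apply]
  conv_lhs => rw [h]
  rw [map_sum]
  refine Finset.sum_congr rfl fun i _ => ?_
  rw [map_smul, smul_eq_mul, mul_comm]
  rfl

namespace Arch

variable {A : Arch} {n : ℕ} {p r : ℝ} {S : Fin n → (Fin A.d → ℝ) × ℝ}

/-- The part of a parameter vector that belongs to layer `l`. -/
def restrictLayer (A : Arch) (l : ℕ) (v : A.Params) : A.Params :=
  fun i => if A.layerNo i = l then v i else 0

theorem layerNorm_eq_euc (v : A.Params) (l : ℕ) :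
    A.layerNorm v l = euc (A.restrictLayer l v) := by
  rw [layerNorm, layerSq, euc]
  congr 1
  refine Finset.sum_congr rfl fun i _ => ?_
  rw [restrictLayer]
  split_ifs <;> simp

theorem layerNorm_sq (v : A.Params) (l : ℕ) : A.layerNorm v l ^ 2 = A.layerSq v l :=
  Real.sq_sqrt (A.layerSq_nonneg v l)

theorem layerNorm_smul (c : ℝ) (v : A.Params) (l : ℕ) :
    A.layerNorm (c • v) l = |c| * A.layerNorm v l := by
  rw [layerNorm_eq_euc, layerNorm_eq_euc, ← euc_smul]
  congr 1
  ext i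
  simp [restrictLayer]

theorem layerNorm_add_le (v w : A.Params) (l : ℕ) :
    A.layerNorm (v + w) l ≤ A.layerNorm v l + A.layerNorm w l := by
  simp only [layerNorm_eq_euc]
  refine le_trans (le_of_eq ?_) (euc_add_le _ _)
  congr 1
  ext i
  simp only [restrictLayer, Pi.add_apply]
  split_ifs <;> simp

theorem continuous_layerNorm (A : Arch) (l : ℕ) : Continuous fun v : A.Params => A.layerNorm v l := by
  have : ∀ i, Continuous fun v : A.Params => if A.layerNo i = l then v i ^ 2 else 0 := by
    intro i
    split_ifs <;> fun_prop
  exact (continuous_finsetSum _ fun i _ => this i).sqrt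

theorem continuous_net_left (A : Arch) (p : ℝ) (x : Fin A.d → ℝ) :
    Continuous fun Θ : A.Params => A.net p Θ x :=
  (A.continuous_net p).comp (Continuous.prodMk continuous_id continuous_const)

/-- The mean of the residual times the prediction, the derivative of the empirical risk in the
direction of each single layer. -/
noncomputable def radial (A : Arch) (p : ℝ) {n : ℕ} (S : Fin n → (Fin A.d → ℝ) × ℝ)
    (Θ : A.Params) : ℝ :=
  (1 / (n : ℝ)) * ∑ i, (A.net p Θ (S i).1 - (S i).2) * A.net p Θ (S i).1

/-- The mean absolute residual. -/
noncomputable def absRes (A : Arch) (p : ℝ) {n : ℕ} (S : Fin n → (Fin A.d → ℝ) × ℝ)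
    (Θ : A.Params) : ℝ :=
  (1 / (n : ℝ)) * ∑ i, |A.net p Θ (S i).1 - (S i).2|

theorem continuous_radial (A : Arch) (p : ℝ) (S : Fin n → (Fin A.d → ℝ) × ℝ) :
    Continuous (A.radial p S) := by
  have := A.continuous_net_left p
  unfold radial
  fun_prop

theorem continuous_absRes (A : Arch) (p : ℝ) (S : Fin n → (Fin A.d → ℝ) × ℝ) :
    Continuous (A.absRes p S) := by
  have := A.continuous_net_left p
  unfold absRes
  fun_prop

/-- Euler's identity: scaling layer `l` by `1 + τ` scales every prediction by `1 + τ`, and the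
derivative at `τ = 0` does not see `l`. -/
theorem fderiv_restrictLayer {Θ : A.Params} (hd : DifferentiableAt ℝ (A.empRisk p S) Θ) {l : ℕ}
    (hl : l ≤ A.LC + A.LF) :
    fderiv ℝ (A.empRisk p S) Θ (A.restrictLayer l Θ) = A.radial p S Θ := by
  have h1 : HasDerivAt (fun τ : ℝ => A.empRisk p S (Θ + τ • A.restrictLayer l Θ))
      (fderiv ℝ (A.empRisk p S) Θ (A.restrictLayer l Θ)) 0 := by
    have hc : HasDerivAt (fun τ : ℝ => Θ + τ • A.restrictLayer l Θ) (A.restrictLayer l Θ) 0 := by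
      simpa using ((hasDerivAt_id (0 : ℝ)).smul_const (A.restrictLayer l Θ)).const_add Θ
    have hf : HasFDerivAt (A.empRisk p S) (fderiv ℝ (A.empRisk p S) Θ)
        (Θ + (0 : ℝ) • A.restrictLayer l Θ) := by simpa using hd.hasFDerivAt
    exact hf.comp_hasDerivAt 0 hc
  have h2 : HasDerivAt (fun τ : ℝ => (1 / (n : ℝ)) * ∑ i, (1 / 2) *
      ((1 + τ) * A.net p Θ (S i).1 - (S i).2) ^ 2) (A.radial p S Θ) 0 := by
    refine HasDerivAt.const_mul _ (HasDerivAt.fun_sum fun i _ => ?_)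
    have e := ((((hasDerivAt_id (0 : ℝ)).const_add 1).mul_const (A.net p Θ (S i).1)).sub_const
      (S i).2).pow 2
    have e' := e.const_mul (1 / 2 : ℝ)
    simp only [id_eq, add_zero, one_mul] at e'
    refine e'.congr_deriv ?_
    push_cast
    ring
  refine h1.unique (h2.congr_of_eventuallyEq ?_)
  filter_upwards [lt_mem_nhds (show (-1 : ℝ) < 0 by norm_num)] with τ hτ
  have hc0 : ∀ j : ℕ, 0 ≤ if j = l then 1 + τ else 1 := by
    intro j
    split_ifs <;> linarith
  have e : Θ + τ • A.restrictLayer l Θ =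
      A.scaleLayers (fun j => if j = l then 1 + τ else 1) Θ := by
    ext i
    simp only [restrictLayer, scaleLayers, Pi.add_apply, Pi.smul_apply, smul_eq_mul]
    split_ifs <;> ring
  have hprod : (∏ j ∈ Finset.range (A.L + 1), if j = l then 1 + τ else 1) = 1 + τ := by
    rw [Finset.prod_ite_eq' (Finset.range (A.L + 1)) l, if_pos]
    simp only [Finset.mem_range, L]
    omega
  simp only [e, empRisk, loss, net_scaleLayers p hc0, hprod]

/-- The network itself need not be differentiable where the risk is. Difference quotients of the
risk are used instead, with `u² - v² = (u - v)(u + v)` and the Lipschitz bound of the network; the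
strict bound on the norms keeps nearby parameters in the ball. -/
theorem abs_fderiv_le (hx : ∀ i, euc (S i).1 ≤ 1) {Θ : A.Params} (hr : 0 < r)
    (hΘ : ∀ l ≤ A.LC + A.LF, A.layerNorm Θ l < r)
    (hd : DifferentiableAt ℝ (A.empRisk p S) Θ) {l : ℕ} (hl : l ≤ A.LC + A.LF) (v : A.Params) :
    |fderiv ℝ (A.empRisk p S) Θ (A.restrictLayer l v)| ≤
      (1 / (A.width : ℝ) ^ p) * r ^ A.L * A.layerNorm v l * A.absRes p S Θ := by
  set w := A.restrictLayer l v with hw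
  set c := (1 / (A.width : ℝ) ^ p) * r ^ A.L * A.layerNorm v l with hc
  have hc0 : 0 ≤ c := by
    have := A.width_rpow_pos p
    have := A.layerNorm_nonneg v l
    positivity
  have hcurve : Continuous fun τ : ℝ => Θ + τ • w := by fun_prop
  have h1 : HasDerivAt (fun τ : ℝ => A.empRisk p S (Θ + τ • w))
      (fderiv ℝ (A.empRisk p S) Θ w) 0 := by
    have hc : HasDerivAt (fun τ : ℝ => Θ + τ • w) w 0 := by
      simpa using ((hasDerivAt_id (0 : ℝ)).smul_const w).const_add Θ
    have hf : HasFDerivAt (A.empRisk p S) (fderiv ℝ (A.empRisk p S) Θ) (Θ + (0 : ℝ) • w) := by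
      simpa using hd.hasFDerivAt
    exact hf.comp_hasDerivAt 0 hc
  have hball : ∀ᶠ τ in 𝓝[≠] (0 : ℝ), Θ + τ • w ∈ A.layerBall r := by
    refine Filter.Eventually.filter_mono nhdsWithin_le_nhds ?_
    have : ∀ k ∈ Set.Iic (A.LC + A.LF), ∀ᶠ τ in 𝓝 (0 : ℝ), A.layerNorm (Θ + τ • w) k < r := by
      intro k hk
      have hcont := ((A.continuous_layerNorm k).comp hcurve).tendsto 0
      exact hcont.eventually_lt_const (by simpa using hΘ k hk)
    filter_upwards [(eventually_all_finite (Set.finite_Iic _)).2 this] with τ hτ k hk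
    exact (hτ k hk).le
  have hnormw : ∀ τ : ℝ, ∑ k ∈ Finset.range (A.L + 1), A.layerNorm (Θ + τ • w - Θ) k =
      |τ| * A.layerNorm v l := by
    intro τ
    rw [add_sub_cancel_left]
    simp only [layerNorm_smul]
    rw [← Finset.mul_sum]
    congr 1
    have : ∀ k, A.layerNorm w k = if k = l then A.layerNorm v l else 0 := by
      intro k
      split_ifs with h
      · rw [h, layerNorm_eq_euc, layerNorm_eq_euc, hw]
        congr 1
        ext i
        simp only [restrictLayer]
        split_ifs <;> rfl
      · rw [layerNorm_eq_euc, ← euc_zero (ι := A.Idx), hw]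
        congr 1
        ext i
        simp only [restrictLayer, Pi.zero_apply]
        split_ifs with h1 h2
        · exact absurd (h1.symm.trans h2) h
        · rfl
        · rfl
    simp only [this]
    rw [Finset.sum_ite_eq', if_pos]
    simp only [Finset.mem_range, L]
    omega
  have hlim := (hasDerivAt_iff_tendsto_slope_zero.1 h1).abs
  have hbound : Tendsto (fun τ : ℝ => c * ((1 / (n : ℝ)) * ∑ i, (1 / 2) *
      |A.net p (Θ + τ • w) (S i).1 + A.net p Θ (S i).1 - 2 * (S i).2|)) (𝓝[≠] 0)
      (𝓝 (c * A.absRes p S Θ)) := by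
    have hnet : ∀ i, Continuous fun τ : ℝ => A.net p (Θ + τ • w) (S i).1 := fun i =>
      (A.continuous_net_left p _).comp hcurve
    have hcont : Continuous fun τ : ℝ => c * ((1 / (n : ℝ)) * ∑ i, (1 / 2) *
      |A.net p (Θ + τ • w) (S i).1 + A.net p Θ (S i).1 - 2 * (S i).2|) := by fun_prop
    have := (hcont.tendsto 0).mono_left (nhdsWithin_le_nhds (s := {0}ᶜ))
    convert this using 2
    rw [absRes]
    congr 2
    refine Finset.sum_congr rfl fun i _ => ?_
    rw [zero_smul, add_zero, show A.net p Θ (S i).1 + A.net p Θ (S i).1 - 2 * (S i).2 =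
      2 * (A.net p Θ (S i).1 - (S i).2) by ring, abs_mul, abs_two]
    ring
  refine le_of_tendsto_of_tendsto hlim hbound ?_
  filter_upwards [hball, self_mem_nhdsWithin] with τ hτ hτ0
  have hτ0' : 0 < |τ| := abs_pos.2 hτ0
  have hnetdiff : ∀ i, |A.net p (Θ + τ • w) (S i).1 - A.net p Θ (S i).1| ≤ |τ| * c := by
    intro i
    have h3 := mul_abs_net_sub_le p hr.le hτ (fun k hk => (hΘ k hk).le) (hx i)
    rw [hnormw] at h3
    refine le_of_mul_le_mul_left (h3.trans (le_of_eq ?_)) hr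
    rw [hc]
    ring
  simp only [zero_add, zero_smul, add_zero, smul_eq_mul]
  rw [abs_mul, abs_inv, inv_mul_le_iff₀ hτ0']
  have hdiff : A.empRisk p S (Θ + τ • w) - A.empRisk p S Θ = (1 / (n : ℝ)) * ∑ i, (1 / 2) *
      ((A.net p (Θ + τ • w) (S i).1 - A.net p Θ (S i).1) *
        (A.net p (Θ + τ • w) (S i).1 + A.net p Θ (S i).1 - 2 * (S i).2)) := by
    rw [empRisk, empRisk, ← mul_sub, ← Finset.sum_sub_distrib]
    congr 1
    refine Finset.sum_congr rfl fun i _ => ?_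
    rw [loss, loss]
    ring
  rw [hdiff, abs_mul, abs_of_nonneg (by positivity : (0 : ℝ) ≤ 1 / (n : ℝ)), ← mul_assoc,
    mul_left_comm (|τ| * c)]
  refine mul_le_mul_of_nonneg_left ((Finset.abs_sum_le_sum_abs _ _).trans ?_) (by positivity)
  rw [Finset.mul_sum]
  refine Finset.sum_le_sum fun i _ => ?_
  rw [abs_mul, abs_mul, abs_of_pos (by norm_num : (0 : ℝ) < 1 / 2), mul_left_comm (|τ| * c)]
  exact mul_le_mul_of_nonneg_left
    (mul_le_mul_of_nonneg_right (hnetdiff i) (abs_nonneg _)) (by norm_num)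

/-- What is known about a generalized gradient `g` of the empirical risk at `Θ`: its component
along the layer `l` of `Θ`, and its size in layer `l`. -/
def LayerGradBound (A : Arch) (p r : ℝ) {n : ℕ} (S : Fin n → (Fin A.d → ℝ) × ℝ) (Θ : A.Params)
    (l : ℕ) (g : A.Params) : Prop :=
  ∑ i, A.restrictLayer l Θ i * g i = A.radial p S Θ ∧
    A.layerNorm g l ≤ (1 / (A.width : ℝ) ^ p) * r ^ A.L * A.absRes p S Θ

theorem layerGradBound_grad (hx : ∀ i, euc (S i).1 ≤ 1) {Θ : A.Params} (hr : 0 < r)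
    (hΘ : ∀ l ≤ A.LC + A.LF, A.layerNorm Θ l < r)
    (hd : DifferentiableAt ℝ (A.empRisk p S) Θ) {l : ℕ} (hl : l ≤ A.LC + A.LF) :
    A.LayerGradBound p r S Θ l (grad (A.empRisk p S) Θ) := by
  constructor
  · rw [← fderiv_restrictLayer hd hl, fderiv_apply_eq_sum_grad]
    exact Finset.sum_congr rfl fun i _ => mul_comm _ _
  · set g := grad (A.empRisk p S) Θ with hg
    -- Testing the derivative against the gradient itself gives `‖g_l‖² ≤ C ‖g_l‖`.
    have h1 := (le_abs_self _).trans (abs_fderiv_le hx hr hΘ hd hl g)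
    have h2 : fderiv ℝ (A.empRisk p S) Θ (A.restrictLayer l g) = A.layerNorm g l ^ 2 := by
      rw [fderiv_apply_eq_sum_grad, layerNorm_sq, layerSq]
      refine Finset.sum_congr rfl fun i _ => ?_
      rw [restrictLayer]
      split_ifs <;> simp [← hg, sq]
    rw [h2] at h1
    have hw := A.width_rpow_pos p
    have hD : 0 ≤ A.absRes p S Θ := by
      unfold absRes
      positivity
    rcases (A.layerNorm_nonneg g l).eq_or_lt with h0 | h0
    · rw [← h0]
      positivity
    · refine le_of_mul_le_mul_left ?_ h0
      rw [← sq]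
      exact h1.trans (le_of_eq (by ring))

/-- For fixed `Θ` the conditions on `g` are affine and convex, so they pass to convex hulls; they
pass to limits of gradients because `radial`, `absRes` and the layer norms are continuous. -/
theorem layerGradBound_of_mem_clarkeGrad (hx : ∀ i, euc (S i).1 ≤ 1) {Θ : A.Params} (hr : 0 < r)
    (hΘ : ∀ l ≤ A.LC + A.LF, A.layerNorm Θ l < r) {l : ℕ} (hl : l ≤ A.LC + A.LF) {g : A.Params}
    (hg : g ∈ clarkeGrad (A.empRisk p S) Θ) : A.LayerGradBound p r S Θ l g := by
  have hconv : Convex ℝ {g | A.LayerGradBound p r S Θ l g} := by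
    rintro g ⟨hg1, hg2⟩ g' ⟨hg1', hg2'⟩ a b ha hb hab
    constructor
    · calc ∑ i, A.restrictLayer l Θ i * (a • g + b • g') i
          = a * ∑ i, A.restrictLayer l Θ i * g i + b * ∑ i, A.restrictLayer l Θ i * g' i := by
            rw [Finset.mul_sum, Finset.mul_sum, ← Finset.sum_add_distrib]
            refine Finset.sum_congr rfl fun i _ => ?_
            simp only [Pi.add_apply, Pi.smul_apply, smul_eq_mul]
            ring
        _ = A.radial p S Θ := by rw [hg1, hg1', ← add_mul, hab, one_mul]
    · refine (layerNorm_add_le _ _ l).trans ?_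
      rw [layerNorm_smul, layerNorm_smul, abs_of_nonneg ha, abs_of_nonneg hb]
      calc _ ≤ a * ((1 / (A.width : ℝ) ^ p) * r ^ A.L * A.absRes p S Θ) +
            b * ((1 / (A.width : ℝ) ^ p) * r ^ A.L * A.absRes p S Θ) :=
            add_le_add (mul_le_mul_of_nonneg_left hg2 ha) (mul_le_mul_of_nonneg_left hg2' hb)
        _ = _ := by rw [← add_mul, hab, one_mul]
  refine convexHull_min ?_ hconv hg
  rintro v ⟨u, hu, hdiff, hv⟩
  have hev : ∀ᶠ k in atTop, A.LayerGradBound p r S (u k) l (grad (A.empRisk p S) (u k)) := by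
    have : ∀ j ∈ Set.Iic (A.LC + A.LF), ∀ᶠ k in atTop, A.layerNorm (u k) j < r := fun j hj =>
      (((A.continuous_layerNorm j).tendsto Θ).comp hu).eventually_lt_const (hΘ j hj)
    filter_upwards [(eventually_all_finite (Set.finite_Iic _)).2 this] with k hk
    exact layerGradBound_grad hx hr hk (hdiff k) hl
  constructor
  · have hc : Continuous fun q : A.Params × A.Params => ∑ i, A.restrictLayer l q.1 i * q.2 i := by
      have : ∀ i, Continuous fun q : A.Params × A.Params => A.restrictLayer l q.1 i := by
        intro i
        unfold restrictLayer
        split_ifs <;> fun_prop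
      fun_prop
    have h1 := (hc.tendsto (Θ, v)).comp (hu.prodMk_nhds hv)
    have h2 := ((A.continuous_radial p S).tendsto Θ).comp hu
    refine tendsto_nhds_unique (h1.congr' ?_) h2
    filter_upwards [hev] with k hk using hk.1
  · have h1 := ((A.continuous_layerNorm l).tendsto v).comp hv
    have h2 := (((A.continuous_absRes p S).tendsto Θ).comp hu).const_mul
      ((1 / (A.width : ℝ) ^ p) * r ^ A.L)
    refine le_of_tendsto_of_tendsto h1 h2 ?_
    filter_upwards [hev] with k hk using hk.2

theorem empRisk_nonneg (A : Arch) (p : ℝ) (S : Fin n → (Fin A.d → ℝ) × ℝ) (Θ : A.Params) :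
    0 ≤ A.empRisk p S Θ := by
  unfold empRisk loss
  positivity

theorem two_mul_empRisk (A : Arch) (p : ℝ) (S : Fin n → (Fin A.d → ℝ) × ℝ) (Θ : A.Params) :
    2 * A.empRisk p S Θ = (1 / (n : ℝ)) * ∑ i, (A.net p Θ (S i).1 - (S i).2) ^ 2 := by
  simp only [empRisk, loss]
  rw [← Finset.mul_sum]
  ring

theorem absRes_le_sqrt (hn : 1 ≤ n) (Θ : A.Params) :
    A.absRes p S Θ ≤ Real.sqrt (2 * A.empRisk p S Θ) := by
  have hn' : (0 : ℝ) < n := by exact_mod_cast hn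
  refine Real.le_sqrt_of_sq_le ?_
  rw [two_mul_empRisk, absRes, mul_pow]
  have h := sq_sum_le_card_mul_sum_sq (s := Finset.univ)
    (f := fun i => |A.net p Θ (S i).1 - (S i).2|)
  simp only [sq_abs, Finset.card_univ, Fintype.card_fin] at h
  calc (1 / (n : ℝ)) ^ 2 * (∑ i, |A.net p Θ (S i).1 - (S i).2|) ^ 2
      ≤ (1 / (n : ℝ)) ^ 2 * (n * ∑ i, (A.net p Θ (S i).1 - (S i).2) ^ 2) := by gcongr
    _ = _ := by field_simp

/-- From `-(f - y) f = -(f - y)² - (f - y) y` and Cauchy–Schwarz for the mean absolute residual. -/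
theorem neg_radial_le (hn : 1 ≤ n) {Cy : ℝ} (hy : ∀ i, |(S i).2| ≤ Cy) (Θ : A.Params) :
    -A.radial p S Θ ≤ Real.sqrt (2 * A.empRisk p S Θ) * (Cy - Real.sqrt (2 * A.empRisk p S Θ)) := by
  have hCy : 0 ≤ Cy := (abs_nonneg _).trans (hy ⟨0, hn⟩)
  rw [mul_sub, Real.mul_self_sqrt (by have := A.empRisk_nonneg p S Θ; positivity)]
  have h1 : -A.radial p S Θ ≤ Cy * A.absRes p S Θ - 2 * A.empRisk p S Θ := by
    rw [two_mul_empRisk, radial, absRes, mul_left_comm, ← mul_sub, ← mul_neg]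
    refine mul_le_mul_of_nonneg_left ?_ (by positivity)
    rw [Finset.mul_sum, ← Finset.sum_sub_distrib, ← Finset.sum_neg_distrib]
    refine Finset.sum_le_sum fun i _ => ?_
    set f := A.net p Θ (S i).1
    have h2 : -((f - (S i).2) * (S i).2) ≤ Cy * |f - (S i).2| := by
      refine (neg_le_abs _).trans ?_
      rw [abs_mul, mul_comm]
      exact mul_le_mul_of_nonneg_right (hy i) (abs_nonneg _)
    nlinarith
  have h3 := mul_le_mul_of_nonneg_left (absRes_le_sqrt (p := p) (S := S) hn Θ) hCy
  linarith

theorem sqrt_two_mul_empRisk_le (hn : 1 ≤ n) {Cf Cy : ℝ} (hy : ∀ i, |(S i).2| ≤ Cy)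
    {Θ : A.Params} (hf : ∀ i, |A.net p Θ (S i).1| ≤ Cf) :
    Real.sqrt (2 * A.empRisk p S Θ) ≤ Cf + Cy := by
  have hn' : (0 : ℝ) < n := by exact_mod_cast hn
  have h0 : 0 ≤ Cf + Cy :=
    add_nonneg ((abs_nonneg _).trans (hf ⟨0, hn⟩)) ((abs_nonneg _).trans (hy ⟨0, hn⟩))
  rw [two_mul_empRisk]
  refine (Real.sqrt_le_left h0).2 ?_
  rw [one_div, inv_mul_le_iff₀ hn']
  refine (Finset.sum_le_card_nsmul _ _ ((Cf + Cy) ^ 2) fun i _ => ?_).trans (by simp)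
  rw [← sq_abs]
  refine pow_le_pow_left₀ (abs_nonneg _) ?_ 2
  exact (abs_sub _ _).trans (add_le_add (hf i) (hy i))

theorem layerSq_step_le (hn : 1 ≤ n) (hx : ∀ i, euc (S i).1 ≤ 1) {Cf Cy R η : ℝ}
    (hy : ∀ i, |(S i).2| ≤ Cy) {Θ : A.Params} (hf : ∀ i, |A.net p Θ (S i).1| ≤ Cf) (hη : 0 ≤ η)
    (hΘ : ∀ l ≤ A.LC + A.LF, A.layerSq Θ l < R) {l : ℕ} (hl : l ≤ A.LC + A.LF) {g : A.Params}
    (hg : g ∈ clarkeGrad (A.empRisk p S) Θ) :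
    A.layerSq (Θ - η • g) l ≤ A.layerSq Θ l +
      2 * η * Real.sqrt (2 * A.empRisk p S Θ) * (Cy - Real.sqrt (2 * A.empRisk p S Θ)) +
      η ^ 2 * (((1 / (A.width : ℝ) ^ p) * (Cf + Cy)) ^ 2 * R ^ A.L) := by
  have hR : 0 < R := (A.layerSq_nonneg Θ 0).trans_lt (hΘ 0 (by omega))
  have hw := A.width_rpow_pos p
  obtain ⟨h1, h2⟩ := layerGradBound_of_mem_clarkeGrad hx (r := Real.sqrt R) (Real.sqrt_pos.2 hR)
    (fun k hk => Real.sqrt_lt_sqrt (A.layerSq_nonneg Θ k) (hΘ k hk)) hl hg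
  have hexp : A.layerSq (Θ - η • g) l = A.layerSq Θ l - 2 * η * A.radial p S Θ +
      η ^ 2 * A.layerNorm g l ^ 2 := by
    rw [← h1, layerNorm_sq]
    simp only [layerSq]
    rw [Finset.mul_sum, Finset.mul_sum, ← Finset.sum_sub_distrib, ← Finset.sum_add_distrib]
    refine Finset.sum_congr rfl fun i _ => ?_
    simp only [restrictLayer, Pi.sub_apply, Pi.smul_apply, smul_eq_mul]
    split_ifs <;> ring
  have h3 : A.layerNorm g l ^ 2 ≤ ((1 / (A.width : ℝ) ^ p) * (Cf + Cy)) ^ 2 * R ^ A.L := by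
    have h4 : A.layerNorm g l ≤ (1 / (A.width : ℝ) ^ p) * Real.sqrt R ^ A.L * (Cf + Cy) :=
      h2.trans (mul_le_mul_of_nonneg_left
        ((absRes_le_sqrt hn Θ).trans (sqrt_two_mul_empRisk_le hn hy hf)) (by positivity))
    refine (pow_le_pow_left₀ (A.layerNorm_nonneg g l) h4 2).trans (le_of_eq ?_)
    rw [mul_right_comm, mul_pow, ← pow_mul, mul_comm A.L 2, pow_mul, Real.sq_sqrt hR.le]
  have h5 := mul_le_mul_of_nonneg_left (neg_radial_le (p := p) hn hy Θ)
    (by positivity : 0 ≤ 2 * η)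
  have h6 := mul_le_mul_of_nonneg_left h3 (sq_nonneg η)
  rw [hexp]
  linarith

/-- Bounds every increment of the cumulative loss independently of the actual losses; the radii `R`
can then be deterministic. -/
theorem two_mul_mul_sub_le (c s : ℝ) : 2 * s * (c - s) ≤ c ^ 2 / 2 := by
  nlinarith [sq_nonneg (c - 2 * s)]

/-- Along gradient descent the squared norm of each layer grows at most by the cumulative loss,
up to an error of second order in the step sizes. -/
theorem layerSq_le_of_isGD (hn : 1 ≤ n) (hx : ∀ i, euc (S i).1 ≤ 1) {Cf Cy K a : ℝ}
    (hy : ∀ i, |(S i).2| ≤ Cy) {T : ℕ} {step R : ℕ → ℝ} {Θ : ℕ → A.Params}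
    (hstep : ∀ t, 0 ≤ step t) (hGD : IsGD A p S step T Θ)
    (hf : ∀ t ≤ T, ∀ i, |A.net p (Θ t) (S i).1| ≤ Cf)
    (h0 : ∀ l ≤ A.LC + A.LF, A.layerSq (Θ 0) l ≤ K)
    (hR : ∀ t, K + a + Cy ^ 2 / 2 * ∑ s ∈ Finset.range t, step s < R t)
    (ha : ∀ t, ∑ s ∈ Finset.range t,
      step s ^ 2 * (((1 / (A.width : ℝ) ^ p) * (Cf + Cy)) ^ 2 * R s ^ A.L) ≤ a)
    {l : ℕ} (hl : l ≤ A.LC + A.LF) {t : ℕ} (ht : t ≤ T) :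
    A.layerSq (Θ t) l ≤ K + a + cumLoss A p S Cy step Θ t := by
  have key : ∀ t ≤ T, ∀ l ≤ A.LC + A.LF, A.layerSq (Θ t) l ≤ K + cumLoss A p S Cy step Θ t +
      ∑ s ∈ Finset.range t,
        step s ^ 2 * (((1 / (A.width : ℝ) ^ p) * (Cf + Cy)) ^ 2 * R s ^ A.L) := by
    intro t
    induction t with
    | zero => intro _ l hl; simpa [cumLoss] using h0 l hl
    | succ t ih =>
      intro ht l hl
      have iht := ih (Nat.le_of_succ_le ht)
      obtain ⟨g, hg, hΘ⟩ := hGD t ht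
      -- Bootstrap: the bound at time `t` keeps all layers inside the radius `R t`, and this
      -- controls the gradient of the next step.
      have hlt : ∀ l ≤ A.LC + A.LF, A.layerSq (Θ t) l < R t := by
        intro l hl
        refine lt_of_le_of_lt ?_ (hR t)
        have hcl : cumLoss A p S Cy step Θ t ≤ Cy ^ 2 / 2 * ∑ s ∈ Finset.range t, step s := by
          rw [cumLoss, Finset.mul_sum]
          refine Finset.sum_le_sum fun s _ => ?_
          have := mul_le_mul_of_nonneg_left
            (two_mul_mul_sub_le Cy (Real.sqrt (2 * A.empRisk p S (Θ s)))) (hstep s)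
          linarith
        linarith [iht l hl, ha t]
      have h1 := layerSq_step_le hn hx hy (hf t (Nat.le_of_succ_le ht)) (hstep t) hlt hl hg
      rw [hΘ, Finset.sum_range_succ, cumLoss, Finset.sum_range_succ]
      have h2 := iht l hl
      rw [cumLoss] at h2
      linarith
  linarith [key t ht l hl, ha t]

end Arch

/-! ### Summability of the step sizes -/

/-- The step size is constant on blocks of length `T₀`; the first `t` times lie in `t / T₀ + 1`
blocks, the last possibly incomplete. -/
theorem sum_range_comp_div_le {T₀ : ℕ} (hT : 1 ≤ T₀) {φ : ℕ → ℝ} (hφ : ∀ j, 0 ≤ φ j) (t : ℕ) :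
    ∑ s ∈ Finset.range t, φ (s / T₀) ≤ T₀ * ∑ j ∈ Finset.range (t / T₀ + 1), φ j := by
  have h1 : ∀ N : ℕ, ∑ s ∈ Finset.range (N * T₀), φ (s / T₀) =
      T₀ * ∑ j ∈ Finset.range N, φ j := by
    intro N
    induction N with
    | zero => simp
    | succ N ih =>
      rw [Nat.succ_mul, Finset.sum_range_add, ih, Finset.sum_range_succ, mul_add]
      congr 1
      have : ∀ x ∈ Finset.range T₀, φ ((N * T₀ + x) / T₀) = φ N := by
        intro x hx
        rw [mul_comm, Nat.mul_add_div hT, Nat.div_eq_of_lt (Finset.mem_range.1 hx), add_zero]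
      rw [Finset.sum_congr rfl this]
      simp
  rw [← h1]
  refine Finset.sum_le_sum_of_subset_of_nonneg (Finset.range_mono ?_) fun _ _ _ => hφ _
  have := Nat.div_add_mod t T₀
  have h2 := Nat.mod_lt t hT
  rw [Nat.succ_mul, mul_comm]
  omega

theorem sum_rpow_neg_le {a : ℝ} (ha0 : 0 ≤ a) (ha : a < 1) (N : ℕ) :
    ∑ j ∈ Finset.range N, ((j : ℝ) + 1) ^ (-a) ≤ (N : ℝ) ^ (1 - a) / (1 - a) := by
  have h1a : 0 < 1 - a := by linarith
  induction N with
  | zero => simp [Real.zero_rpow h1a.ne']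
  | succ N ih =>
    rw [Finset.sum_range_succ]
    push_cast
    have hN : (0 : ℝ) < (N : ℝ) + 1 := by positivity
    -- Bernoulli's inequality for the exponent `1 - a` makes the bound telescope.
    have hb : (N : ℝ) ^ (1 - a) ≤ ((N : ℝ) + 1) ^ (1 - a) - (1 - a) * ((N : ℝ) + 1) ^ (-a) := by
      have h2 : (N : ℝ) = ((N : ℝ) + 1) * (1 + -(1 / ((N : ℝ) + 1))) := by
        field_simp
        ring
      have h3 : (1 : ℝ) / ((N : ℝ) + 1) ≤ 1 := by
        rw [div_le_one hN]
        linarith [(Nat.cast_nonneg N : (0 : ℝ) ≤ N)]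
      have h4 := _root_.rpow_one_add_le_one_add_mul_self (s := -(1 / ((N : ℝ) + 1))) (by linarith)
        h1a.le (by linarith)
      conv_lhs => rw [h2]
      rw [Real.mul_rpow hN.le (by linarith)]
      refine (mul_le_mul_of_nonneg_left h4 (by positivity)).trans (le_of_eq ?_)
      have h5 : ((N : ℝ) + 1) ^ (1 - a) * (1 / ((N : ℝ) + 1)) = ((N : ℝ) + 1) ^ (-a) := by
        rw [one_div, ← Real.rpow_neg_one, ← Real.rpow_add hN]
        congr 1
        ring
      rw [← h5]
      ring
    rw [le_div_iff₀ h1a] at ih ⊢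
    linarith

theorem sum_rpow_neg_one_sub_le {b : ℝ} (hb : 0 < b) (N : ℕ) :
    ∑ j ∈ Finset.range N, ((j : ℝ) + 1) ^ (-(1 + b)) ≤ 1 + 1 / b := by
  have key : ∀ N : ℕ, ∑ j ∈ Finset.range (N + 1), ((j : ℝ) + 1) ^ (-(1 + b)) ≤
      1 + 1 / b - ((N : ℝ) + 1) ^ (-b) / b := by
    intro N
    induction N with
    | zero => simp
    | succ N ih =>
      rw [Finset.sum_range_succ]
      push_cast
      set x : ℝ := (N : ℝ) + 1 + 1 with hx
      have hx1 : 1 < x := by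
        have : (0 : ℝ) ≤ N := Nat.cast_nonneg N
        linarith
      have hx0 : 0 < x := by linarith
      have hstep : x ^ (-(1 + b)) * b + x ^ (-b) ≤ ((N : ℝ) + 1) ^ (-b) := by
        have h1 : ((N : ℝ) + 1) = x * (1 - 1 / x) := by
          field_simp
          rw [hx]
          ring
        have h2 : 0 < 1 - 1 / x := by
          rw [sub_pos, div_lt_one hx0]
          exact hx1
        have h3 : 1 + b * (1 / x) ≤ (1 - 1 / x) ^ (-b) := by
          have h4 : (1 - 1 / x) ≤ Real.exp (-(1 / x)) := by
            linarith [Real.add_one_le_exp (-(1 / x))]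
          calc 1 + b * (1 / x) ≤ Real.exp (b * (1 / x)) := by
                linarith [Real.add_one_le_exp (b * (1 / x))]
            _ = Real.exp (-(1 / x)) ^ (-b) := by
                rw [← Real.exp_mul]
                congr 1
                ring
            _ ≤ (1 - 1 / x) ^ (-b) := Real.rpow_le_rpow_of_nonpos h2 h4 (by linarith)
        have h5 : x ^ (-(1 + b)) = x ^ (-b) * (1 / x) := by
          rw [one_div, ← Real.rpow_neg_one, ← Real.rpow_add hx0]
          congr 1
          ring
        rw [h1, Real.mul_rpow hx0.le h2.le, h5]
        have := mul_le_mul_of_nonneg_left h3 (Real.rpow_nonneg hx0.le (-b))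
        linarith
      have h6 : x ^ (-(1 + b)) + x ^ (-b) / b ≤ ((N : ℝ) + 1) ^ (-b) / b := by
        rw [le_div_iff₀ hb, add_mul, div_mul_cancel₀ _ hb.ne']
        exact hstep
      linarith
  rcases N with _ | N
  · simp
    positivity
  · refine (key N).trans ?_
    have : 0 ≤ ((N : ℝ) + 1) ^ (-b) / b := by positivity
    linarith

theorem stepSize_eq {η α : ℝ} {T₀ : ℕ} (hT : 1 ≤ T₀) (t : ℕ) :
    stepSize η α T₀ t = η * (((t / T₀ : ℕ) : ℝ) + 1) ^ (-α) := by
  have hT' : (0 : ℝ) < T₀ := by exact_mod_cast hT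
  have h : ⌈((t : ℝ) + 1) / (T₀ : ℝ)⌉₊ = t / T₀ + 1 := by
    rw [Nat.ceil_eq_iff (Nat.succ_ne_zero _)]
    have h1 := Nat.div_add_mod t T₀
    have h2 := Nat.mod_lt t hT
    constructor
    · rw [lt_div_iff₀ hT', Nat.succ_sub_one]
      have : (t / T₀) * T₀ < t + 1 := by
        rw [mul_comm]
        omega
      exact_mod_cast this
    · rw [div_le_iff₀ hT']
      have : t + 1 ≤ (t / T₀ + 1) * T₀ := by
        rw [Nat.succ_mul, mul_comm]
        omega
      exact_mod_cast this
  rw [stepSize, h, Real.rpow_neg (by positivity), div_eq_mul_inv]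
  push_cast
  rfl

/-- The step sizes are summable against the growth that they permit: with radii
`R t = D * κ ^ 2 * ⌈(t + 1) / T₀⌉ ^ (1 - α')`, for a suitable `α' < 1`, the first order growth stays
below `R t` and the second order terms sum up to at most `κ ^ 2`. -/
theorem exists_radii {L : ℕ} (hL : 1 ≤ L) {K₀ κ α ε η Cy M : ℝ} {T₀ : ℕ} (hK₀ : 0 < K₀)
    (hκ : 0 < κ) (hCy : 0 < Cy) (hM : 0 < M) (hε : 0 < ε) (hε1 : ε < 1) (hT : 1 ≤ T₀)
    (hα : ((L : ℝ) + 1) / ((L : ℝ) + 2) < α) (hη : 0 < η)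
    (hη1 : η ≤ 1 / (3 * ((L : ℝ) ^ (((L : ℝ) - 1) / 2)) ^ 2 * (K₀ + L + 4) ^ L) *
      ((L : ℝ) ^ (((L : ℝ) - 1) / 2) *
        Real.sqrt (min ε (((L : ℝ) + 2) * α - ((L : ℝ) + 1))) /
          (M * (T₀ : ℝ) ^ ((1 + ε) / 2) * κ ^ (L - 1))))
    (hη2 : η ≤ 1 / (3 * ((L : ℝ) ^ (((L : ℝ) - 1) / 2)) ^ 2 * (K₀ + L + 4) ^ L) *
      (κ ^ 2 * (1 - ε) / (Cy ^ 2 * (T₀ : ℝ)))) :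
    ∃ R : ℕ → ℝ,
      (∀ t, K₀ * κ ^ 2 + κ ^ 2 + Cy ^ 2 / 2 * ∑ s ∈ Finset.range t, stepSize η α T₀ s < R t) ∧
      ∀ t, ∑ s ∈ Finset.range t, stepSize η α T₀ s ^ 2 * (M ^ 2 * R s ^ L) ≤ κ ^ 2 := by
  have hL' : (1 : ℝ) ≤ L := by exact_mod_cast hL
  have hL2 : (0 : ℝ) < (L : ℝ) + 2 := by linarith
  have hT' : (1 : ℝ) ≤ T₀ := by exact_mod_cast hT
  have hT0 : (0 : ℝ) < T₀ := by linarith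
  set Λ := (L : ℝ) ^ (((L : ℝ) - 1) / 2) with hΛ
  have hΛ1 : 1 ≤ Λ := Real.one_le_rpow hL' (by linarith)
  have hΛ0 : 0 < Λ := by linarith
  -- `K₀ + 1` for the initialization and the second order terms, `L + 2` for the first order growth,
  -- `1` for strictness.
  set D := K₀ + L + 4 with hD
  have hD1 : 1 ≤ D := by linarith
  have hD0 : 0 < D := by linarith
  have hDL : 1 ≤ D ^ L := one_le_pow₀ hD1
  set c := 1 / (3 * Λ ^ 2 * D ^ L) with hc
  have hc0 : 0 < c := by positivity
  have hc1 : c ≤ 1 := by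
    rw [hc, div_le_one (by positivity)]
    have := one_le_mul_of_one_le_of_one_le (one_le_pow₀ hΛ1 (n := 2)) hDL
    rw [mul_assoc]
    linarith only [this]
  set β := ((L : ℝ) + 2) * α - ((L : ℝ) + 1) with hβ
  have hβ0 : 0 < β := by
    rw [div_lt_iff₀ hL2] at hα
    linarith
  have hα0 : 0 < α := lt_trans (by positivity) hα
  -- Capping the exponent below `1` keeps `1 / (1 - α')` bounded in terms of `L`, also for `α = 1`.
  -- Lowering the exponent is harmless since the steps are only bounded from above. In terms of the
  -- excess over the critical exponent, `β' = min β (1/2)`.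
  set α' := min α (((L : ℝ) + 3 / 2) / ((L : ℝ) + 2)) with hα'
  have hα'le : α' ≤ α := min_le_left _ _
  have hα'0 : 0 ≤ α' := le_min hα0.le (by positivity)
  have h1α' : 1 / (2 * ((L : ℝ) + 2)) ≤ 1 - α' := by
    have h1 : α' ≤ ((L : ℝ) + 3 / 2) / ((L : ℝ) + 2) := min_le_right _ _
    have h2 : 1 - ((L : ℝ) + 3 / 2) / ((L : ℝ) + 2) = 1 / (2 * ((L : ℝ) + 2)) := by
      field_simp
      ring
    linarith
  have hα'1 : α' < 1 := by
    have : (0 : ℝ) < 1 / (2 * ((L : ℝ) + 2)) := by positivity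
    linarith
  have hinv : 1 / (1 - α') ≤ 2 * ((L : ℝ) + 2) := by
    rw [div_le_iff₀ (by linarith)]
    rw [div_le_iff₀ (by positivity)] at h1α'
    linarith
  set β' := ((L : ℝ) + 2) * α' - ((L : ℝ) + 1) with hβ'
  have hβ'min : β' = min β (1 / 2) := by
    rw [hβ', hα', mul_min_of_nonneg _ _ hL2.le, ← min_sub_sub_right]
    congr 1
    field_simp
    ring
  have hβ'0 : 0 < β' := by
    rw [hβ'min]
    exact lt_min hβ0 (by norm_num)
  -- The factor `min ε β` in the step size restriction compensates the blow-up `1 / β'` of the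
  -- series at the critical exponent.
  have hratio : min ε β * (1 + 1 / β') ≤ 3 := by
    have hm1 : min ε β ≤ 1 := (min_le_left _ _).trans hε1.le
    have hm2 : min ε β ≤ β := min_le_right _ _
    have hm0 : 0 < min ε β := lt_min hε hβ0
    have : min ε β * (1 / β') ≤ 2 := by
      rw [mul_one_div, div_le_iff₀ hβ'0, hβ'min]
      rcases min_cases β (1 / 2 : ℝ) with ⟨h, -⟩ | ⟨h, -⟩ <;> rw [h] <;> linarith
    linarith
  let J : ℕ → ℝ := fun t => ((t / T₀ : ℕ) : ℝ) + 1
  have hJ1 : ∀ t, 1 ≤ J t := fun t => by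
    have : (0 : ℝ) ≤ ((t / T₀ : ℕ) : ℝ) := Nat.cast_nonneg _
    simp only [J]
    linarith
  have hJ0 : ∀ t, 0 < J t := fun t => lt_of_lt_of_le one_pos (hJ1 t)
  have hstep : ∀ t, stepSize η α T₀ t ≤ η * J t ^ (-α') := by
    intro t
    rw [stepSize_eq hT]
    exact mul_le_mul_of_nonneg_left
      (Real.rpow_le_rpow_of_exponent_le (hJ1 t) (by linarith)) hη.le
  have hstep0 : ∀ t, 0 ≤ stepSize η α T₀ t := by
    intro t
    rw [stepSize_eq hT]
    have := hJ0 t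
    positivity
  refine ⟨fun t => D * κ ^ 2 * J t ^ (1 - α'), fun t => ?_, fun t => ?_⟩
  · have hsum : ∑ s ∈ Finset.range t, stepSize η α T₀ s ≤
        η * (T₀ * (J t ^ (1 - α') * (2 * ((L : ℝ) + 2)))) := by
      refine (Finset.sum_le_sum fun s _ => hstep s).trans ?_
      rw [← Finset.mul_sum]
      refine mul_le_mul_of_nonneg_left ?_ hη.le
      refine (sum_range_comp_div_le hT (φ := fun j => ((j : ℝ) + 1) ^ (-α'))
        (fun j => by positivity) t).trans ?_
      refine mul_le_mul_of_nonneg_left ?_ hT0.le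
      refine (sum_rpow_neg_le hα'0 hα'1 _).trans ?_
      rw [div_eq_mul_one_div]
      push_cast
      exact mul_le_mul_of_nonneg_left hinv (Real.rpow_nonneg (hJ0 t).le _)
    have hηT : Cy ^ 2 * (η * T₀) ≤ κ ^ 2 := by
      have h1 : c * (κ ^ 2 * (1 - ε) / (Cy ^ 2 * (T₀ : ℝ))) ≤ κ ^ 2 / (Cy ^ 2 * (T₀ : ℝ)) := by
        rw [← mul_div_assoc]
        refine div_le_div_of_nonneg_right ?_ (by positivity)
        have h2 : 0 ≤ κ ^ 2 * (1 - ε) := mul_nonneg (sq_nonneg _) (by linarith)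
        exact (mul_le_of_le_one_left h2 hc1).trans
          (mul_le_of_le_one_right (sq_nonneg _) (by linarith))
      have h2 := hη2.trans h1
      rw [le_div_iff₀ (by positivity)] at h2
      linarith
    have hJp : 1 ≤ J t ^ (1 - α') := Real.one_le_rpow (hJ1 t) (by linarith)
    have hκ2 : 0 < κ ^ 2 := by positivity
    calc K₀ * κ ^ 2 + κ ^ 2 + Cy ^ 2 / 2 * ∑ s ∈ Finset.range t, stepSize η α T₀ s
        ≤ K₀ * κ ^ 2 + κ ^ 2 +
          Cy ^ 2 / 2 * (η * (T₀ * (J t ^ (1 - α') * (2 * ((L : ℝ) + 2))))) :=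
          add_le_add le_rfl (mul_le_mul_of_nonneg_left hsum (by positivity))
      _ = K₀ * κ ^ 2 + κ ^ 2 + Cy ^ 2 * (η * T₀) * (J t ^ (1 - α') * ((L : ℝ) + 2)) := by ring
      _ ≤ K₀ * κ ^ 2 + κ ^ 2 + κ ^ 2 * (J t ^ (1 - α') * ((L : ℝ) + 2)) :=
          add_le_add le_rfl (mul_le_mul_of_nonneg_right hηT
            (mul_nonneg (zero_le_one.trans hJp) hL2.le))
      _ < D * κ ^ 2 * J t ^ (1 - α') := by
          have e : D * κ ^ 2 * J t ^ (1 - α') = (K₀ + 1) * κ ^ 2 * J t ^ (1 - α') +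
              κ ^ 2 * (J t ^ (1 - α') * ((L : ℝ) + 2)) + κ ^ 2 * J t ^ (1 - α') := by
            rw [hD]
            ring
          have h3 : (K₀ + 1) * κ ^ 2 ≤ (K₀ + 1) * κ ^ 2 * J t ^ (1 - α') :=
            le_mul_of_one_le_right (by positivity) hJp
          have h4 := mul_pos hκ2 (lt_of_lt_of_le one_pos hJp)
          rw [e]
          linarith only [h3, h4]
  · have hterm : ∀ s, stepSize η α T₀ s ^ 2 * (M ^ 2 * (D * κ ^ 2 * J s ^ (1 - α')) ^ L) ≤
        η ^ 2 * M ^ 2 * (D * κ ^ 2) ^ L * J s ^ (-(1 + β')) := by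
      intro s
      have h1 : stepSize η α T₀ s ^ 2 ≤ (η * J s ^ (-α')) ^ 2 :=
        pow_le_pow_left₀ (hstep0 s) (hstep s) 2
      -- Squared steps times the `L`-th power of the radii: `-2α' + L (1 - α') = -(1 + β')`, hence
      -- the threshold `(L + 1) / (L + 2)`.
      have h2 : (J s ^ (-α')) ^ 2 * (J s ^ (1 - α')) ^ L = J s ^ (-(1 + β')) := by
        rw [← Real.rpow_natCast, ← Real.rpow_natCast, ← Real.rpow_mul (hJ0 s).le,
          ← Real.rpow_mul (hJ0 s).le, ← Real.rpow_add (hJ0 s)]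
        congr 1
        rw [hβ']
        push_cast
        ring
      have h3 : 0 ≤ M ^ 2 * (D * κ ^ 2 * J s ^ (1 - α')) ^ L := by
        have := hJ0 s
        positivity
      refine (mul_le_mul_of_nonneg_right h1 h3).trans (le_of_eq ?_)
      rw [← h2]
      ring_nf
    refine (Finset.sum_le_sum fun s _ => hterm s).trans ?_
    rw [← Finset.mul_sum]
    have hsum : ∑ s ∈ Finset.range t, J s ^ (-(1 + β')) ≤ T₀ * (1 + 1 / β') := by
      refine (sum_range_comp_div_le hT (φ := fun j => ((j : ℝ) + 1) ^ (-(1 + β')))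
        (fun j => by positivity) t).trans ?_
      exact mul_le_mul_of_nonneg_left (sum_rpow_neg_one_sub_le hβ'0 _) hT0.le
    have hm0 : 0 < min ε β := lt_min hε hβ0
    have hηM : η * (M * ((T₀ : ℝ) ^ ((1 + ε) / 2) * κ ^ (L - 1))) ≤ c * Λ * Real.sqrt (min ε β) := by
      rw [← mul_div_assoc, le_div_iff₀ (by positivity)] at hη1
      linarith
    have hηM2 : η ^ 2 * M ^ 2 * (T₀ * (κ ^ (L - 1)) ^ 2) ≤ c ^ 2 * Λ ^ 2 * min ε β := by
      have h1 := pow_le_pow_left₀ (by positivity) hηM 2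
      rw [mul_pow, mul_pow, mul_pow, mul_pow, mul_pow, Real.sq_sqrt hm0.le] at h1
      refine le_trans ?_ h1
      have h2 : (T₀ : ℝ) ≤ ((T₀ : ℝ) ^ ((1 + ε) / 2)) ^ 2 := by
        rw [← Real.rpow_natCast, ← Real.rpow_mul hT0.le]
        conv_lhs => rw [← Real.rpow_one (T₀ : ℝ)]
        refine Real.rpow_le_rpow_of_exponent_le hT' ?_
        push_cast
        linarith
      calc η ^ 2 * M ^ 2 * (T₀ * (κ ^ (L - 1)) ^ 2)
          ≤ η ^ 2 * M ^ 2 * (((T₀ : ℝ) ^ ((1 + ε) / 2)) ^ 2 * (κ ^ (L - 1)) ^ 2) :=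
          mul_le_mul_of_nonneg_left (mul_le_mul_of_nonneg_right h2 (sq_nonneg _)) (by positivity)
        _ = _ := by ring
    have hκL : (D * κ ^ 2) ^ L = D ^ L * (κ ^ (L - 1)) ^ 2 * κ ^ 2 := by
      obtain ⟨k, rfl⟩ : ∃ k, L = k + 1 := ⟨L - 1, by omega⟩
      rw [Nat.add_sub_cancel]
      ring_nf
    calc η ^ 2 * M ^ 2 * (D * κ ^ 2) ^ L * ∑ s ∈ Finset.range t, J s ^ (-(1 + β'))
        ≤ η ^ 2 * M ^ 2 * (D * κ ^ 2) ^ L * (T₀ * (1 + 1 / β')) :=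
          mul_le_mul_of_nonneg_left hsum (by positivity)
      _ = η ^ 2 * M ^ 2 * (T₀ * (κ ^ (L - 1)) ^ 2) * (D ^ L * κ ^ 2 * (1 + 1 / β')) := by
          rw [hκL]
          ring
      _ ≤ c ^ 2 * Λ ^ 2 * min ε β * (D ^ L * κ ^ 2 * (1 + 1 / β')) :=
          mul_le_mul_of_nonneg_right hηM2 (by positivity)
      _ = c * κ ^ 2 * (c * (Λ ^ 2 * D ^ L)) * (min ε β * (1 + 1 / β')) := by ring
      _ ≤ c * κ ^ 2 * (c * (Λ ^ 2 * D ^ L)) * 3 :=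
          mul_le_mul_of_nonneg_left hratio (by positivity)
      _ = c * κ ^ 2 := by
          rw [hc]
          field_simp
      _ ≤ κ ^ 2 := mul_le_of_le_one_left (sq_nonneg _) hc1

/-! ### Gaussian initialization -/

theorem integral_sq_gaussianReal (v : NNReal) : ∫ x, x ^ 2 ∂(gaussianReal 0 v) = v := by
  have h := variance_fun_id_gaussianReal (μ := 0) (v := v)
  rw [variance_eq_integral (by fun_prop)] at h
  simpa [integral_id_gaussianReal] using h

theorem integrable_sq_gaussianReal (v : NNReal) :
    Integrable (fun x : ℝ => x ^ 2) (gaussianReal 0 v) :=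
  (memLp_id_gaussianReal (μ := 0) (v := v) 2).integrable_sq

namespace Arch

instance (A : Arch) (κ : ℝ) : IsProbabilityMeasure (A.initLaw κ) := by
  unfold initLaw
  infer_instance

theorem sum_layer_variance (A : Arch) (κ : ℝ) {l : ℕ} (hl : l ≤ A.LC + A.LF) :
    (∑ i, if A.layerNo i = l then κ ^ 2 / (A.layerSize i : ℝ) else 0) = κ ^ 2 := by
  rcases lt_or_ge l A.LC with h | h
  · rw [A.sum_layer_conv ⟨l, h⟩ (fun i => κ ^ 2 / (A.layerSize i : ℝ))]
    have : (A.s l : ℝ) ≠ 0 := by exact_mod_cast Nat.one_le_iff_ne_zero.1 (A.s_pos l h)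
    simp only [layerSize, Finset.sum_const, Finset.card_univ, Fintype.card_fin, nsmul_eq_mul]
    field_simp
  obtain ⟨k, rfl⟩ : ∃ k, l = A.LC + k := ⟨l - A.LC, by omega⟩
  rcases lt_or_ge k A.LF with h' | h'
  · rw [A.sum_layer_fc ⟨k, h'⟩ (fun i => κ ^ 2 / (A.layerSize i : ℝ))]
    have h1 : (A.m (A.LC + k) : ℝ) ≠ 0 := by exact_mod_cast Nat.one_le_iff_ne_zero.1 (A.m_pos _ hl)
    have h2 : (A.m (A.LC + k + 1) : ℝ) ≠ 0 := by
      exact_mod_cast Nat.one_le_iff_ne_zero.1 (A.m_pos (A.LC + k + 1) (by omega))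
    simp only [layerSize, Finset.sum_const, Finset.card_univ, Fintype.card_prod, Fintype.card_fin,
      nsmul_eq_mul]
    push_cast
    field_simp
  · obtain rfl : k = A.LF := by omega
    rw [A.sum_layer_out (fun i => κ ^ 2 / (A.layerSize i : ℝ))]
    have : ((A.width : ℕ) : ℝ) ≠ 0 := by exact_mod_cast Nat.one_le_iff_ne_zero.1 (A.m_pos _ le_rfl)
    simp only [layerSize, Finset.sum_const, Finset.card_univ, Fintype.card_fin, nsmul_eq_mul]
    field_simp

theorem integrable_eval_sq_initLaw (A : Arch) (κ : ℝ) (i : A.Idx) :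
    Integrable (fun Θ : A.Params => Θ i ^ 2) (A.initLaw κ) :=
  (measurePreserving_eval (fun i => gaussianReal 0 (κ ^ 2 / (A.layerSize i : ℝ)).toNNReal)
    i).integrable_comp_of_integrable (integrable_sq_gaussianReal _)

theorem integral_eval_sq_initLaw (A : Arch) (κ : ℝ) (i : A.Idx) :
    ∫ Θ, Θ i ^ 2 ∂(A.initLaw κ) = κ ^ 2 / (A.layerSize i : ℝ) := by
  rw [initLaw, integral_comp_eval
    (μ := fun i => gaussianReal 0 (κ ^ 2 / (A.layerSize i : ℝ)).toNNReal) (f := fun x => x ^ 2)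
    (by fun_prop), integral_sq_gaussianReal, Real.coe_toNNReal _ (by positivity)]

theorem integrable_layerSq_initLaw (A : Arch) (κ : ℝ) (l : ℕ) :
    Integrable (fun Θ => A.layerSq Θ l) (A.initLaw κ) := by
  refine integrable_finsetSum _ fun i _ => ?_
  split_ifs
  · exact A.integrable_eval_sq_initLaw κ i
  · exact integrable_zero _ _ _

theorem integral_layerSq_initLaw (A : Arch) (κ : ℝ) {l : ℕ} (hl : l ≤ A.LC + A.LF) :
    ∫ Θ, A.layerSq Θ l ∂(A.initLaw κ) = κ ^ 2 := by
  rw [← A.sum_layer_variance κ hl]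
  unfold layerSq
  rw [integral_finsetSum]
  · refine Finset.sum_congr rfl fun i _ => ?_
    split_ifs
    · exact A.integral_eval_sq_initLaw κ i
    · simp
  · intro i _
    split_ifs
    · exact A.integrable_eval_sq_initLaw κ i
    · exact integrable_zero _ _ _

/-- Each squared layer norm has mean `κ²`; Markov's inequality and a union bound over the `L + 1`
layers. -/
theorem initLaw_exists_layerSq_gt_le (A : Arch) {κ K₀ : ℝ} (hκ : 0 < κ) (hK₀ : 0 < K₀) :
    A.initLaw κ {Θ | ∃ l ≤ A.LC + A.LF, K₀ * κ ^ 2 < A.layerSq Θ l} ≤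
      ENNReal.ofReal (((A.L : ℝ) + 1) / K₀) := by
  have h1 : ∀ l ∈ Finset.range (A.L + 1),
      A.initLaw κ {Θ | K₀ * κ ^ 2 ≤ A.layerSq Θ l} ≤ ENNReal.ofReal (1 / K₀) := by
    intro l hl
    have hl' : l ≤ A.LC + A.LF := Nat.lt_succ_iff.1 (Finset.mem_range.1 hl)
    have h2 := mul_meas_ge_le_integral_of_nonneg (μ := A.initLaw κ)
      (ae_of_all _ fun Θ => A.layerSq_nonneg Θ l) (A.integrable_layerSq_initLaw κ l) (K₀ * κ ^ 2)
    rw [A.integral_layerSq_initLaw κ hl'] at h2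
    rw [← ofReal_measureReal]
    refine ENNReal.ofReal_le_ofReal ?_
    rw [le_div_iff₀ hK₀]
    have hκ2 : 0 < κ ^ 2 := by positivity
    refine le_of_mul_le_mul_right ?_ hκ2
    linarith
  have hsub : {Θ : A.Params | ∃ l ≤ A.LC + A.LF, K₀ * κ ^ 2 < A.layerSq Θ l} ⊆
      ⋃ l ∈ Finset.range (A.L + 1), {Θ | K₀ * κ ^ 2 ≤ A.layerSq Θ l} := by
    rintro Θ ⟨l, hl, h⟩
    simp only [Set.mem_iUnion]
    exact ⟨l, Finset.mem_range.2 (Nat.lt_succ_of_le hl), h.le⟩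
  refine (measure_mono hsub).trans ((measure_biUnion_finset_le _ _).trans
    ((Finset.sum_le_sum h1).trans (le_of_eq ?_)))
  rw [Finset.sum_const, Finset.card_range, nsmul_eq_mul, ← ENNReal.ofReal_natCast,
    ← ENNReal.ofReal_mul (by positivity)]
  congr 1
  push_cast
  ring

end Arch

/-! ### Truncated loss: bounded and Lipschitz on the whole parameter space -/

/-- Truncation of a real number to the interval `[-c, c]`. -/
noncomputable def clip (c t : ℝ) : ℝ := max (-c) (min c t)

theorem abs_clip_le {c : ℝ} (hc : 0 ≤ c) (t : ℝ) : |clip c t| ≤ c :=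
  abs_le.2 ⟨le_max_left _ _, max_le (by linarith) (min_le_left _ _)⟩

theorem clip_eq_self {c t : ℝ} (h : |t| ≤ c) : clip c t = t := by
  rw [clip, min_eq_right (abs_le.1 h).2, max_eq_right (abs_le.1 h).1]

theorem abs_clip_sub_clip_le (c s t : ℝ) : |clip c s - clip c t| ≤ |s - t| := by
  refine (abs_max_sub_max_le_max _ _ _ _).trans ?_
  rw [sub_self, abs_zero, max_eq_right (abs_nonneg _)]
  refine (abs_min_sub_min_le_max _ _ _ _).trans ?_
  rw [sub_self, abs_zero, max_eq_right (abs_nonneg _)]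

theorem continuous_clip (c : ℝ) : Continuous (clip c) := by
  unfold clip
  fun_prop

namespace Arch

variable {A : Arch} {n : ℕ} {p r Cf Cy : ℝ}

/-- The quadratic loss of the truncated network on a truncated label. -/
noncomputable def clippedLoss (A : Arch) (p Cf Cy : ℝ) (Θ : A.Params) (z : (Fin A.d → ℝ) × ℝ) : ℝ :=
  (1 / 2) * (clip Cf (A.net p Θ z.1) - clip Cy z.2) ^ 2

theorem abs_clippedLoss_le (hCf : 0 ≤ Cf) (hCy : 0 ≤ Cy) (Θ : A.Params)
    (z : (Fin A.d → ℝ) × ℝ) : |A.clippedLoss p Cf Cy Θ z| ≤ (Cf + Cy) ^ 2 / 2 := by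
  have h : |clip Cf (A.net p Θ z.1) - clip Cy z.2| ≤ Cf + Cy :=
    (abs_sub _ _).trans (add_le_add (abs_clip_le hCf _) (abs_clip_le hCy _))
  have h2 := pow_le_pow_left₀ (abs_nonneg _) h 2
  rw [sq_abs] at h2
  rw [clippedLoss, abs_of_nonneg (by positivity)]
  linarith

theorem clippedLoss_eq_loss {Θ : A.Params} {z : (Fin A.d → ℝ) × ℝ} (hf : |A.net p Θ z.1| ≤ Cf)
    (hy : |z.2| ≤ Cy) : A.clippedLoss p Cf Cy Θ z = A.loss p Θ z := by
  rw [clippedLoss, loss, clip_eq_self hf, clip_eq_self hy]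

theorem continuous_clippedLoss_left (z : (Fin A.d → ℝ) × ℝ) :
    Continuous fun Θ => A.clippedLoss p Cf Cy Θ z := by
  have h1 := A.continuous_net_left p z.1
  have h2 := continuous_clip
  unfold clippedLoss
  fun_prop

theorem measurable_clippedLoss (Θ : A.Params) : Measurable (A.clippedLoss p Cf Cy Θ) := by
  refine Continuous.measurable ?_
  have h1 : Continuous (A.net p Θ) :=
    (A.continuous_net p).comp (Continuous.prodMk continuous_const continuous_id)
  have h2 := continuous_clip
  unfold clippedLoss
  fun_prop

theorem abs_sq_clip_sub_le (hCf : 0 ≤ Cf) (hCy : 0 ≤ Cy) (y s t : ℝ) :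
    |(1 / 2) * (clip Cf s - clip Cy y) ^ 2 - (1 / 2) * (clip Cf t - clip Cy y) ^ 2| ≤
      (Cf + Cy) * |s - t| := by
  have e : (1 / 2) * (clip Cf s - clip Cy y) ^ 2 - (1 / 2) * (clip Cf t - clip Cy y) ^ 2 =
      ((1 / 2) * (clip Cf s - clip Cy y) + (1 / 2) * (clip Cf t - clip Cy y)) *
        (clip Cf s - clip Cf t) := by ring
  rw [e, abs_mul]
  refine mul_le_mul ?_ (abs_clip_sub_clip_le _ _ _) (abs_nonneg _) (by positivity)
  have h1 := abs_le.1 (abs_clip_le hCf s)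
  have h2 := abs_le.1 (abs_clip_le hCf t)
  have h3 := abs_le.1 (abs_clip_le hCy y)
  rw [abs_le]
  constructor <;> linarith

theorem sum_signedSum_clippedLoss_le (hn : 1 ≤ n) (hr : 0 < r) (hCf : 0 ≤ Cf) (hCy : 0 ≤ Cy)
    {S : Fin n → (Fin A.d → ℝ) × ℝ} (hx : ∀ i, euc (S i).1 ≤ 1)
    (h : (Fin n → ℤˣ) → A.layerBall r) :
    ∑ ε, signedSum ε (fun i => A.clippedLoss p Cf Cy (h ε) (S i)) ≤
      2 ^ n * (n * ((Cf + Cy) * ((1 / (A.width : ℝ) ^ p) * r ^ (A.L + 1) * A.CLd) /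
        Real.sqrt n)) := by
  have hn' : (0 : ℝ) < n := by exact_mod_cast hn
  -- Contraction: the truncated loss is `(Cf + Cy)`-Lipschitz in the prediction, so its Rademacher
  -- average reduces to that of the networks.
  obtain ⟨h', hh'⟩ := exists_selection_lipschitz (P := A.layerBall r)
    (v := fun Θ i => A.net p Θ (S i).1)
    (φ := fun i t => (1 / 2) * (clip Cf t - clip Cy (S i).2) ^ 2) (M := Cf + Cy)
    (fun i s t => abs_sq_clip_sub_le hCf hCy _ s t) h
  refine hh'.trans ?_
  simp only [signedSum_const_mul]
  rw [← Finset.mul_sum]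
  refine (mul_le_mul_of_nonneg_left (sum_signedSum_net_le p hn hr hx h')
    (by positivity)).trans (le_of_eq ?_)
  have hs : (n : ℝ) / Real.sqrt n = Real.sqrt n := Real.div_sqrt
  rw [mul_div_left_comm, hs]
  ring

/-- Uniform deviation of the truncated loss over the networks of bounded layer norms. -/
theorem measure_clippedGap_le (hn : 1 ≤ n) (hr : 0 < r) (hCf : 0 < Cf) (hCy : 0 < Cy)
    (μ : Measure ((Fin A.d → ℝ) × ℝ)) [IsProbabilityMeasure μ]
    (hμ : ∀ᵐ z ∂μ, euc z.1 ≤ 1) {t : ℝ} (ht : 0 ≤ t) :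
    (Measure.pi fun _ : Fin n => μ) {S | ∃ Θ ∈ A.layerBall r,
        2 * ((Cf + Cy) * ((1 / (A.width : ℝ) ^ p) * r ^ (A.L + 1) * A.CLd) / Real.sqrt n) + t <
          ∫ z, A.clippedLoss p Cf Cy Θ z ∂μ -
            (1 / (n : ℝ)) * ∑ i, A.clippedLoss p Cf Cy Θ (S i)} ≤
      ENNReal.ofReal (Real.exp (-(n * t ^ 2 / (8 * ((Cf + Cy) ^ 2 / 2) ^ 2)))) := by
  refine measure_exists_gap_le (f := A.clippedLoss p Cf Cy) hn (by positivity) ht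
    measurable_clippedLoss continuous_clippedLoss_left (abs_clippedLoss_le hCf.le hCy.le) μ ?_
  have hae : ∀ᵐ S ∂(Measure.pi fun _ : Fin n => μ), ∀ i, euc (S i).1 ≤ 1 :=
    eventually_all.2 fun i =>
      (measurePreserving_eval (fun _ : Fin n => μ) i).quasiMeasurePreserving.ae hμ
  filter_upwards [hae] with S hS θ
  exact sum_signedSum_clippedLoss_le hn hr hCf.le hCy.le hS θ

end Arch

/-! ### Dyadic levels for the random radius -/

/-- The radius at which the complexity of the class of networks equals `2 ^ j * (Cf + Cy)`. -/
noncomputable def Arch.levelRadius (A : Arch) (p b : ℝ) (j : ℕ) : ℝ :=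
  (2 ^ j * b * (A.width : ℝ) ^ p / A.CLd) ^ (((A.L + 1 : ℕ) : ℝ)⁻¹)

/-- The deviation that the sampling noise causes on level `j`. -/
noncomputable def levelNoise (b δ : ℝ) (n j : ℕ) : ℝ :=
  b ^ 2 / 2 * Real.sqrt (8 * (Real.log (2 / δ) + (j + 1) * Real.log 2) / n)

/-- The price `(j + 1) log 2` of the union over levels is at most `4^j`, so its root is absorbed by
the complexity `2^j` of the level. -/
theorem levelNoise_le {b δ : ℝ} (hδ : 0 < δ) (hδ1 : δ < 1) (n j : ℕ) :
    levelNoise b δ n j ≤ 3 / 2 * b ^ 2 *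
      (Real.sqrt (Real.log (2 / δ) / n) + 2 ^ j / Real.sqrt n) := by
  have hlog : 0 ≤ Real.log (2 / δ) := Real.log_nonneg (by rw [le_div_iff₀ hδ]; linarith)
  have hl2 : 0 ≤ Real.log 2 := Real.log_nonneg one_le_two
  have h1 : Real.sqrt (8 * (Real.log (2 / δ) + (j + 1) * Real.log 2) / n) ≤
      3 * (Real.sqrt (Real.log (2 / δ) / n) + 2 ^ j / Real.sqrt n) := by
    have e : 8 * (Real.log (2 / δ) + (j + 1) * Real.log 2) / (n : ℝ) ≤
        9 * (Real.log (2 / δ) / n + (2 ^ j / Real.sqrt n) ^ 2) := by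
      rw [div_pow, Real.sq_sqrt (Nat.cast_nonneg n), ← add_div, ← mul_div_assoc]
      refine div_le_div_of_nonneg_right ?_ (Nat.cast_nonneg n)
      have h2 : ((j : ℝ) + 1) * Real.log 2 ≤ (2 ^ j) ^ 2 := by
        have h3 : ((j : ℝ) + 1) ≤ 2 ^ j := by exact_mod_cast Nat.succ_le_of_lt j.lt_two_pow_self
        have h4 : (1 : ℝ) ≤ 2 ^ j := one_le_pow₀ one_le_two
        have h5 : Real.log 2 ≤ 1 := by linarith [Real.log_two_lt_d9]
        have h6 := mul_le_mul h3 (h5.trans h4) hl2 (by positivity)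
        rwa [sq]
      nlinarith [sq_nonneg ((2 : ℝ) ^ j)]
    rw [Real.sqrt_le_left (by positivity)]
    refine e.trans ?_
    rw [mul_pow, show (3 : ℝ) ^ 2 = 9 by norm_num]
    refine mul_le_mul_of_nonneg_left ?_ (by norm_num)
    have h7 : Real.sqrt (Real.log (2 / δ) / n) ^ 2 = Real.log (2 / δ) / n :=
      Real.sq_sqrt (by positivity)
    have h8 : 0 ≤ Real.sqrt (Real.log (2 / δ) / n) * (2 ^ j / Real.sqrt n) := by positivity
    nlinarith
  rw [levelNoise]
  calc b ^ 2 / 2 * Real.sqrt (8 * (Real.log (2 / δ) + (j + 1) * Real.log 2) / n)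
      ≤ b ^ 2 / 2 * (3 * (Real.sqrt (Real.log (2 / δ) / n) + 2 ^ j / Real.sqrt n)) := by gcongr
    _ = _ := by ring

theorem exp_neg_levelNoise {b δ : ℝ} (hb : 0 < b) (hδ : 0 < δ) (hδ1 : δ < 1) {n : ℕ} (hn : 1 ≤ n)
    (j : ℕ) : Real.exp (-(n * levelNoise b δ n j ^ 2 / (8 * (b ^ 2 / 2) ^ 2))) =
      δ / 2 * (1 / 2) ^ (j + 1) := by
  have hn' : (0 : ℝ) < n := by exact_mod_cast hn
  have hlog : 0 ≤ Real.log (2 / δ) := Real.log_nonneg (by rw [le_div_iff₀ hδ]; linarith)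
  have hl2 : 0 ≤ Real.log 2 := Real.log_nonneg one_le_two
  have e : -(n * levelNoise b δ n j ^ 2 / (8 * (b ^ 2 / 2) ^ 2)) =
      -Real.log (2 / δ) + ((j + 1 : ℕ) : ℝ) * -Real.log 2 := by
    rw [levelNoise, mul_pow, Real.sq_sqrt (by positivity)]
    field_simp
    push_cast
    ring
  rw [e, Real.exp_add, Real.exp_nat_mul, Real.exp_neg, Real.exp_neg,
    Real.exp_log (by positivity), Real.exp_log two_pos, inv_div, one_div]

/-- The smallest admissible `j`: if it is positive, `j - 1` fails and `2^j b < 2X`. -/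
theorem exists_level {b X : ℝ} (hb : 0 < b) (hX : 0 ≤ X) :
    ∃ j : ℕ, X ≤ 2 ^ j * b ∧ 2 ^ j * b ≤ b + 2 * X := by
  classical
  have hex : ∃ j : ℕ, X ≤ 2 ^ j * b := by
    obtain ⟨j, hj⟩ := pow_unbounded_of_one_lt (X / b) one_lt_two
    exact ⟨j, by rw [div_lt_iff₀ hb] at hj; exact hj.le⟩
  refine ⟨Nat.find hex, Nat.find_spec hex, ?_⟩
  rcases h : Nat.find hex with _ | j
  · simp
    exact hX
  · have h1 := Nat.find_min hex (m := j) (by omega)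
    rw [pow_succ]
    linarith

namespace Arch

variable {A : Arch} {n : ℕ} {p Cf Cy δ : ℝ}

theorem levelRadius_pos {b : ℝ} (hb : 0 < b) (j : ℕ) : 0 < A.levelRadius p b j := by
  have := A.CLd_pos
  have := A.width_rpow_pos p
  exact Real.rpow_pos_of_pos (by positivity) _

theorem levelRadius_pow {b : ℝ} (hb : 0 < b) (j : ℕ) :
    A.levelRadius p b j ^ (A.L + 1) = 2 ^ j * b * (A.width : ℝ) ^ p / A.CLd := by
  have := A.CLd_pos
  have := A.width_rpow_pos p
  exact Real.rpow_inv_natCast_pow (by positivity) (Nat.succ_ne_zero _)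

/-- The samples on which the truncated loss deviates too much on level `j`. -/
def badSamples (A : Arch) (p Cf Cy δ : ℝ) (n : ℕ) (μ : Measure ((Fin A.d → ℝ) × ℝ)) (j : ℕ) :
    Set (Fin n → (Fin A.d → ℝ) × ℝ) :=
  {S | ∃ Θ ∈ A.layerBall (A.levelRadius p (Cf + Cy) j),
    2 * ((Cf + Cy) * (2 ^ j * (Cf + Cy)) / Real.sqrt n) + levelNoise (Cf + Cy) δ n j <
      ∫ z, A.clippedLoss p Cf Cy Θ z ∂μ - (1 / (n : ℝ)) * ∑ i, A.clippedLoss p Cf Cy Θ (S i)}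

theorem measure_iUnion_badSamples_le (hn : 1 ≤ n) (hCf : 0 < Cf) (hCy : 0 < Cy) (hδ : 0 < δ)
    (hδ1 : δ < 1) (μ : Measure ((Fin A.d → ℝ) × ℝ)) [IsProbabilityMeasure μ]
    (hμ : ∀ᵐ z ∂μ, euc z.1 ≤ 1) :
    (Measure.pi fun _ : Fin n => μ) (⋃ j, A.badSamples p Cf Cy δ n μ j) ≤
      ENNReal.ofReal (δ / 2) := by
  have hb : 0 < Cf + Cy := by linarith
  have hj : ∀ j, (Measure.pi fun _ : Fin n => μ) (A.badSamples p Cf Cy δ n μ j) ≤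
      ENNReal.ofReal (δ / 2 * (1 / 2) ^ (j + 1)) := by
    intro j
    have h1 := measure_clippedGap_le (p := p) hn (A.levelRadius_pos (p := p) hb j) hCf hCy μ hμ
      (t := levelNoise (Cf + Cy) δ n j) (by unfold levelNoise; positivity)
    have e : (1 / (A.width : ℝ) ^ p) * A.levelRadius p (Cf + Cy) j ^ (A.L + 1) * A.CLd =
        2 ^ j * (Cf + Cy) := by
      have := A.CLd_pos
      have := A.width_rpow_pos p
      rw [levelRadius_pow hb]
      field_simp
    rw [exp_neg_levelNoise hb hδ hδ1 hn, e] at h1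
    exact h1
  have hsum : HasSum (fun j : ℕ => δ / 2 * (1 / 2) ^ (j + 1)) (δ / 2) := by
    have := (hasSum_geometric_two.mul_left (δ / 2 * (1 / 2)))
    have e1 : (fun j : ℕ => δ / 2 * (1 / 2) ^ (j + 1)) =
        fun j => δ / 2 * (1 / 2) * (1 / 2) ^ j := by
      ext j
      rw [pow_succ]
      ring
    rw [show δ / 2 * (1 / 2) * 2 = δ / 2 by ring] at this
    rwa [e1]
  refine (measure_iUnion_le _).trans ((ENNReal.tsum_le_tsum hj).trans (le_of_eq ?_))
  rw [← ENNReal.ofReal_tsum_of_nonneg (fun j => by positivity) hsum.summable, hsum.tsum_eq]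

theorem gap_le_of_notMem_badSamples (hn : 1 ≤ n) (hCf : 0 < Cf) (hCy : 0 < Cy) (hδ : 0 < δ)
    (hδ1 : δ < 1) {μ : Measure ((Fin A.d → ℝ) × ℝ)} {S : Fin n → (Fin A.d → ℝ) × ℝ}
    (hS : ∀ j, S ∉ A.badSamples p Cf Cy δ n μ j) {Θ : A.Params} {R : ℝ} (hR : 0 ≤ R)
    (hΘ : ∀ l ≤ A.LC + A.LF, A.layerSq Θ l ≤ R) :
    ∫ z, A.clippedLoss p Cf Cy Θ z ∂μ - (1 / (n : ℝ)) * ∑ i, A.clippedLoss p Cf Cy Θ (S i) ≤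
      9 * ((Cf + Cy) * (A.CLd / ((A.width : ℝ) ^ p * Real.sqrt n)) *
        R ^ (((A.L : ℝ) + 1) / 2) + (Cf + Cy) ^ 2 * Real.sqrt (Real.log (2 / δ) / n)) := by
  have hn' : (0 : ℝ) < n := by exact_mod_cast hn
  have hsn : 0 < Real.sqrt n := Real.sqrt_pos.2 hn'
  have hC := A.CLd_pos
  have hw := A.width_rpow_pos p
  set b := Cf + Cy with hb
  have hb0 : 0 < b := by linarith
  set X := A.CLd / (A.width : ℝ) ^ p * R ^ (((A.L : ℝ) + 1) / 2) with hX
  have hX0 : 0 ≤ X := by positivity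
  obtain ⟨j, hj1, hj2⟩ := exists_level hb0 hX0
  have hball : Θ ∈ A.layerBall (A.levelRadius p b j) := by
    intro l hl
    refine (Real.sqrt_le_sqrt (hΘ l hl)).trans ?_
    refine le_of_pow_le_pow_left₀ (Nat.succ_ne_zero A.L) (A.levelRadius_pos hb0 j).le ?_
    rw [levelRadius_pow hb0, le_div_iff₀ hC]
    have e : Real.sqrt R ^ (A.L + 1) = R ^ (((A.L : ℝ) + 1) / 2) := by
      rw [Real.sqrt_eq_rpow, ← Real.rpow_natCast, ← Real.rpow_mul hR]
      congr 1
      push_cast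
      ring
    rw [e]
    calc R ^ (((A.L : ℝ) + 1) / 2) * A.CLd = X * (A.width : ℝ) ^ p := by
          rw [hX]
          field_simp
      _ ≤ 2 ^ j * b * (A.width : ℝ) ^ p := mul_le_mul_of_nonneg_right hj1 hw.le
  have h1 : ∫ z, A.clippedLoss p Cf Cy Θ z ∂μ -
      (1 / (n : ℝ)) * ∑ i, A.clippedLoss p Cf Cy Θ (S i) ≤
      2 * (b * (2 ^ j * b) / Real.sqrt n) + levelNoise b δ n j := by
    by_contra hcon
    exact hS j ⟨Θ, hball, not_le.1 hcon⟩
  refine h1.trans ?_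
  have h2 := levelNoise_le (b := b) hδ hδ1 n j
  set ℓ := Real.sqrt (Real.log (2 / δ) / n) with hℓ
  -- The lowest level contributes `b² / √n` even for small norms; it is absorbed by the noise
  -- because `log (2/δ) ≥ log 2 ≥ 1/4`.
  have hℓ1 : 1 / Real.sqrt n ≤ 2 * ℓ := by
    have h3 : (1 / 2 : ℝ) ^ 2 ≤ Real.log (2 / δ) := by
      have : Real.log 2 ≤ Real.log (2 / δ) :=
        Real.log_le_log two_pos (by rw [le_div_iff₀ hδ]; linarith)
      linarith [Real.log_two_gt_d9]
    have h4 := Real.le_sqrt_of_sq_le h3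
    rw [hℓ, Real.sqrt_div' _ hn'.le, ← mul_div_assoc]
    exact div_le_div_of_nonneg_right (by linarith) hsn.le
  have h5 : b * (2 ^ j * b) / Real.sqrt n ≤ b ^ 2 * (2 * ℓ) + 2 * (b * X / Real.sqrt n) := by
    calc b * (2 ^ j * b) / Real.sqrt n ≤ b * (b + 2 * X) / Real.sqrt n := by gcongr
      _ = b ^ 2 * (1 / Real.sqrt n) + 2 * (b * X / Real.sqrt n) := by ring
      _ ≤ _ := by gcongr
  have h6 : b ^ 2 * (2 ^ j / Real.sqrt n) = b * (2 ^ j * b) / Real.sqrt n := by ring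
  have h7 : b * (A.CLd / ((A.width : ℝ) ^ p * Real.sqrt n)) * R ^ (((A.L : ℝ) + 1) / 2) =
      b * X / Real.sqrt n := by
    rw [hX]
    field_simp
  have h8 : 0 ≤ b * X / Real.sqrt n := by positivity
  have h9 : 0 ≤ b ^ 2 * ℓ := by positivity
  rw [h7]
  have h10 : levelNoise b δ n j ≤ 3 / 2 * (b ^ 2 * ℓ + b * (2 ^ j * b) / Real.sqrt n) := by
    rw [← h6]
    linarith
  -- With `B = b (2^j b) / √n`, `h1` and `h10` give `(7/2) B + (3/2) b² ℓ`; by `h5` this is at most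
  -- `(17/2) b² ℓ + 7 b X / √n`, hence the constant `9`.
  linarith

theorem genError_eq_clipped {μ : Measure ((Fin A.d → ℝ) × ℝ)} {S : Fin n → (Fin A.d → ℝ) × ℝ}
    {Θ : A.Params} (hμ : ∀ᵐ z ∂μ, |z.2| ≤ Cy) (hf : ∀ᵐ z ∂μ, |A.net p Θ z.1| ≤ Cf)
    (hSy : ∀ i, |(S i).2| ≤ Cy) (hSf : ∀ i, |A.net p Θ (S i).1| ≤ Cf) :
    A.genError p μ S Θ =
      ∫ z, A.clippedLoss p Cf Cy Θ z ∂μ - (1 / (n : ℝ)) * ∑ i, A.clippedLoss p Cf Cy Θ (S i) := by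
  rw [genError, popRisk, empRisk]
  congr 1
  · refine integral_congr_ae ?_
    filter_upwards [hμ, hf] with z hz1 hz2
    exact (clippedLoss_eq_loss hz2 hz1).symm
  · congr 1
    exact Finset.sum_congr rfl fun i _ => (clippedLoss_eq_loss (hSf i) (hSy i)).symm

/-- Continuity upgrades the almost sure bound to the whole support. Sample points lie in the support
almost surely, so one null set serves the uncountably many possible runs. -/
theorem abs_net_le_of_mem_support {μ : Measure ((Fin A.d → ℝ) × ℝ)} {Θ : A.Params}
    (hf : ∀ᵐ z ∂μ, |A.net p Θ z.1| ≤ Cf) {z : (Fin A.d → ℝ) × ℝ} (hz : z ∈ μ.support) :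
    |A.net p Θ z.1| ≤ Cf := by
  have hc : Continuous fun z : (Fin A.d → ℝ) × ℝ => |A.net p Θ z.1| :=
    ((A.continuous_net p).comp (Continuous.prodMk continuous_const continuous_fst)).abs
  exact Measure.support_subset_of_isClosed (isClosed_Iic.preimage hc) hf hz

end Arch

/-! ### Assembly -/

theorem theorem2 :
    -- the absolute constant hidden in the final bound
    ∃ K : ℝ, 0 < K ∧
    ∀ (L : ℕ) (δ : ℝ), 1 ≤ L → 0 < δ → δ < 1 →
    -- the constants hidden in `O(κ ^ 2)` and in the restriction on the step size
    ∃ C c : ℝ, 0 < C ∧ 0 < c ∧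
    ∀ (A : Arch) (p κ Cf Cy α ε η : ℝ) (n T₀ T : ℕ) (μ : Measure ((Fin A.d → ℝ) × ℝ)),
      A.L = L → 0 ≤ p → 0 < κ → 0 < Cf → 0 < Cy → Cy ≤ 1 → 0 < ε → ε < 1 → 1 ≤ n → 1 ≤ T₀ →
      ((L : ℝ) + 1) / ((L : ℝ) + 2) < α → α ≤ 1 →
      IsProbabilityMeasure μ →
      (∀ᵐ z ∂μ, ∑ i, z.1 i ^ 2 ≤ 1 ∧ |z.2| ≤ Cy) →
      0 < η →
      η ≤ c * min
        ((A.width : ℝ) ^ p * (L : ℝ) ^ (((L : ℝ) - 1) / 2) *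
            Real.sqrt (min ε (((L : ℝ) + 2) * α - ((L : ℝ) + 1))) /
          ((Cf + Cy) * (T₀ : ℝ) ^ ((1 + ε) / 2) * κ ^ (L - 1)))
        (κ ^ 2 * (1 - ε) / (Cy ^ 2 * (T₀ : ℝ))) →
      -- the sample `ω.1` is i.i.d. with law `μ`, and the initialization `ω.2` is independent of it;
      -- the event that the bound fails for some run of gradient descent whose network functions
      -- are bounded by `Cf` has probability at most `δ`
      ((Measure.pi fun _ : Fin n => μ).prod (A.initLaw κ))
        {ω | ¬ ∀ Θ : ℕ → A.Params, Θ 0 = ω.2 →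
          IsGD A p ω.1 (stepSize η α T₀) T Θ →
          (∀ t ≤ T, ∀ᵐ z ∂μ, |A.net p (Θ t) z.1| ≤ Cf) →
          0 ≤ C * κ ^ 2 + cumLoss A p ω.1 Cy (stepSize η α T₀) Θ T ∧
          A.genError p μ ω.1 (Θ T) ≤
            K * ((Cf + Cy) * (A.CLd / ((A.width : ℝ) ^ p * Real.sqrt n)) *
                (C * κ ^ 2 + cumLoss A p ω.1 Cy (stepSize η α T₀) Θ T) ^ (((L : ℝ) + 1) / 2) +
              (Cf + Cy) ^ 2 * Real.sqrt (Real.log (2 / δ) / n))}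
        ≤ ENNReal.ofReal δ := by
  refine ⟨9, by norm_num, fun L δ hL hδ hδ1 => ?_⟩
  have hL0 : (0 : ℝ) < L := by exact_mod_cast hL
  -- Chosen so that Markov's bound `(L + 1) / K₀` is `δ / 2`; the sampling error takes the other
  -- half.
  set K₀ : ℝ := 2 * ((L : ℝ) + 1) / δ with hK₀
  have hK₀0 : 0 < K₀ := by positivity
  refine ⟨K₀ + 1, 1 / (3 * ((L : ℝ) ^ (((L : ℝ) - 1) / 2)) ^ 2 * (K₀ + L + 4) ^ L),
    by positivity, by positivity, ?_⟩
  intro A p κ Cf Cy α ε η n T₀ T μ hAL hp hκ hCf hCy hCy1 hε hε1 hn hT₀ hα hα1 hμp hμ hη hηle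
  have hw := A.width_rpow_pos p
  have hb : 0 < Cf + Cy := by linarith
  have hμx : ∀ᵐ z ∂μ, euc z.1 ≤ 1 := by
    filter_upwards [hμ] with z hz
    exact euc_le_of_sq_le zero_le_one (by simpa using hz.1)
  have hμy : ∀ᵐ z ∂μ, |z.2| ≤ Cy := by
    filter_upwards [hμ] with z hz using hz.2
  set c : ℝ := 1 / (3 * ((L : ℝ) ^ (((L : ℝ) - 1) / 2)) ^ 2 * (K₀ + L + 4) ^ L) with hc
  have hc0 : 0 ≤ c := by positivity
  obtain ⟨R, hR, hRsum⟩ := exists_radii hL (M := (1 / (A.width : ℝ) ^ p) * (Cf + Cy)) hK₀0 hκ hCy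
    (by positivity) hε hε1 hT₀ hα hη
    (by
      refine hηle.trans ((mul_le_mul_of_nonneg_left (min_le_left _ _) hc0).trans (le_of_eq ?_))
      rw [← hc]
      congr 1
      field_simp)
    (hηle.trans (mul_le_mul_of_nonneg_left (min_le_right _ _) hc0))
  set P := Measure.pi fun _ : Fin n => μ with hP
  let good : Set (Fin n → (Fin A.d → ℝ) × ℝ) :=
    {S | ∀ i, euc (S i).1 ≤ 1 ∧ |(S i).2| ≤ Cy ∧ S i ∈ μ.support}
  have hgood : P goodᶜ = 0 := by
    have : ∀ᵐ S ∂P, ∀ i, euc (S i).1 ≤ 1 ∧ |(S i).2| ≤ Cy ∧ S i ∈ μ.support :=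
      eventually_all.2 fun i =>
        (measurePreserving_eval (fun _ : Fin n => μ) i).quasiMeasurePreserving.ae
          (hμx.and (hμy.and Measure.support_mem_ae))
    exact this
  set E₁ := goodᶜ ∪ ⋃ j, A.badSamples p Cf Cy δ n μ j with hE₁
  set E₂ := {Θ : A.Params | ∃ l ≤ A.LC + A.LF, K₀ * κ ^ 2 < A.layerSq Θ l} with hE₂
  have hPE₁ : P E₁ ≤ ENNReal.ofReal (δ / 2) := by
    refine (measure_union_le _ _).trans ?_
    rw [hgood, zero_add]
    exact Arch.measure_iUnion_badSamples_le hn hCf hCy hδ hδ1 μ hμx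
  have hPE₂ : A.initLaw κ E₂ ≤ ENNReal.ofReal (δ / 2) := by
    refine (A.initLaw_exists_layerSq_gt_le hκ hK₀0).trans (le_of_eq ?_)
    rw [hAL, hK₀]
    congr 1
    field_simp
  -- `E₁` concerns only the sample and `E₂` only the initialization; neither refers to a run, so
  -- outside them the bound holds for all runs at once.
  refine (measure_mono (t := E₁ ×ˢ Set.univ ∪ Set.univ ×ˢ E₂) ?_).trans ?_
  · intro ω hω
    by_contra hcon
    refine hω fun Θ hΘ0 hGD hfb => ?_
    simp only [Set.mem_union, Set.mem_prod, Set.mem_univ, and_true, true_and, not_or, hE₁,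
      Set.mem_compl_iff, not_not, Set.mem_iUnion, not_exists] at hcon
    obtain ⟨⟨hg, hbad⟩, hinit⟩ := hcon
    have hinit' : ∀ l ≤ A.LC + A.LF, A.layerSq (Θ 0) l ≤ K₀ * κ ^ 2 := by
      intro l hl
      rw [hΘ0]
      by_contra h
      exact hinit ⟨l, hl, not_le.1 h⟩
    have hSf : ∀ t ≤ T, ∀ i, |A.net p (Θ t) (ω.1 i).1| ≤ Cf := fun t ht i =>
      Arch.abs_net_le_of_mem_support (hfb t ht) (hg i).2.2
    have hbound : ∀ l ≤ A.LC + A.LF, A.layerSq (Θ T) l ≤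
        (K₀ + 1) * κ ^ 2 + cumLoss A p ω.1 Cy (stepSize η α T₀) Θ T := by
      intro l hl
      have := Arch.layerSq_le_of_isGD hn (fun i => (hg i).1) (fun i => (hg i).2.1)
        (fun t => by unfold stepSize; positivity) hGD hSf hinit' hR (by rw [hAL]; exact hRsum) hl
        le_rfl
      linarith
    have hnonneg := (A.layerSq_nonneg (Θ T) 0).trans (hbound 0 (Nat.zero_le _))
    refine ⟨hnonneg, ?_⟩
    rw [Arch.genError_eq_clipped hμy (hfb T le_rfl) (fun i => (hg i).2.1) (hSf T le_rfl), ← hAL]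
    exact Arch.gap_le_of_notMem_badSamples hn hCf hCy hδ hδ1 hbad hnonneg hbound
  · refine (measure_union_le _ _).trans ?_
    rw [Measure.prod_prod, Measure.prod_prod, measure_univ, measure_univ, mul_one, one_mul]
    refine (add_le_add hPE₁ hPE₂).trans (le_of_eq ?_)
    rw [← ENNReal.ofReal_add (by positivity) (by positivity), add_halves]
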